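/- **Setting.** Let $\mathbb F$ be a field of characteristic zero and $H$ a finite-dimensional semisimple Hopf algebra over $\mathbb F$ with dual $H^*$; $S$ denotes antipodes, and Sweedler notation is used. *Doubles.* The Drinfeld double $D(H)$ is $H^*\otimes H$ with $$(\alpha\otimes h)(\alpha'\otimes h')=\langle\alpha'_{(3)},h_{(1)}\rangle\langle S^{-1}(\alpha'_{(1)}),h_{(3)}\rangle\,\alpha\alpha'_{(2)}\otimes h_{(2)}h',\qquad 1=1_{H^*}\otimes 1_H,$$ $$\Delta(\alpha\otimes h)=(\alpha_{(2)}\otimes h_{(1)})\otimes(\alpha_{(1)}\otimes h_{(2)}),\qquad \epsilon(\alpha\otimes h)=\epsilon(\alpha)\epsilon(h),$$ $$S(\alpha\otimes h)=\langle\alpha_{(1)},h_{(3)}\rangle\langle S^{-1}(\alpha_{(3)}),h_{(1)}\rangle\,S(\alpha_{(2)})\otimes S(h_{(2)}).$$ The Heisenberg double $\mathcal H(H)$ is $H\otimes H^*$ with $(h\otimes\alpha)(h'\otimes\alpha')=\langle\alpha_{(1)},h'_{(2)}\rangle\,hh'_{(1)}\otimes\alpha_{(2)}\alpha'$ and unit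 $1\otimes 1$. The dual $D(H)^*$ is $H\otimes H^*$ with, for a basis $(x_i)$ of $H$ and its dual basis $(\alpha^i)$, $$(y\otimes\gamma)(z\otimes\delta)=zy\otimes\gamma\delta,\qquad \Delta(y\otimes\gamma)=\sum_{i,j}(y_{(1)}\otimes\alpha^i\gamma_{(1)}\alpha^j)\otimes(S(x_j)y_{(2)}x_i\otimes\gamma_{(2)}),\qquad \epsilon(y\otimes\gamma)=\epsilon(y)\epsilon(\gamma),$$ $$S_D(y\otimes\gamma)=\sum_{i,j}x_iS^{-1}(y)x_j\otimes S(\alpha^j)S(\gamma)\alpha^i .$$ In a tensor power $A^{\otimes X}$, $(a)_x$ denotes the pure tensor with entry $a$ at $x\in X$ and $1$ elsewhere. *Graphs.* A ciliated ribbon graph $\Gamma$ is a finite directed graph (vertices $V$, edges $E$) with a linear order on the edge ends at each vertex, thought of as counterclockwise from a cilium placed between the highest and the lowest end; only the induced cyclic order is used to define faces. A path turns maximally right at a vertex if the starting end of the next edge comes directly after the target end of the previous edge in the cyclic order. A face is a cyclic class of closed paths that turn maximally right at each vertex and traverse each edge at most once in each direction. $\Gamma$ is regular if it has no loops and no two distinct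 edges with the same starting vertex and the same target vertex, each face traverses each edge at most once (in either direction), and each face contains exactly one cilium. For a vertex $v$, $f(v)$ is the face path that starts and ends at the cilium at $v$ (leaving along the lowest edge end and returning along the highest one; it is the trivial path if $v$ has no edges). *Holonomies.* To each edge $e$ associate four symbols $r(e),l(e),r(\bar e),l(\bar e)$, with $r(e^{-1})=l(e)^{-1}$ and $r(\bar e^{-1})=l(\bar e)^{-1}$. Define $\mathrm{Hol}_x:H\otimes H^*\to(H\otimes H^*)^{\otimes E}$ by $$\mathrm{Hol}_{r(e)}(y\otimes\gamma)=\epsilon(y)(1\otimes\gamma)_e,\qquad \mathrm{Hol}_{r(\bar e)}(y\otimes\gamma)=\epsilon(\gamma)(y\otimes1)_e,$$ $$\mathrm{Hol}_{l(e)}=S_D\circ\mathrm{Hol}_{r(e)}\circ S_D,\qquad \mathrm{Hol}_{l(\bar e)}=S_D\circ\mathrm{Hol}_{r(\bar e)}\circ S_D,\qquad \mathrm{Hol}_{x^{-1}}=\mathrm{Hol}_x\circ S_D$$ (the outer $S_D$ acts on the factor of $e$), and on words by $\mathrm{Hol}_{p\circ q}=m\circ(\mathrm{Hol}_p\otimes\mathrm{Hol}_q)\circ\Delta$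 with the comultiplication $\Delta$ of $D(H)^*$ and the multiplication $m$ of $(D(H)^*)^{\otimes E}$; trivial paths go to $\epsilon\,1$. If $e_1<\dots<e_n$ are the edges at $v$ and $e_i^{\epsilon_i}$ is incoming, put $p_v=r(\bar e_1^{\epsilon_1})\circ\dots\circ r(\bar e_n^{\epsilon_n})$; if $f(v)=e_1^{\epsilon_1}\circ\dots\circ e_n^{\epsilon_n}$ (last factor traversed first), put $p_{f(v)}=r(e_1^{\epsilon_1})\circ\dots\circ r(e_n^{\epsilon_n})$. **Theorem.** Let $\Gamma$ be a regular ciliated ribbon graph. Then $D(H)^{\otimes V}$ is a Hopf algebra, $\mathcal H(H)^{\otimes E}$ is an associative unital algebra, and there is a unique homomorphism of unital algebras $\tau:D(H)^{\otimes V}\to\mathcal H(H)^{\otimes E}$ with $$\tau((\delta\otimes z)_v)=\mathrm{Hol}_{p_{f(v)}}(1\otimes\delta)\cdot\mathrm{Hol}_{p_v}(z\otimes1)\qquad(v\in V,\ \delta\in H^*,\ z\in H),$$ where $\cdot$ is the multiplication of $\mathcal H(H)^{\otimes E}$. Moreover $$X\lhd k=\tau(S(k_{(2)}))\cdot X\cdot\tau(k_{(1)})$$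 makes $\mathcal H(H)^{op\otimes E}$ a right module algebra over $D(H)^{\otimes V}$, that is, it is a right module structure with $1\lhd k=\epsilon(k)1$ and $(XY)\lhd k=(X\lhd k_{(1)})(Y\lhd k_{(2)})$ for the product of $\mathcal H(H)^{op\otimes E}$, and it satisfies $$X\lhd(\delta\otimes z)_v=\mathrm{Hol}_{p_v}(S(z_{(2)})\otimes1)\cdot\mathrm{Hol}_{p_{f(v)}}(1\otimes S(\delta_{(1)}))\cdot X\cdot\mathrm{Hol}_{p_{f(v)}}(1\otimes\delta_{(2)})\cdot\mathrm{Hol}_{p_v}(z_{(1)}\otimes1).$$ -/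

import Mathlib

open TensorProduct
open scoped PiTensorProduct

noncomputable section

/-! ### Algebras and Hopf algebras given by structure maps -/

/-- A bilinear multiplication and a unit element on the vector space `A`. -/
structure AlgMaps (F A : Type*) [Field F] [AddCommMonoid A] [Module F A] where
  mul : A →ₗ[F] A →ₗ[F] A
  one : A

/-- The structure maps of a (prospective) Hopf algebra on the vector space `A`. -/
structure HopfMaps (F A : Type*) [Field F] [AddCommMonoid A] [Module F A]
    extends AlgMaps F A where
  comul : A →ₗ[F] A ⊗[F] A
  counit : A →ₗ[F] F
  antipode : A →ₗ[F] A

/-- The space `(H^* ⊗ H)^{⊗V}` underlying `D(H)^{⊗V}`. -/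
abbrev DoublePow (F A V : Type*) [Field F] [AddCommMonoid A] [Module F A] : Type _ :=
  ⨂[F] _ : V, Module.Dual F A ⊗[F] A

/-- The space `(H ⊗ H^*)^{⊗E}` underlying `ℋ(H)^{⊗E}` and `(D(H)^*)^{⊗E}`. -/
abbrev HeisenbergPow (F A E : Type*) [Field F] [AddCommMonoid A] [Module F A] : Type _ :=
  ⨂[F] _ : E, A ⊗[F] Module.Dual F A

section Basic

variable {F A B : Type*} [Field F] [AddCommMonoid A] [Module F A] [AddCommMonoid B] [Module F B]

/-- The multiplication as a linear map on the tensor product. -/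
def AlgMaps.mulT (a : AlgMaps F A) : A ⊗[F] A →ₗ[F] A := TensorProduct.lift a.mul

/-- `a` is an associative unital algebra. -/
structure AlgMaps.IsAlgebra (a : AlgMaps F A) : Prop where
  mul_assoc : ∀ x y z, a.mul (a.mul x y) z = a.mul x (a.mul y z)
  one_mul : ∀ x, a.mul a.one x = x
  mul_one : ∀ x, a.mul x a.one = x

/-- Homomorphisms of unital algebras. -/
structure AlgMaps.IsAlgHom (a : AlgMaps F A) (b : AlgMaps F B) (f : A →ₗ[F] B) : Prop where
  map_mul : ∀ x y, f (a.mul x y) = b.mul (f x) (f y)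
  map_one : f a.one = b.one

/-- The opposite algebra. -/
def AlgMaps.op (a : AlgMaps F A) : AlgMaps F A where
  mul := a.mul.flip
  one := a.one

/-- The multiplication
`(x ⊗ y) (x' ⊗ y') = ∑ x x'' ⊗ y'' y'` on `A ⊗ B`, where `∑ x'' ⊗ y'' = c (y ⊗ x')`.
For the flip `c` it is the usual tensor product of algebras. -/
def AlgMaps.twisted (a : AlgMaps F A) (b : AlgMaps F B) (c : B ⊗[F] A →ₗ[F] A ⊗[F] B) :
    AlgMaps F (A ⊗[F] B) where
  mul := TensorProduct.curry
    (TensorProduct.map a.mulT b.mulT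
      ∘ₗ (TensorProduct.tensorTensorTensorAssoc F A A B B).symm.toLinearMap
      ∘ₗ TensorProduct.map (TensorProduct.map LinearMap.id c) LinearMap.id
      ∘ₗ (TensorProduct.tensorTensorTensorAssoc F A B A B).toLinearMap)
  one := a.one ⊗ₜ[F] b.one

/-- The Hopf algebra axioms. -/
structure HopfMaps.IsHopfAlgebra (h : HopfMaps F A) : Prop extends h.toAlgMaps.IsAlgebra where
  coassoc : ∀ x, TensorProduct.assoc F A A A (TensorProduct.map h.comul LinearMap.id (h.comul x))
    = TensorProduct.map LinearMap.id h.comul (h.comul x)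
  counit_left : ∀ x, TensorProduct.lid F A
    (TensorProduct.map h.counit LinearMap.id (h.comul x)) = x
  counit_right : ∀ x, TensorProduct.rid F A
    (TensorProduct.map LinearMap.id h.counit (h.comul x)) = x
  comul_one : h.comul h.one = h.one ⊗ₜ[F] h.one
  comul_mul : ∀ x y, h.comul (h.mul x y)
    = (h.twisted h.toAlgMaps (TensorProduct.comm F A A).toLinearMap).mul (h.comul x) (h.comul y)
  counit_one : h.counit h.one = 1
  counit_mul : ∀ x y, h.counit (h.mul x y) = h.counit x * h.counit y
  antipode_left : ∀ x, h.mulT (TensorProduct.map h.antipode LinearMap.id (h.comul x))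
    = h.counit x • h.one
  antipode_right : ∀ x, h.mulT (TensorProduct.map LinearMap.id h.antipode (h.comul x))
    = h.counit x • h.one

/-- `act x k = x ◁ k` makes the algebra `a` a right module algebra over the Hopf algebra `h`:
`x ◁ 1 = x`, `x ◁ (k l) = (x ◁ k) ◁ l`, `(x y) ◁ k = (x ◁ k₁) (y ◁ k₂)`, `1 ◁ k = ε(k) 1`. -/
structure IsRightModuleAlgebra (h : HopfMaps F A) (a : AlgMaps F B)
    (act : B →ₗ[F] A →ₗ[F] B) : Prop where
  act_one : ∀ x, act x h.one = x
  act_mul : ∀ x k l, act x (h.mul k l) = act (act x k) l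
  mul_act : ∀ x y k, act (a.mul x y) k
    = a.mulT (TensorProduct.map (act x) (act y) (h.comul k))
  one_act : ∀ k, act a.one k = h.counit k • a.one

/-- The linear map `k ⊗ l ↦ p(k) · x · q(l)`. -/
def AlgMaps.sandwich (b : AlgMaps F B) (p q : A →ₗ[F] B) (x : B) : A ⊗[F] A →ₗ[F] B :=
  TensorProduct.lift (b.mul.compl₁₂ (b.mul.flip x ∘ₗ p) q)

/-! ### Tensor powers -/

section Pi

variable (ι : Type*)

/-- The tensor power `A^{⊗ι}` of an algebra, with the factorwise multiplication. -/
def AlgMaps.pi (a : AlgMaps F A) : AlgMaps F (⨂[F] _ : ι, A) where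
  mul := PiTensorProduct.map₂ (fun _ => a.mul)
  one := PiTensorProduct.tprod F (fun _ => a.one)

/-- The inclusion `x ↦ (x)_i` of the `i`-th factor: the pure tensor with entry `x` at `i` and
entries `1` elsewhere. -/
def AlgMaps.incl {ι : Type*} [DecidableEq ι] (a : AlgMaps F A) (i : ι) :
    A →ₗ[F] ⨂[F] _ : ι, A :=
  (PiTensorProduct.tprod F).toLinearMap (fun _ => a.one) i

variable [Fintype ι]

/-- The regrouping `(A ⊗ B)^{⊗ι} → A^{⊗ι} ⊗ B^{⊗ι}`, defined on a basis; see
`unzip_tprod` for its values on pure tensors. -/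
def unzip (F A B : Type*) [Field F] [AddCommMonoid A] [Module F A] [Module.Free F A]
    [AddCommMonoid B] [Module F B] [Module.Free F B] :
    (⨂[F] _ : ι, A ⊗[F] B) →ₗ[F] (⨂[F] _ : ι, A) ⊗[F] (⨂[F] _ : ι, B) :=
  (Basis.piTensorProduct (fun _ : ι => (Module.Free.chooseBasis F A).tensorProduct
      (Module.Free.chooseBasis F B))).constr F
    (fun p => (PiTensorProduct.tprod F fun i => Module.Free.chooseBasis F A (p i).1) ⊗ₜ[F]
      (PiTensorProduct.tprod F fun i => Module.Free.chooseBasis F B (p i).2))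

theorem unzip_tprod [Module.Free F A] [Module.Free F B] (x : ι → A) (y : ι → B) :
    unzip ι F A B (PiTensorProduct.tprod F fun i => x i ⊗ₜ[F] y i)
      = (PiTensorProduct.tprod F x) ⊗ₜ[F] (PiTensorProduct.tprod F y) := by
  classical
  let b := Module.Free.chooseBasis F A
  let c := Module.Free.chooseBasis F B
  have h₁ : ∀ (p : ι → Module.Free.ChooseBasisIndex F A)
      (q : ι → Module.Free.ChooseBasisIndex F B),
      unzip ι F A B (PiTensorProduct.tprod F fun i => b (p i) ⊗ₜ[F] c (q i))
        = (PiTensorProduct.tprod F fun i => b (p i)) ⊗ₜ[F]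
          (PiTensorProduct.tprod F fun i => c (q i)) := by
    intro p q
    have := (Basis.piTensorProduct (fun _ : ι => b.tensorProduct c)).constr_basis F
      (fun p => (PiTensorProduct.tprod F fun i => b (p i).1) ⊗ₜ[F]
        (PiTensorProduct.tprod F fun i => c (p i).2)) (fun i => (p i, q i))
    rw [Basis.piTensorProduct_apply] at this
    simp only [Module.Basis.tensorProduct_apply] at this
    exact this
  have h₂ : ∀ (p : ι → Module.Free.ChooseBasisIndex F A) (y : ι → B),
      unzip ι F A B (PiTensorProduct.tprod F fun i => b (p i) ⊗ₜ[F] y i)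
        = (PiTensorProduct.tprod F fun i => b (p i)) ⊗ₜ[F] (PiTensorProduct.tprod F y) := by
    intro p y
    have : ((unzip ι F A B).compMultilinearMap (PiTensorProduct.tprod F)).compLinearMap
          (fun i => TensorProduct.mk F A B (b (p i)))
        = (TensorProduct.mk F _ _ (PiTensorProduct.tprod F fun i => b (p i))).compMultilinearMap
          (PiTensorProduct.tprod F) :=
      Module.Basis.ext_multilinear (fun _ => c) (fun q => h₁ p q)
    exact congrArg (fun f => f y) this
  have : ((unzip ι F A B).compMultilinearMap (PiTensorProduct.tprod F)).compLinearMap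
        (fun i => (TensorProduct.mk F A B).flip (y i))
      = ((TensorProduct.mk F _ _).flip (PiTensorProduct.tprod F y)).compMultilinearMap
        (PiTensorProduct.tprod F) :=
    Module.Basis.ext_multilinear (fun _ => b) (fun p => h₂ p y)
  exact congrArg (fun f => f x) this

/-- The tensor power `A^{⊗ι}` of a Hopf algebra, with the factorwise structure maps. -/
def HopfMaps.pi [Module.Free F A] (h : HopfMaps F A) : HopfMaps F (⨂[F] _ : ι, A) where
  toAlgMaps := h.toAlgMaps.pi ι
  comul := unzip ι F A A ∘ₗ PiTensorProduct.map (fun _ => h.comul)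
  counit := (PiTensorProduct.constantBaseRingEquiv ι F).toLinearMap
    ∘ₗ PiTensorProduct.map (fun _ => h.counit)
  antipode := PiTensorProduct.map (fun _ => h.antipode)

end Pi

/-! ### The dual, the Drinfeld double and the Heisenberg double -/

/-- The dual of a finite-dimensional Hopf algebra:
`⟨α β, h⟩ = ⟨α, h₁⟩ ⟨β, h₂⟩`, `⟨α₁, h⟩ ⟨α₂, k⟩ = ⟨α, h k⟩`, `⟨S α, h⟩ = ⟨α, S h⟩`. -/
def HopfMaps.dual [Module.Free F A] [Module.Finite F A] (h : HopfMaps F A) :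
    HopfMaps F (Module.Dual F A) where
  mul := TensorProduct.curry (h.comul.dualMap ∘ₗ TensorProduct.dualDistrib F A A)
  one := h.counit
  comul := (TensorProduct.dualDistribEquiv F A A).symm.toLinearMap ∘ₗ h.mulT.dualMap
  counit := Module.Dual.eval F A h.one
  antipode := h.antipode.dualMap

/-- The inverse of the antipode (which is invertible for a finite-dimensional Hopf algebra). -/
def HopfMaps.antipodeInv (h : HopfMaps F A) : A →ₗ[F] A :=
  Ring.inverse (M₀ := Module.End F A) h.antipode

/-- The iterated comultiplication `x ↦ x₁ ⊗ (x₂ ⊗ x₃)`. -/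
def HopfMaps.comul₃ (h : HopfMaps F A) : A →ₗ[F] A ⊗[F] (A ⊗[F] A) :=
  TensorProduct.map LinearMap.id h.comul ∘ₗ h.comul

/-- The linear map `x ⊗ (y ⊗ z) ↦ z ⊗ (y ⊗ x)`. -/
def reverse₃ (F A : Type*) [Field F] [AddCommMonoid A] [Module F A] :
    A ⊗[F] (A ⊗[F] A) →ₗ[F] A ⊗[F] (A ⊗[F] A) :=
  (TensorProduct.assoc F A A A).toLinearMap
    ∘ₗ (TensorProduct.comm F A (A ⊗[F] A)).toLinearMap
    ∘ₗ TensorProduct.map LinearMap.id (TensorProduct.comm F A A).toLinearMap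

end Basic

section Doubles

variable {F A : Type*} [Field F] [AddCommMonoid A] [Module F A] [Module.Free F A] [Module.Finite F A]

/-- The linear map `h ⊗ α ↦ ⟨p α₃, h₁⟩ ⟨q α₁, h₃⟩ α₂ ⊗ h₂`. -/
def HopfMaps.straighten (h : HopfMaps F A) (p q : Module.Dual F A →ₗ[F] Module.Dual F A) :
    A ⊗[F] Module.Dual F A →ₗ[F] Module.Dual F A ⊗[F] A :=
  (TensorProduct.lid F _).toLinearMap
    ∘ₗ TensorProduct.map
      (contractRight F A ∘ₗ TensorProduct.map LinearMap.id p)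
      ((TensorProduct.rid F _).toLinearMap
        ∘ₗ TensorProduct.map (TensorProduct.comm F A (Module.Dual F A)).toLinearMap
          (contractRight F A ∘ₗ TensorProduct.map LinearMap.id q)
        ∘ₗ (TensorProduct.tensorTensorTensorComm F A A
            (Module.Dual F A) (Module.Dual F A)).toLinearMap)
    ∘ₗ (TensorProduct.tensorTensorTensorComm F A (A ⊗[F] A)
        (Module.Dual F A) (Module.Dual F A ⊗[F] Module.Dual F A)).toLinearMap
    ∘ₗ TensorProduct.map h.comul₃ (reverse₃ F (Module.Dual F A) ∘ₗ h.dual.comul₃)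

/-- The Drinfeld double `D(H)` on `H^* ⊗ H`:
`(α ⊗ h) (α' ⊗ h') = ⟨α'₃, h₁⟩ ⟨S⁻¹ α'₁, h₃⟩ α α'₂ ⊗ h₂ h'`,
`Δ(α ⊗ h) = (α₂ ⊗ h₁) ⊗ (α₁ ⊗ h₂)`, `ε(α ⊗ h) = ε(α) ε(h)` and
`S(α ⊗ h) = ⟨α₁, h₃⟩ ⟨S⁻¹ α₃, h₁⟩ S(α₂) ⊗ S(h₂)`. -/
def HopfMaps.drinfeldDouble (h : HopfMaps F A) : HopfMaps F (Module.Dual F A ⊗[F] A) where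
  toAlgMaps := h.dual.twisted h.toAlgMaps (h.straighten LinearMap.id h.dual.antipodeInv)
  comul := (TensorProduct.tensorTensorTensorComm F (Module.Dual F A) (Module.Dual F A)
      A A).toLinearMap
    ∘ₗ TensorProduct.map ((TensorProduct.comm F _ _).toLinearMap ∘ₗ h.dual.comul) h.comul
  counit := (TensorProduct.lid F F).toLinearMap ∘ₗ TensorProduct.map h.dual.counit h.counit
  antipode := TensorProduct.map h.dual.antipode h.antipode
    ∘ₗ h.straighten h.dual.antipodeInv LinearMap.id
    ∘ₗ (TensorProduct.comm F (Module.Dual F A) A).toLinearMap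

/-- The linear map `α ⊗ h ↦ ⟨α₁, h₂⟩ h₁ ⊗ α₂`. -/
def HopfMaps.heisenbergTwist (h : HopfMaps F A) :
    Module.Dual F A ⊗[F] A →ₗ[F] A ⊗[F] Module.Dual F A :=
  (TensorProduct.lid F _).toLinearMap
    ∘ₗ TensorProduct.map (contractLeft F A) (TensorProduct.comm F (Module.Dual F A) A).toLinearMap
    ∘ₗ (TensorProduct.tensorTensorTensorComm F (Module.Dual F A) (Module.Dual F A)
        A A).toLinearMap
    ∘ₗ TensorProduct.map h.dual.comul ((TensorProduct.comm F A A).toLinearMap ∘ₗ h.comul)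

/-- The (right) Heisenberg double `ℋ(H)` on `H ⊗ H^*`:
`(h ⊗ α) (h' ⊗ α') = ⟨α₁, h'₂⟩ h h'₁ ⊗ α₂ α'`. -/
def HopfMaps.heisenberg (h : HopfMaps F A) : AlgMaps F (A ⊗[F] Module.Dual F A) :=
  h.twisted h.dual.toAlgMaps h.heisenbergTwist

/-- The dual `D(H)^*` of the Drinfeld double on `H ⊗ H^*`. With a basis `x i` of `H` and its dual
basis `α i`:
`(y ⊗ γ) (z ⊗ δ) = z y ⊗ γ δ`,
`Δ(y ⊗ γ) = ∑ i j, (y₁ ⊗ α i γ₁ α j) ⊗ (S(x j) y₂ x i ⊗ γ₂)`,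
`S(y ⊗ γ) = ∑ i j, x i S⁻¹(y) x j ⊗ S(α j) S(γ) α i`. -/
def HopfMaps.drinfeldDoubleDual (h : HopfMaps F A) :
    HopfMaps F (A ⊗[F] Module.Dual F A) where
  toAlgMaps := h.toAlgMaps.op.twisted h.dual.toAlgMaps (TensorProduct.comm F _ _).toLinearMap
  comul := ∑ i, ∑ j,
    TensorProduct.map
      (TensorProduct.map LinearMap.id
        (h.dual.mul ((Module.Free.chooseBasis F A).coord i)
          ∘ₗ h.dual.mul.flip ((Module.Free.chooseBasis F A).coord j)))
      (TensorProduct.map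
        (h.mul (h.antipode (Module.Free.chooseBasis F A j)) ∘ₗ h.mul.flip (Module.Free.chooseBasis F A i))
        LinearMap.id)
    ∘ₗ (TensorProduct.tensorTensorTensorComm F A A
        (Module.Dual F A) (Module.Dual F A)).toLinearMap
    ∘ₗ TensorProduct.map h.comul h.dual.comul
  counit := (TensorProduct.lid F F).toLinearMap ∘ₗ TensorProduct.map h.counit h.dual.counit
  antipode := ∑ i, ∑ j,
    TensorProduct.map
      (h.mul (Module.Free.chooseBasis F A i) ∘ₗ h.mul.flip (Module.Free.chooseBasis F A j) ∘ₗ h.antipodeInv)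
      (h.dual.mul (h.dual.antipode ((Module.Free.chooseBasis F A).coord j))
        ∘ₗ h.dual.mul.flip ((Module.Free.chooseBasis F A).coord i) ∘ₗ h.dual.antipode)

end Doubles

/-- The structure maps of a Hopf algebra. -/
def HopfMaps.of (F H : Type*) [Field F] [Ring H] [HopfAlgebra F H] : HopfMaps F H where
  mul := LinearMap.mul F H
  one := 1
  comul := Coalgebra.comul
  counit := Coalgebra.counit
  antipode := HopfAlgebra.antipode F

/-! ### Ciliated ribbon graphs -/

/-- A ciliated ribbon graph with vertex set `V` and edge set `E`. The edge ends are the pairs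
`(e, false)` (starting end of `e`) and `(e, true)` (target end of `e`); `ends v` lists the edge
ends incident at `v` in their linear order, counterclockwise from the cilium. The cyclic order of
the underlying ribbon graph is the cyclic order of this list. -/
structure CiliatedRibbonGraph (V E : Type*) where
  st : E → V
  ta : E → V
  ends : V → List (E × Bool)
  ends_nodup : ∀ v, (ends v).Nodup
  start_mem_ends : ∀ v e, (e, false) ∈ ends v ↔ st e = v
  target_mem_ends : ∀ v e, (e, true) ∈ ends v ↔ ta e = v

namespace CiliatedRibbonGraph

variable {V E : Type*} (Γ : CiliatedRibbonGraph V E)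

/-- The vertex at which an edge end is incident. -/
def vert (d : E × Bool) : V := bif d.2 then Γ.ta d.1 else Γ.st d.1

/-- The opposite end of the same edge. An oriented edge `e^{±1}` is encoded by the edge end
at which it starts: `(e, false)` is `e` and `(e, true)` is `e⁻¹`. So it arrives at the opposite
end, and taking the opposite end is also reversal of orientation. -/
def opp (d : E × Bool) : E × Bool := (d.1, !d.2)

variable [DecidableEq E]

/-- The oriented edge that follows `d` on a path turning maximally right: its starting end
comes directly after the target end of `d` in the cyclic order at their vertex. -/
def faceNext (d : E × Bool) : E × Bool := (Γ.ends (Γ.vert (opp d))).formPerm (opp d)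

/-- The ciliated face `f(v)` that starts and ends at the cilium at `v`: it leaves `v` along the
edge end of lowest order, turns maximally right at each vertex, and closes up at the cilium at `v`.
As a word `e₁^{ε₁} ∘ … ∘ eₙ^{εₙ}`, with the oriented edge that is traversed first at the end.
It is the trivial path if no edge is incident at `v`. -/
def ciliatedFace (v : V) : List (E × Bool) :=
  match (Γ.ends v).head? with
  | none => []
  | some c => ((List.range (Function.minimalPeriod Γ.faceNext c)).map
      (fun i => Γ.faceNext^[i] c)).reverse

/-- The cilium at `v` lies in the face that traverses the oriented edge `d`. (It lies between the
edge ends of highest and lowest order at `v`, so in the face leaving `v` along the lowest one.) -/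
def CiliumInFace (v : V) (d : E × Bool) : Prop :=
  ∃ c, (Γ.ends v).head? = some c ∧ ∃ n : ℕ, Γ.faceNext^[n] c = d

/-- Regular ciliated ribbon graphs. -/
structure IsRegular : Prop where
  no_loops : ∀ e, Γ.st e ≠ Γ.ta e
  no_multiple_edges : ∀ e e', Γ.st e = Γ.st e' → Γ.ta e = Γ.ta e' → e = e'
  face_traverses_edge_once : ∀ (d : E × Bool) (n : ℕ), Γ.faceNext^[n] d ≠ opp d
  face_has_one_cilium : ∀ d : E × Bool, ∃! v, Γ.CiliumInFace v d

end CiliatedRibbonGraph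

/-! ### The thickened graph and its holonomies -/

/-- The edges `r(e)`, `l(e)`, `r(ē)`, `l(ē)` of the thickening, for each edge `e`. -/
inductive ThickEdge (E : Type*) where
  | r (e : E)
  | l (e : E)
  | rBar (e : E)
  | lBar (e : E)

/-- Words in the edges of the thickening and their inverses (`(x, true)` stands for `x`, and
`(x, false)` for `x⁻¹`), in the order of composition: `[x₁, …, xₙ]` is `x₁ ∘ … ∘ xₙ`. -/
abbrev ThickPath (E : Type*) := List (ThickEdge E × Bool)

namespace CiliatedRibbonGraph

variable {V E : Type*} (Γ : CiliatedRibbonGraph V E)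

/-- The vertex loop `p_v = r(ē₁^{ε₁}) ∘ … ∘ r(ēₙ^{εₙ})`, where `e₁ < … < eₙ` are the edges at `v`,
oriented such that each `eᵢ^{εᵢ}` is incoming, and `r(ē⁻¹) = l(ē)⁻¹`. -/
def vertexLoop (v : V) : ThickPath E :=
  (Γ.ends v).map fun d => bif d.2 then (.rBar d.1, true) else (.lBar d.1, false)

/-- The face loop `p_f = r(e₁^{ε₁}) ∘ … ∘ r(eₙ^{εₙ})` for the ciliated face
`f = e₁^{ε₁} ∘ … ∘ eₙ^{εₙ}` that starts and ends at the cilium at `v`, where `r(e⁻¹) = l(e)⁻¹`. -/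
def faceLoop [DecidableEq E] (v : V) : ThickPath E :=
  (Γ.ciliatedFace v).map fun d => bif d.2 then (.l d.1, false) else (.r d.1, true)

end CiliatedRibbonGraph

section Holonomy

variable {F A E : Type*} [Field F] [AddCommMonoid A] [Module F A] [Module.Free F A] [Module.Finite F A]
  [DecidableEq E] (h : HopfMaps F A)

/-- The linear map `y ⊗ γ ↦ ε(y) (1 ⊗ γ)`. -/
def HopfMaps.holR : A ⊗[F] Module.Dual F A →ₗ[F] A ⊗[F] Module.Dual F A :=
  TensorProduct.map (h.counit.smulRight h.one) LinearMap.id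

/-- The linear map `y ⊗ γ ↦ ε(γ) (y ⊗ 1)`. -/
def HopfMaps.holRBar : A ⊗[F] Module.Dual F A →ₗ[F] A ⊗[F] Module.Dual F A :=
  TensorProduct.map LinearMap.id (h.dual.counit.smulRight h.dual.one)

/-- The holonomies of the edges of the thickening: `Hol_{r(e)}(y ⊗ γ) = ε(y) (1 ⊗ γ)_e`,
`Hol_{r(ē)}(y ⊗ γ) = ε(γ) (y ⊗ 1)_e`, `Hol_{l(e)} = S_D ∘ Hol_{r(e)} ∘ S_D`,
`Hol_{l(ē)} = S_D ∘ Hol_{r(ē)} ∘ S_D`, with the antipode `S_D` of `D(H)^*`. -/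
def HopfMaps.holEdge :
    ThickEdge E → (A ⊗[F] Module.Dual F A →ₗ[F] HeisenbergPow F A E)
  | .r e => h.drinfeldDoubleDual.incl e ∘ₗ h.holR
  | .rBar e => h.drinfeldDoubleDual.incl e ∘ₗ h.holRBar
  | .l e => h.drinfeldDoubleDual.incl e
      ∘ₗ h.drinfeldDoubleDual.antipode ∘ₗ h.holR ∘ₗ h.drinfeldDoubleDual.antipode
  | .lBar e => h.drinfeldDoubleDual.incl e
      ∘ₗ h.drinfeldDoubleDual.antipode ∘ₗ h.holRBar ∘ₗ h.drinfeldDoubleDual.antipode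

/-- The holonomy functor on words: `Hol_{x⁻¹} = Hol_x ∘ S_D` for edges `x` of the thickening, and
`Hol_{p ∘ q} = m ∘ (Hol_p ⊗ Hol_q) ∘ Δ` with the comultiplication `Δ` of `D(H)^*` and the
multiplication `m` of `(D(H)^*)^{⊗E}`; trivial paths are sent to `ε 1`. -/
def HopfMaps.hol : ThickPath E →
    (A ⊗[F] Module.Dual F A →ₗ[F] HeisenbergPow F A E)
  | [] => h.drinfeldDoubleDual.counit.smulRight (h.drinfeldDoubleDual.toAlgMaps.pi E).one
  | (x, b) :: p => (h.drinfeldDoubleDual.toAlgMaps.pi E).mulT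
      ∘ₗ TensorProduct.map
        (bif b then h.holEdge x else h.holEdge x ∘ₗ h.drinfeldDoubleDual.antipode) (hol p)
      ∘ₗ h.drinfeldDoubleDual.comul

variable {V : Type*} (Γ : CiliatedRibbonGraph V E) (v : V)

/-- The linear map `H → ℋ(H)^{⊗E}`, `z ↦ Hol_{p_v}(z ⊗ 1)`. -/
def HopfMaps.vertexHol : A →ₗ[F] HeisenbergPow F A E :=
  h.hol (Γ.vertexLoop v) ∘ₗ (TensorProduct.mk F A (Module.Dual F A)).flip h.dual.one

/-- The linear map `H^* → ℋ(H)^{⊗E}`, `δ ↦ Hol_{p_{f(v)}}(1 ⊗ δ)`. -/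
def HopfMaps.faceHol : Module.Dual F A →ₗ[F] HeisenbergPow F A E :=
  h.hol (Γ.faceLoop v) ∘ₗ TensorProduct.mk F A (Module.Dual F A) h.one

end Holonomy

end

/-!
The antipode `S` of a finite-dimensional semisimple Hopf algebra in characteristic zero is an
involution (Larson and Radford, `antipode_antipode_of_isSemisimpleRing`); everything else is a
computation with `S² = 1`.

*The antipode.* The twisted trace `λ(x) = Tr(L_x ∘ S²)` is an integral of the dual
(`leftHit_twistedTrace`). Its modular element `g` has finite order and satisfies `h g = g S⁴(h)`,
and `S²` is inner. Comparing traces of powers of the element that implements `S²`, one finds that its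
eigenvalues are algebraic numbers and that its trace `λ(1)` is nonzero
(`Module.End.trace_ne_zero_of_trace_pow`), whence `g = 1` and `S⁴ = 1`. The regular character `x`
of the dual satisfies `x² = n x`, where `n = dim H`, so that `Tr S² = λ(x)` is `n` times an integer;
being a nonzero trace of an involution it is `± n`, so `S² = ± 1`, and `S²` fixes the unit.

*The doubles.* The Heisenberg double is `End H`, with `H` acting by left multiplication and `H^*`
by its right coaction (`heisenbergEquiv`). In the convolution algebra of maps from `H^* ⊗ H` to an
algebra `R`, let `P` be the pairing. Representations `A` of `H^*` and `B` of `H` in `R` form a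
representation `α ⊗ h ↦ A(α) B(h)` of the Drinfeld double if and only if `B A = P (A B) P⁻¹`
(`DoubleRel`, `doubleMap_mul`). The left and right multiplications and coactions on `H` satisfy one
half each of this relation, `A B = P⁻¹ B A` or `A B = B A P`. Tensoring one of each kind gives a
faithful representation of the double (`faithful_injective`), from which its Hopf algebra axioms
are read off (`drinfeldDouble_isHopfAlgebra`).

*Holonomies.* In `End(H)^{⊗E}` the holonomies of a vertex loop and of a face loop are the
convolution products, over the edge ends at the vertex and over the oriented edges of the face, of
multiplications and coactions (`hol_vertexWord`, `hol_faceWord`); regularity makes the factors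
commute, so these are algebra homomorphisms. Moving a face loop across a vertex loop, the edge that
arrives at a corner of the face contributes `P` and the edge that departs contributes `P⁻¹`. Inside
a corner without cilium the two factors are adjacent and cancel; only at the cilium are they at
the two ends of the product and leave a conjugation by `P` (`EdgeRelations.prod_mul_prod`). Hence the
face loop and the vertex loop of the same cilium form a representation of the double, and loops of
different cilia commute (`exists_loopHoms`).

Commuting representations combine to an algebra homomorphism on the tensor power
(`AlgMaps.exists_piHom`), which is unique as the tensor power is generated by its factors. Its
adjoint action is a module algebra structure (`exists_isRightModuleAlgebra`), and on the factor of a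
vertex it splits into the conjugations by the face loop and by the vertex loop (`sandwich_incl`).
-/

set_option synthInstance.maxHeartbeats 200000
set_option linter.unusedSectionVars false

noncomputable section

/-! ### Traces of powers and algebraicity of eigenvalues -/

/-- The traces of the powers of an endomorphism, as power sums of its eigenvalues `μ`, weighted with
the dimensions `w μ` of the generalized eigenspaces. -/
theorem Module.End.exists_trace_pow_eq {K V : Type*} [Field K] [IsAlgClosed K] [AddCommGroup V]
    [Module K V] [FiniteDimensional K V] (f : Module.End K V) :
    ∃ (s : Finset K) (w : K → ℕ), (∀ μ ∈ s, f.HasEigenvalue μ ∧ 0 < w μ) ∧ (∀ μ ∉ s, w μ = 0) ∧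
      (∀ k : ℕ, LinearMap.trace K V (f ^ k) = ∑ μ ∈ s, (w μ : K) * μ ^ k) ∧
      (Nontrivial V → s.Nonempty) := by
  classical
  have hint : DirectSum.IsInternal f.maxGenEigenspace := by
    rw [DirectSum.isInternal_submodule_iff_iSupIndep_and_iSup_eq_top]
    exact ⟨f.independent_maxGenEigenspace, f.iSup_maxGenEigenspace_eq_top⟩
  have hfin : {i | f.maxGenEigenspace i ≠ ⊥}.Finite :=
    WellFoundedGT.finite_ne_bot_of_iSupIndep hint.submodule_iSupIndep
  refine ⟨hfin.toFinset, fun μ => Module.finrank K (f.maxGenEigenspace μ), ?_, ?_, ?_, ?_⟩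
  · intro μ hμ
    have : f.maxGenEigenspace μ ≠ ⊥ := by simpa using hμ
    have h' : f.HasUnifEigenvalue μ ⊤ := this
    refine ⟨h'.lt one_pos, Module.finrank_pos_iff.mpr ?_⟩
    exact (Submodule.nontrivial_iff_ne_bot).mpr this
  · intro μ hμ
    have : f.maxGenEigenspace μ = ⊥ := by simpa using hμ
    change Module.finrank K (f.maxGenEigenspace μ) = 0
    rw [this, finrank_bot]
  · intro k
    have hm : ∀ μ, Set.MapsTo (f ^ k) (f.maxGenEigenspace μ) (f.maxGenEigenspace μ) := fun μ =>
      Module.End.mapsTo_maxGenEigenspace_of_comm (Commute.self_pow f k) μ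
    rw [LinearMap.trace_eq_sum_trace_restrict' hint hfin hm]
    refine Finset.sum_congr rfl fun μ _ => ?_
    have hm1 := Module.End.mapsTo_maxGenEigenspace_of_comm (Commute.refl f) μ
    have hnil := f.isNilpotent_restrict_maxGenEigenspace_sub_algebraMap μ
    set g := f.restrict hm1 with hg
    have h1 : (f ^ k).restrict (hm μ) = g ^ k := by
      exact (Module.End.pow_restrict k hm1 (hm μ)).symm
    have hnil' : IsNilpotent (g - algebraMap K _ μ) := by
      exact hnil
    have h2 : IsNilpotent (g ^ k - algebraMap K _ (μ ^ k)) := by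
      have hc : Commute g (algebraMap K (Module.End K (f.maxGenEigenspace μ)) μ) :=
        (Algebra.commutes μ g).symm
      rw [map_pow, ← hc.geom_sum₂_mul]
      refine Commute.isNilpotent_mul_left ?_ hnil'
      refine Commute.sum_left _ _ _ fun i _ => ?_
      have e1 : Commute g (g - algebraMap K _ μ) := (Commute.refl g).sub_right hc
      have e2 : Commute (algebraMap K (Module.End K (f.maxGenEigenspace μ)) μ)
        (g - algebraMap K _ μ) := Algebra.commutes _ _
      exact (e1.pow_left _).mul_left (e2.pow_left _)
    have h3 := LinearMap.isNilpotent_trace_of_isNilpotent h2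
    rw [isNilpotent_iff_eq_zero, map_sub, sub_eq_zero] at h3
    rw [h1, h3, Algebra.algebraMap_eq_smul_one, map_smul, LinearMap.trace_one, smul_eq_mul,
      mul_comm]
  · intro hV
    by_contra he
    rw [Finset.not_nonempty_iff_eq_empty] at he
    have h0 : ∀ i, f.maxGenEigenspace i = ⊥ := by
      intro i
      by_contra hi
      have : i ∈ hfin.toFinset := by simpa using hi
      simp [he] at this
    have := f.iSup_maxGenEigenspace_eq_top
    simp only [h0, iSup_bot] at this
    exact bot_ne_top this

/-- If `Tr (f ^ (M (j + 1) - 1)) = Tr (f ^ (M (j + 1)))` for all `j`, then `Tr f ≠ 0`: the hypothesis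
forces the eigenvalues to be algebraic numbers, and after an embedding into `ℂ` the trace `Tr f`
becomes the sum of the squares of their absolute values. -/
theorem Module.End.trace_ne_zero_of_trace_pow {F V : Type*} [Field F] [CharZero F]
    [AddCommGroup V] [Module F V] [FiniteDimensional F V] [Nontrivial V] (f : Module.End F V)
    (hf : IsUnit f) (M : ℕ) (hM : 0 < M)
    (h : ∀ j : ℕ, LinearMap.trace F V (f ^ (M * j + (M - 1)))
      = LinearMap.trace F V (f ^ (M * j + M))) :
    LinearMap.trace F V f ≠ 0 := by
  classical
  let K := AlgebraicClosure F
  have : CharZero K := charZero_of_injective_algebraMap (algebraMap F K).injective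
  let g : Module.End K (K ⊗[F] V) := Module.End.baseChangeHom F K V f
  have hpow : ∀ k, LinearMap.trace K _ (g ^ k) = algebraMap F K (LinearMap.trace F V (f ^ k)) := by
    intro k
    rw [← LinearMap.trace_baseChange, ← map_pow]
    rfl
  have hg : IsUnit g := hf.map _
  obtain ⟨s, w, hs, hw, htr, hsne⟩ := g.exists_trace_pow_eq
  replace hsne := hsne inferInstance
  have hwpos : ∀ μ ∈ s, 0 < w μ := fun μ hμ => (hs μ hμ).2
  have hne : ∀ μ ∈ s, μ ≠ 0 := by
    rintro μ hμ rfl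
    have := (hs _ hμ).1.mem_spectrum
    rw [spectrum.zero_mem_iff] at this
    exact this hg
  -- The hypothesis says that the family `μ ↦ w μ (μ⁻¹ - 1) μ ^ M` is orthogonal to all powers of
  -- `μ ^ M`, hence to all polynomials in `μ ^ M`.
  have hdiff : ∀ k : ℕ, ∑ μ ∈ s, (w μ : K) * (μ⁻¹ - 1) * μ ^ M * (μ ^ M) ^ k = 0 := by
    intro k
    have : ∑ μ ∈ s, (w μ : K) * μ ^ (M * k + (M - 1)) - ∑ μ ∈ s, (w μ : K) * μ ^ (M * k + M)
        = 0 := by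
      rw [← htr, ← htr, hpow, hpow, h, sub_self]
    rw [← Finset.sum_sub_distrib] at this
    rw [← this]
    refine Finset.sum_congr rfl fun μ hμ => ?_
    obtain ⟨m, rfl⟩ : ∃ m, M = m + 1 := ⟨M - 1, by omega⟩
    have h1 : μ⁻¹ * μ = 1 := inv_mul_cancel₀ (hne μ hμ)
    simp only [add_tsub_cancel_right, pow_add, pow_mul, pow_one]
    linear_combination (w μ : K) * ((μ ^ m * μ) ^ k * μ ^ m) * h1
  have hpoly : ∀ p : Polynomial K,
      ∑ μ ∈ s, (w μ : K) * (μ⁻¹ - 1) * μ ^ M * p.eval (μ ^ M) = 0 := by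
    intro p
    induction p using Polynomial.induction_on' with
    | add p q hp hq => simp only [Polynomial.eval_add, mul_add, Finset.sum_add_distrib, hp, hq,
        add_zero]
    | monomial n a =>
      have := hdiff n
      simp only [Polynomial.eval_monomial]
      calc _ = a * ∑ μ ∈ s, (w μ : K) * (μ⁻¹ - 1) * μ ^ M * (μ ^ M) ^ n := by
            rw [Finset.mul_sum]; exact Finset.sum_congr rfl fun _ _ => by ring
        _ = 0 := by rw [this, mul_zero]
  -- interpolation isolates the eigenvalues with a given `M`-th power
  have hgroup : ∀ ν ∈ s, ∑ μ ∈ s with μ ^ M = ν ^ M, (w μ : K) * (μ⁻¹ - 1) = 0 := by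
    intro ν hν
    let p : Polynomial K := ∏ x ∈ (s.image (· ^ M)).erase (ν ^ M), (Polynomial.X - Polynomial.C x)
    have hp0 : p.eval (ν ^ M) ≠ 0 := by
      rw [Polynomial.eval_prod]
      refine Finset.prod_ne_zero_iff.mpr fun x hx => ?_
      simp only [Polynomial.eval_sub, Polynomial.eval_X, Polynomial.eval_C]
      exact sub_ne_zero.mpr (Finset.ne_of_mem_erase hx).symm
    have hp1 : ∀ μ ∈ s, μ ^ M ≠ ν ^ M → p.eval (μ ^ M) = 0 := by
      intro μ hμ hne
      rw [Polynomial.eval_prod]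
      refine Finset.prod_eq_zero (i := μ ^ M)
        (Finset.mem_erase.mpr ⟨hne, Finset.mem_image_of_mem _ hμ⟩) (by simp)
    have h1 := hpoly p
    rw [← Finset.sum_filter_of_ne (p := fun μ => μ ^ M = ν ^ M)] at h1
    · have h2 : (∑ μ ∈ s with μ ^ M = ν ^ M, (w μ : K) * (μ⁻¹ - 1)) * (ν ^ M * p.eval (ν ^ M))
          = 0 := by
        rw [← h1, Finset.sum_mul]
        refine Finset.sum_congr rfl fun μ hμ => ?_
        rw [(Finset.mem_filter.mp hμ).2]
        ring
      exact (mul_eq_zero.mp h2).resolve_right (mul_ne_zero (pow_ne_zero _ (hne ν hν)) hp0)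
    · intro μ hμ h2
      by_contra h3
      exact h2 (by rw [hp1 μ hμ h3, mul_zero])
  -- If `μ ^ M = ν ^ M`, then `ν / μ` is a root of unity; multiplying the relation of the group of `ν`
  -- with `ν` writes `ν` as a rational combination of such ratios.
  have halg : ∀ ν ∈ s, IsAlgebraic ℚ ν := by
    intro ν hν
    set t := s.filter (fun μ => μ ^ M = ν ^ M) with ht
    have hνt : ν ∈ t := by simp [ht, hν]
    have hA : (∑ μ ∈ t, w μ) ≠ 0 := by
      have : 0 < ∑ μ ∈ t, w μ :=
        Finset.sum_pos (fun μ hμ => hwpos μ (Finset.mem_filter.mp hμ).1) ⟨ν, hνt⟩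
      exact this.ne'
    have h1 : (((∑ μ ∈ t, w μ : ℕ) : ℚ) : K) * ν = ∑ μ ∈ t, (w μ : K) * (ν / μ) := by
      have := hgroup ν hν
      simp only [mul_sub, mul_one, Finset.sum_sub_distrib, sub_eq_zero] at this
      push_cast
      rw [← this, Finset.sum_mul]
      exact Finset.sum_congr rfl fun μ _ => by rw [div_eq_mul_inv]; ring
    have h2 : IsAlgebraic ℚ (∑ μ ∈ t, (w μ : K) * (ν / μ)) := by
      rw [← mem_algebraicClosure_iff]
      refine (algebraicClosure ℚ K).sum_mem fun μ hμ => mem_algebraicClosure_iff.mpr ?_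
      refine (isAlgebraic_natCast (w μ)).mul ?_
      have h3 : (ν / μ) ^ M = 1 := by
        rw [div_pow, (Finset.mem_filter.mp hμ).2, div_self (pow_ne_zero _ (hne ν hν))]
      refine IsAlgebraic.of_pow hM ?_
      rw [h3]
      exact isAlgebraic_one
    have h4 : ν = (((∑ μ ∈ t, w μ : ℕ) : ℚ)⁻¹ : ℚ) • ∑ μ ∈ t, (w μ : K) * (ν / μ) := by
      rw [← h1, Rat.smul_def, ← mul_assoc, ← Rat.cast_mul, inv_mul_cancel₀ (by exact_mod_cast hA),
        Rat.cast_one, one_mul]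
    rw [h4]
    exact h2.smul _
  let L := algebraicClosure ℚ K
  have : Algebra.IsAlgebraic ℚ L := algebraicClosure.isAlgebraic ℚ K
  let φ : L →ₐ[ℚ] ℂ := IsAlgClosed.lift
  have hlift : ∀ μ ∈ s, ∃ x : L, (x : K) = μ := fun μ hμ => ⟨⟨μ, mem_algebraicClosure_iff.mpr (halg μ hμ)⟩, rfl⟩
  choose! e he using hlift
  have hC : ∀ ν ∈ s, ∑ μ ∈ s with μ ^ M = ν ^ M, (w μ : ℂ) * ((φ (e μ))⁻¹ - 1) = 0 := by
    intro ν hν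
    have h1 : ∑ μ ∈ s with μ ^ M = ν ^ M, (w μ : L) * ((e μ)⁻¹ - 1) = 0 := by
      apply Subtype.coe_injective
      push_cast
      rw [← hgroup ν hν]
      refine Finset.sum_congr rfl fun μ hμ => ?_
      rw [he μ (Finset.mem_filter.mp hμ).1]
    have h2 := congrArg φ h1
    simpa using h2
  -- The absolute value is constant on each group, so the relations of the groups can be weighted
  -- with its square and added up.
  have hmod : ∀ μ ∈ s, ∀ ν ∈ s, μ ^ M = ν ^ M → ‖φ (e μ)‖ = ‖φ (e ν)‖ := by
    intro μ hμ ν hν h1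
    have h2 : e μ ^ M = e ν ^ M := by
      apply Subtype.coe_injective
      push_cast
      rw [he μ hμ, he ν hν, h1]
    have h3 := congrArg (fun x => ‖φ x‖) h2
    simp only [map_pow, norm_pow] at h3
    exact (pow_left_inj₀ (norm_nonneg _) (norm_nonneg _) hM.ne').mp h3
  have hne' : ∀ μ ∈ s, φ (e μ) ≠ 0 := by
    intro μ hμ h1
    rw [map_eq_zero] at h1
    exact hne μ hμ (by rw [← he μ hμ, h1]; rfl)
  have hsum : ∑ μ ∈ s, (w μ : ℂ) * ((φ (e μ))⁻¹ - 1) * (‖φ (e μ)‖ : ℂ) ^ 2 = 0 := by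
    rw [← Finset.sum_fiberwise_of_maps_to (t := s.image (· ^ M)) (g := (· ^ M))
      (fun μ hμ => Finset.mem_image_of_mem _ hμ)]
    refine Finset.sum_eq_zero fun x hx => ?_
    obtain ⟨ν, hν, rfl⟩ := Finset.mem_image.mp hx
    have h1 := congrArg (· * (‖φ (e ν)‖ : ℂ) ^ 2) (hC ν hν)
    simp only [zero_mul, Finset.sum_mul] at h1
    rw [← h1]
    refine Finset.sum_congr rfl fun μ hμ => ?_
    rw [hmod μ (Finset.mem_filter.mp hμ).1 ν hν (Finset.mem_filter.mp hμ).2]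
  intro h0
  have h1 : ∑ μ ∈ s, (w μ : ℂ) * φ (e μ) = 0 := by
    have h2 : ∑ μ ∈ s, (w μ : K) * μ = 0 := by
      have h3 := htr 1
      rw [hpow, pow_one, h0, map_zero] at h3
      simpa using h3.symm
    have h3 : ∑ μ ∈ s, (w μ : L) * e μ = 0 := by
      apply Subtype.coe_injective
      push_cast
      rw [← h2]
      exact Finset.sum_congr rfl fun μ hμ => by rw [he μ hμ]
    simpa using congrArg φ h3
  have h2 : ∑ μ ∈ s, (w μ : ℝ) * ‖φ (e μ)‖ ^ 2 = 0 := by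
    have h3 : ∑ μ ∈ s, (w μ : ℂ) * (starRingEnd ℂ) (φ (e μ)) = 0 := by
      simpa using congrArg (starRingEnd ℂ) h1
    -- The conjugate of `x` is `x⁻¹ ‖x‖ ^ 2`.
    have h4 : ∑ μ ∈ s, (w μ : ℂ) * (‖φ (e μ)‖ : ℂ) ^ 2 = 0 := by
      rw [← h3, ← sub_eq_zero, ← Finset.sum_sub_distrib, ← neg_eq_zero, ← Finset.sum_neg_distrib,
        ← hsum]
      refine Finset.sum_congr rfl fun μ hμ => ?_
      have h5 : (starRingEnd ℂ) (φ (e μ)) = (φ (e μ))⁻¹ * (‖φ (e μ)‖ : ℂ) ^ 2 := by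
        rw [← Complex.mul_conj', ← mul_assoc, inv_mul_cancel₀ (hne' μ hμ), one_mul]
      rw [h5]
      ring
    exact_mod_cast h4
  have h3 : 0 < ∑ μ ∈ s, (w μ : ℝ) * ‖φ (e μ)‖ ^ 2 := by
    refine Finset.sum_pos (fun μ hμ => ?_) hsne
    have h10 := hwpos μ hμ
    have h11 := norm_pos_iff.mpr (hne' μ hμ)
    positivity
  exact h3.ne' h2

/-! ### Convolution with algebra homomorphisms and constants -/

section Convolution

open WithConv Coalgebra HopfAlgebra

variable {F C R : Type*} [Field F] [Ring R] [Algebra F R]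

/-- The convolution inverse of an algebra homomorphism is its composite with the antipode. -/
theorem conv_algHom_mul_antipode [Ring C] [HopfAlgebra F C] (f : C →ₐ[F] R) :
    toConv f.toLinearMap * toConv (f.toLinearMap ∘ₗ antipode F) = 1 := by
  have h := LinearMap.algHom_comp_convMul_distrib f (toConv LinearMap.id) (toConv (antipode F (A := C)))
  rw [LinearMap.id_mul_antipode] at h
  apply WithConv.ext
  simp only [LinearMap.comp_id] at h
  rw [← h]
  ext x
  simp [LinearMap.convOne_def]

theorem conv_antipode_mul_algHom [Ring C] [HopfAlgebra F C] (f : C →ₐ[F] R) :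
    toConv (f.toLinearMap ∘ₗ antipode F) * toConv f.toLinearMap = 1 := by
  have h := LinearMap.algHom_comp_convMul_distrib f (toConv (antipode F (A := C))) (toConv LinearMap.id)
  rw [LinearMap.antipode_mul_id] at h
  apply WithConv.ext
  simp only [LinearMap.comp_id] at h
  rw [← h]
  ext x
  simp [LinearMap.convOne_def]

variable [AddCommMonoid C] [Module F C] [Coalgebra F C]

theorem conv_const_mul (t : R) (X : WithConv (C →ₗ[F] R)) (c : C) :
    (toConv ((counit (R := F) (A := C)).smulRight t) * X) c = t * X c := by
  rw [(ℛ F c).convMul_apply]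
  conv_rhs => rw [← Coalgebra.sum_counit_smul (ℛ F c)]
  simp [Finset.mul_sum]

theorem sum_smul_counit {ι : Type*} {c : C} (r : Coalgebra.Repr F c ι) :
    ∑ i ∈ r.index, counit (R := F) (r.right i) • r.left i = c := by
  have := congrArg (TensorProduct.rid F C) (Coalgebra.sum_tmul_counit_eq r)
  rw [map_sum] at this
  simpa only [TensorProduct.rid_tmul, one_smul] using this

theorem conv_mul_const (t : R) (X : WithConv (C →ₗ[F] R)) (c : C) :
    (X * toConv ((counit (R := F) (A := C)).smulRight t)) c = X c * t := by
  rw [(ℛ F c).convMul_apply]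
  conv_rhs => rw [← sum_smul_counit (ℛ F c)]
  simp [Finset.sum_mul]

end Convolution

/-! ### The trace of left multiplication twisted by the square of the antipode -/

section LarsonRadford

open WithConv Coalgebra HopfAlgebra Algebra.TensorProduct

variable {F H : Type*} [Field F] [Ring H] [HopfAlgebra F H]

local notation "S" => antipode F (A := H)
local notation "Δ" => comul (R := F) (A := H)

/-- The comultiplication is the convolution product of the inclusions `h ↦ h ⊗ 1` and `h ↦ 1 ⊗ h`. -/
theorem toConv_comul : toConv Δ = toConv (includeLeft : H →ₐ[F] H ⊗[F] H).toLinearMap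
    * toConv (includeRight : H →ₐ[F] H ⊗[F] H).toLinearMap := by
  have : (LinearMap.mul' F (H ⊗[F] H)) ∘ₗ TensorProduct.map
    (includeLeft : H →ₐ[F] H ⊗[F] H).toLinearMap (includeRight : H →ₐ[F] H ⊗[F] H).toLinearMap
      = LinearMap.id := by
    ext; simp
  ext x
  exact (congrArg (fun f => f (Δ x)) this).symm

theorem toConv_comul_antipode : toConv (Δ ∘ₗ S)
    = toConv ((includeRight : H →ₐ[F] H ⊗[F] H).toLinearMap ∘ₗ S)
      * toConv ((includeLeft : H →ₐ[F] H ⊗[F] H).toLinearMap ∘ₗ S) := by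
  refine left_inv_eq_right_inv (a := toConv Δ)
    (conv_antipode_mul_algHom (Bialgebra.comulAlgHom F H)) ?_
  rw [toConv_comul, mul_assoc, ← mul_assoc (toConv (includeRight : H →ₐ[F] H ⊗[F] H).toLinearMap),
    conv_algHom_mul_antipode, one_mul, conv_algHom_mul_antipode]

/-- The antipode reverses the comultiplication. -/
theorem comul_antipode (x : H) :
    Δ (S x) = TensorProduct.comm F H H (TensorProduct.map S S (Δ x)) := by
  have h := congrArg (fun f => f x) (toConv_comul_antipode (F := F) (H := H))
  have h2 : (LinearMap.mul' F (H ⊗[F] H)) ∘ₗ TensorProduct.map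
      ((includeRight : H →ₐ[F] H ⊗[F] H).toLinearMap ∘ₗ S)
      ((includeLeft : H →ₐ[F] H ⊗[F] H).toLinearMap ∘ₗ S)
      = (TensorProduct.comm F H H).toLinearMap ∘ₗ TensorProduct.map S S := by
    ext; simp
  exact h.trans (congrArg (fun f => f (Δ x)) h2)

/-- `Δ(S k₁) (k₂ ⊗ 1) = 1 ⊗ S k`. -/
theorem toConv_comul_antipode_mul : toConv (Δ ∘ₗ S)
      * toConv (includeLeft : H →ₐ[F] H ⊗[F] H).toLinearMap
    = toConv ((includeRight : H →ₐ[F] H ⊗[F] H).toLinearMap ∘ₗ S) := by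
  rw [toConv_comul_antipode, mul_assoc, conv_antipode_mul_algHom, mul_one]

/-- For a right integral `t`: `t₁ h ⊗ t₂ = t₁ ⊗ t₂ S(h)`. -/
theorem comul_mul_tmul_one {t : H} (ht : ∀ h, t * h = counit (R := F) h • t) (h : H) :
    Δ t * (h ⊗ₜ[F] 1) = Δ t * (1 ⊗ₜ[F] S h) := by
  let c : WithConv (H →ₗ[F] H ⊗[F] H) := toConv ((counit (R := F) (A := H)).smulRight (Δ t))
  have h1 : c * toConv Δ = c := by
    ext x
    rw [conv_const_mul]
    simp [c, ← Bialgebra.comul_mul, ht]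
  have h2 : c * toConv (includeLeft : H →ₐ[F] H ⊗[F] H).toLinearMap
      = c * toConv ((includeRight : H →ₐ[F] H ⊗[F] H).toLinearMap ∘ₗ S) := by
    conv_rhs => rw [← h1, toConv_comul, mul_assoc, mul_assoc, conv_algHom_mul_antipode, mul_one]
  have h3 : (c * _) h = (c * _) h := congrArg (fun f => f h) h2
  rw [conv_const_mul, conv_const_mul] at h3
  exact h3

/-- For a left integral `t`: `t₁ ⊗ h t₂ = S(h) t₁ ⊗ t₂`. -/
theorem one_tmul_mul_comul {t : H} (ht : ∀ h, h * t = counit (R := F) h • t) (h : H) :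
    (1 ⊗ₜ[F] h) * Δ t = (S h ⊗ₜ[F] 1) * Δ t := by
  let c : WithConv (H →ₗ[F] H ⊗[F] H) := toConv ((counit (R := F) (A := H)).smulRight (Δ t))
  have h1 : toConv Δ * c = c := by
    ext x
    rw [conv_mul_const]
    simp [c, ← Bialgebra.comul_mul, ht]
  have h2 : toConv (includeRight : H →ₐ[F] H ⊗[F] H).toLinearMap * c
      = toConv ((includeLeft : H →ₐ[F] H ⊗[F] H).toLinearMap ∘ₗ S) * c := by
    conv_rhs => rw [← h1, toConv_comul, ← mul_assoc, ← mul_assoc, conv_antipode_mul_algHom, one_mul]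
  have h3 : (_ * c) h = (_ * c) h := congrArg (fun f => f h) h2
  rw [conv_mul_const, conv_mul_const] at h3
  exact h3

/-- The left coaction `h ↦ h₁ f(h₂)` of the dual. -/
def leftHit {C : Type*} [AddCommGroup C] [Module F C] [Coalgebra F C] (f : Module.Dual F C) :
    C →ₗ[F] C :=
  (TensorProduct.rid F C).toLinearMap ∘ₗ f.lTensor C ∘ₗ comul

/-- The right coaction `h ↦ f(h₁) h₂` of the dual. -/
def rightHit {C : Type*} [AddCommGroup C] [Module F C] [Coalgebra F C] (f : Module.Dual F C) :
    C →ₗ[F] C :=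
  (TensorProduct.lid F C).toLinearMap ∘ₗ f.rTensor C ∘ₗ comul

theorem leftHit_apply {C ι : Type*} [AddCommGroup C] [Module F C] [Coalgebra F C]
    (f : Module.Dual F C) {x : C} (r : Coalgebra.Repr F x ι) :
    leftHit f x = ∑ i ∈ r.index, f (r.right i) • r.left i := by
  simp [leftHit, ← r.eq]

theorem rightHit_apply {C ι : Type*} [AddCommGroup C] [Module F C] [Coalgebra F C]
    (f : Module.Dual F C) {x : C} (r : Coalgebra.Repr F x ι) :
    rightHit f x = ∑ i ∈ r.index, f (r.left i) • r.right i := by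
  simp [rightHit, ← r.eq]

/-- The twisted trace `x ↦ Tr(L_x ∘ S²)`; it is an integral of the dual Hopf algebra. -/
def twistedTrace (F H : Type*) [Field F] [Ring H] [HopfAlgebra F H] : Module.Dual F H :=
  LinearMap.trace F H ∘ₗ LinearMap.lcomp F H (antipode F ∘ₗ antipode F) ∘ₗ LinearMap.mul F H

local notation "lam" => twistedTrace F H

theorem twistedTrace_apply (x : H) :
    lam x = LinearMap.trace F H (LinearMap.mulLeft F x ∘ₗ S ∘ₗ S) := rfl

/-- The square of the antipode is the Nakayama automorphism of the twisted trace. -/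
theorem twistedTrace_mul (x y : H) : lam (y * x) = lam (x * S (S y)) := by
  have h : LinearMap.mulLeft F (x * S (S y)) ∘ₗ S ∘ₗ S
      = LinearMap.mulLeft F x ∘ₗ (S ∘ₗ S) ∘ₗ LinearMap.mulLeft F y := by
    ext h
    simp [antipode_mul_antidistrib]
  rw [twistedTrace_apply, twistedTrace_apply, h]
  have := LinearMap.trace_mul_comm F (LinearMap.mulLeft F x ∘ₗ (S ∘ₗ S)) (LinearMap.mulLeft F y)
  rw [Module.End.mul_eq_comp, Module.End.mul_eq_comp, LinearMap.comp_assoc] at this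
  rw [this, LinearMap.mulLeft_mul, LinearMap.comp_assoc]

variable [FiniteDimensional F H]

/-- The map `h ↦ f(T(h₂)₁ S(h₁)) T(h₂)₂`. Its trace does not see the twist by the coproduct, and for
`T = L_x ∘ S²` it is a combination of maps of the same form. -/
def traceTwist (f : Module.Dual F H) (T : H →ₗ[F] H) : H →ₗ[F] H :=
  (TensorProduct.lid F H).toLinearMap ∘ₗ f.rTensor H ∘ₗ LinearMap.mul' F (H ⊗[F] H)
    ∘ₗ (TensorProduct.comm F _ _).toLinearMap
    ∘ₗ TensorProduct.map ((includeLeft : H →ₐ[F] H ⊗[F] H).toLinearMap ∘ₗ S) (Δ ∘ₗ T) ∘ₗ Δ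

/-- For `T = φ(·) v` the trace is `f(v₁ S(v₂)) φ(v₃)`, where the first two factors collapse to `1`. -/
theorem trace_traceTwist (f : Module.Dual F H) (T : H →ₗ[F] H) :
    LinearMap.trace F H (traceTwist f T) = f 1 * LinearMap.trace F H T := by
  obtain ⟨t, rfl⟩ := (dualTensorHomEquiv F H H).surjective T
  change LinearMap.trace F H (traceTwist f (dualTensorHom F H H t))
    = f 1 * LinearMap.trace F H (dualTensorHom F H H t)
  induction t with
  | zero => simp [traceTwist]
  | add x y hx hy =>
    have : traceTwist f (dualTensorHom F H H (x + y))
        = traceTwist f (dualTensorHom F H H x) + traceTwist f (dualTensorHom F H H y) := by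
      simp only [traceTwist, map_add, LinearMap.comp_add, TensorProduct.map_add_right,
        LinearMap.add_comp]
    rw [this, map_add, hx, hy, map_add, map_add, mul_add]
  | tmul φ v =>
    let r := ℛ F v
    let g : H → Module.Dual F H := fun a =>
      LinearMap.mul' F F ∘ₗ TensorProduct.map (f ∘ₗ LinearMap.mulLeft F a ∘ₗ S) φ ∘ₗ Δ
    have h1 : traceTwist f (dualTensorHom F H H (φ ⊗ₜ v))
        = ∑ i ∈ r.index, (g (r.left i)).smulRight (r.right i) := by
      have : ∀ z : H ⊗[F] H, TensorProduct.lid F H (f.rTensor H (LinearMap.mul' F (H ⊗[F] H)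
          (TensorProduct.comm F _ _ (TensorProduct.map
            ((includeLeft : H →ₐ[F] H ⊗[F] H).toLinearMap ∘ₗ S)
            (Δ ∘ₗ dualTensorHom F H H (φ ⊗ₜ v)) z))))
          = ∑ i ∈ r.index, (LinearMap.mul' F F (TensorProduct.map
            (f ∘ₗ LinearMap.mulLeft F (r.left i) ∘ₗ S) φ z)) • r.right i := by
        intro z
        induction z with
        | zero => simp
        | add x y hx hy => simp only [map_add, hx, hy, add_smul, Finset.sum_add_distrib]
        | tmul x y =>
          simp [← r.eq, Finset.sum_mul, Finset.smul_sum, smul_smul, mul_comm]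
      ext h
      simpa [traceTwist, g] using this (Δ h)
    rw [h1, map_sum]
    simp only [LinearMap.trace_smulRight]
    have h2 : toConv LinearMap.id * (toConv S * toConv (φ.smulRight (1 : H)))
        = toConv (φ.smulRight (1 : H)) := by
      rw [← mul_assoc, LinearMap.id_mul_antipode, one_mul]
    have h3 := congrArg (fun X => f (X v)) h2
    simp only [r.convMul_apply, map_sum] at h3
    have h4 : ∀ a b : H, f (a * (toConv S * toConv (φ.smulRight (1 : H))) b) = g a b := by
      intro a b
      have : ∀ z : H ⊗[F] H, f (a * (LinearMap.mul' F H (TensorProduct.map S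
          (φ.smulRight (1 : H)) z))) = LinearMap.mul' F F (TensorProduct.map
            (f ∘ₗ LinearMap.mulLeft F a ∘ₗ S) φ z) := by
        intro z
        induction z with
        | zero => simp
        | add x y hx hy => simp only [map_add, mul_add, hx, hy]
        | tmul x y => simp [mul_comm]
      exact this (Δ b)
    have h5 := (Finset.sum_congr rfl fun i _ => h4 (r.left i) (r.right i)).symm.trans h3
    rw [h5]
    simp [LinearMap.trace_eq_contract_apply, mul_comm]

/-- The twisted trace is an integral: `x₁ λ(x₂) = λ(x) 1`. -/
theorem leftHit_twistedTrace (x : H) : leftHit lam x = lam x • 1 := by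
  rw [← sub_eq_zero]
  refine (Module.forall_dual_apply_eq_zero_iff F _).mp fun f => ?_
  rw [map_sub, sub_eq_zero, map_smul]
  let r := ℛ F x
  -- The trace of `traceTwist f (L_x ∘ S²)` is `f(1) λ(x)` by `trace_traceTwist`, and
  -- `f(x₁) λ(x₂)` because `Δ(S² h₂) (S h₁ ⊗ 1) = 1 ⊗ S² h`.
  have h1 : traceTwist f (LinearMap.mulLeft F x ∘ₗ S ∘ₗ S)
      = ∑ i ∈ r.index, f (r.left i) • (LinearMap.mulLeft F (r.right i) ∘ₗ S ∘ₗ S) := by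
    ext h
    have h2 : LinearMap.mul' F (H ⊗[F] H) ((TensorProduct.comm F _ _) (TensorProduct.map
        ((includeLeft : H →ₐ[F] H ⊗[F] H).toLinearMap ∘ₗ S)
        (Δ ∘ₗ LinearMap.mulLeft F x ∘ₗ S ∘ₗ S) (Δ h))) = Δ x * (1 ⊗ₜ S (S h)) := by
      have h3 := congrArg (fun X => X (S h)) (toConv_comul_antipode_mul (F := F) (H := H))
      simp only [LinearMap.convMul_apply, comul_antipode] at h3
      have h4 : Δ x * (1 ⊗ₜ S (S h)) = Δ x * ((toConv
        ((includeRight : H →ₐ[F] H ⊗[F] H).toLinearMap ∘ₗ S)) (S h)) := by simp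
      rw [h4, ← h3]
      have : ∀ z : H ⊗[F] H, LinearMap.mul' F (H ⊗[F] H) ((TensorProduct.comm F _ _)
          (TensorProduct.map ((includeLeft : H →ₐ[F] H ⊗[F] H).toLinearMap ∘ₗ S)
          (Δ ∘ₗ LinearMap.mulLeft F x ∘ₗ S ∘ₗ S) z))
          = Δ x * LinearMap.mul' F (H ⊗[F] H) (TensorProduct.map (Δ ∘ₗ S)
            (includeLeft : H →ₐ[F] H ⊗[F] H).toLinearMap
            (TensorProduct.comm F H H (TensorProduct.map S S z))) := by
        intro z
        induction z with
        | zero => simp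
        | add x y hx hy => simp only [map_add, mul_add, hx, hy]
        | tmul a b => simp [mul_assoc]
      exact this (Δ h)
    have h3 := congrArg (fun z => TensorProduct.lid F H (f.rTensor H z)) h2
    refine h3.trans ?_
    simp [← r.eq, Finset.sum_mul]
  have h2 := trace_traceTwist f (LinearMap.mulLeft F x ∘ₗ S ∘ₗ S)
  rw [h1, map_sum, ← twistedTrace_apply] at h2
  rw [leftHit_apply lam r, map_sum, smul_eq_mul, mul_comm, ← h2]
  refine Finset.sum_congr rfl fun i _ => ?_
  rw [map_smul, map_smul, ← twistedTrace_apply, smul_eq_mul, smul_eq_mul, mul_comm]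

end LarsonRadford

/-! ### Integrals and the trace form of a semisimple algebra -/

section Semisimple

variable {F R : Type*} [Field F] [Ring R] [Algebra F R]

/-- A normalized left integral with respect to a character of a semisimple algebra. -/
theorem exists_left_integral [IsSemisimpleRing R] (ε : R →ₐ[F] F) :
    ∃ t : R, ε t = 1 ∧ ∀ h, h * t = ε h • t := by
  obtain ⟨J, hJ⟩ := exists_isCompl (RingHom.ker ε : Submodule R R)
  have h1 : (1 : R) ∈ (RingHom.ker ε : Submodule R R) ⊔ J := by rw [hJ.sup_eq_top]; trivial
  obtain ⟨i, hi, t, ht, hit⟩ := Submodule.mem_sup.mp h1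
  have hεt : ε t = 1 := by
    have := congrArg ε hit
    rwa [map_add, (RingHom.mem_ker).mp hi, zero_add, map_one] at this
  refine ⟨t, hεt, fun h => ?_⟩
  have h2 : (h - algebraMap F R (ε h)) * t ∈ J := J.smul_mem _ ht
  have h3 : (h - algebraMap F R (ε h)) * t ∈ (RingHom.ker ε : Submodule R R) := by
    apply (RingHom.mem_ker).mpr
    simp
  have h4 := (Submodule.disjoint_def.mp hJ.disjoint) _ h3 h2
  rw [sub_mul, sub_eq_zero] at h4
  rw [h4, Algebra.smul_def]

/-- A normalized two-sided integral with respect to a character of a semisimple algebra. -/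
theorem exists_integral [IsSemisimpleRing R] (ε : R →ₐ[F] F) :
    ∃ t : R, ε t = 1 ∧ (∀ h, h * t = ε h • t) ∧ ∀ h, t * h = ε h • t := by
  obtain ⟨t, ht, hl⟩ := exists_left_integral ε
  obtain ⟨s, hs, hr⟩ := exists_left_integral (R := Rᵐᵒᵖ) (F := F) (AlgHom.fromOpposite ε fun _ _ => mul_comm _ _)
  have hr' : ∀ h, s.unop * h = ε h • s.unop := fun h => congrArg MulOpposite.unop (hr (.op h))
  have hs' : ε s.unop = 1 := hs
  have : s.unop = t := by
    have h1 := hl s.unop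
    rw [hr' t, ht, hs', one_smul, one_smul] at h1
    exact h1
  exact ⟨t, ht, hl, this ▸ hr'⟩

/-- The trace of left multiplication, `x ↦ Tr(L_x)`. -/
def leftTrace (F R : Type*) [Field F] [Ring R] [Algebra F R] : Module.Dual F R :=
  LinearMap.trace F R ∘ₗ LinearMap.mul F R

theorem leftTrace_apply (x : R) :
    leftTrace F R x = LinearMap.trace F R (LinearMap.mulLeft F x) := rfl

theorem leftTrace_mul_comm (x y : R) : leftTrace F R (x * y) = leftTrace F R (y * x) := by
  simp only [leftTrace_apply, LinearMap.mulLeft_mul]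
  exact LinearMap.trace_mul_comm F _ _

variable [FiniteDimensional F R] [CharZero F]

/-- The trace form of a semisimple algebra in characteristic zero is nondegenerate. -/
theorem eq_zero_of_trace_mul_eq_zero [IsSemisimpleRing R] {x : R}
    (hx : ∀ y, leftTrace F R (y * x) = 0) : x = 0 := by
  -- The radical of the trace form is a left ideal, so it is generated by an idempotent; that
  -- idempotent has trace zero, hence rank zero.
  let N : Submodule R R :=
    { carrier := {x | ∀ y, leftTrace F R (y * x) = 0}
      add_mem' := fun ha hb y => by rw [mul_add, map_add, ha, hb, add_zero]
      zero_mem' := fun y => by simp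
      smul_mem' := fun c a ha y => by rw [smul_eq_mul, ← mul_assoc]; exact ha _ }
  obtain ⟨J, hJ⟩ := exists_isCompl N
  have h1 : (1 : R) ∈ N ⊔ J := by rw [hJ.sup_eq_top]; trivial
  obtain ⟨e, he, f, hf, hef⟩ := Submodule.mem_sup.mp h1
  have key : ∀ z ∈ N, z = z * e := by
    intro z hz
    have h2 : z * f ∈ J := J.smul_mem _ hf
    have h3 : z * f = z - z * e := by rw [eq_sub_iff_add_eq', ← mul_add, hef, mul_one]
    have h4 := Submodule.disjoint_def.mp hJ.disjoint (z * f)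
      (h3 ▸ N.sub_mem hz (N.smul_mem z he)) h2
    rw [h4, eq_comm, sub_eq_zero] at h3
    exact h3
  have hid : IsIdempotentElem (LinearMap.mulLeft F e) := by
    change LinearMap.mulLeft F e * LinearMap.mulLeft F e = LinearMap.mulLeft F e
    rw [Module.End.mul_eq_comp, ← LinearMap.mulLeft_mul, ← key e he]
  have he0 : e = 0 := by
    have h2 := (LinearMap.IsIdempotentElem.trace_eq_zero_iff hid).mp (by
      have := he 1
      rw [one_mul] at this
      exact this)
    simpa using congrArg (fun f => f 1) h2
  rw [key x hx, he0, mul_zero]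

/-- In a semisimple algebra left and right multiplication have the same trace: they are adjoint
with respect to the trace form. -/
theorem trace_mulRight [IsSemisimpleRing R] (b : R) :
    LinearMap.trace F R (LinearMap.mulRight F b) = leftTrace F R b := by
  let T : R →ₗ[F] Module.Dual F R :=
    LinearMap.llcomp F R R F (leftTrace F R) ∘ₗ LinearMap.mul F R
  have hT : Function.Injective T := by
    refine (injective_iff_map_eq_zero T).mpr fun x hx => eq_zero_of_trace_mul_eq_zero (F := F) fun y => ?_
    rw [leftTrace_mul_comm]
    exact congrArg (fun f => f y) hx
  let e := LinearMap.linearEquivOfInjective T hT Subspace.dual_finrank_eq.symm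
  have h1 : e.conj (LinearMap.mulRight F b) = Module.Dual.transpose (LinearMap.mulLeft F b) := by
    apply LinearMap.ext
    intro φ
    obtain ⟨x, rfl⟩ := e.surjective φ
    rw [LinearEquiv.conj_apply_apply, LinearEquiv.symm_apply_apply]
    ext y
    change leftTrace F R (x * b * y) = leftTrace F R (x * (b * y))
    rw [mul_assoc]
  rw [← LinearMap.trace_conj' _ e, h1, LinearMap.trace_transpose']
  rfl

end Semisimple

/-! ### Integrals of the dual of a semisimple Hopf algebra -/

section LarsonRadford

open WithConv Coalgebra HopfAlgebra Algebra.TensorProduct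

variable {F H : Type*} [Field F] [Ring H] [HopfAlgebra F H]

local notation "S" => antipode F (A := H)
local notation "Δ" => comul (R := F) (A := H)
local notation "ε" => counit (R := F) (A := H)
local notation "lam" => twistedTrace F H

/-- For a right integral `t` and an integral `μ` of the dual: `t₁ μ(t₂ S(h)) = μ(t) h`. -/
theorem leftHit_mulRight_antipode {t : H} (ht : ∀ h, t * h = ε h • t) {μ : Module.Dual F H}
    (hμ : ∀ x, leftHit μ x = μ x • 1) (h : H) :
    leftHit (μ ∘ₗ LinearMap.mulRight F (S h)) t = μ t • h := by
  have h1 := congrArg (fun z => TensorProduct.rid F H (μ.lTensor H z)) (comul_mul_tmul_one ht h)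
  let r := ℛ F t
  simp only [← r.eq, Finset.sum_mul, tmul_mul_tmul, mul_one, map_sum, LinearMap.lTensor_tmul,
    TensorProduct.rid_tmul] at h1
  have h2 := hμ t
  rw [leftHit_apply _ r] at h2 ⊢
  refine h1.symm.trans ?_
  have h3 := congrArg (· * h) h2
  simpa [Finset.sum_mul] using h3

variable [FiniteDimensional F H]

/-- The twisted trace takes the value `1` on the normalized integral `t`, since `L_t ∘ S²` is the
projection `h ↦ ε(h) t`. -/
theorem twistedTrace_integral {t : H} (h1 : ε t = 1) (ht : ∀ h, t * h = ε h • t) :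
    lam t = 1 := by
  have : LinearMap.mulLeft F t ∘ₗ S ∘ₗ S = (ε).smulRight t := by
    ext h
    simp [ht]
  rw [twistedTrace_apply, this, LinearMap.trace_smulRight, h1]

/-- Integrals of the dual are unique up to scalars. -/
theorem dual_integral_unique {t : H} (h3 : ∀ h, t * h = ε h • t) (h4 : lam t = 1)
    {μ : Module.Dual F H} (hμ : ∀ x, leftHit μ x = μ x • 1) : μ = μ t • lam := by
  -- The map `f ↦ t₁ f(t₂)` is onto, hence bijective, and takes the same values at `μ` and `μ(t) λ`.
  let Q : Module.Dual F H →ₗ[F] H :=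
    { toFun := fun f => leftHit f t
      map_add' := fun f g => by
        rw [leftHit_apply _ (ℛ F t), leftHit_apply _ (ℛ F t), leftHit_apply _ (ℛ F t)]
        simp [add_smul, Finset.sum_add_distrib]
      map_smul' := fun c f => by
        rw [leftHit_apply _ (ℛ F t), leftHit_apply _ (ℛ F t)]
        simp [Finset.smul_sum, smul_smul] }
  have hQs : Function.Surjective Q := fun h =>
    ⟨lam ∘ₗ LinearMap.mulRight F (S h), by
      have h5 := leftHit_mulRight_antipode h3 leftHit_twistedTrace h
      rwa [h4, one_smul] at h5⟩
  have hQ : Function.Injective Q :=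
    (LinearMap.injective_iff_surjective_of_finrank_eq_finrank Subspace.dual_finrank_eq).mpr hQs
  have hA : ∀ h : H, Q (μ ∘ₗ LinearMap.mulRight F (S h)) = μ t • h := leftHit_mulRight_antipode h3 hμ
  have hB : ∀ h : H, Q (lam ∘ₗ LinearMap.mulRight F (S h)) = h := fun h => by
    have h5 := leftHit_mulRight_antipode h3 leftHit_twistedTrace h
    rwa [h4, one_smul] at h5
  have h5 : Q μ = Q (μ t • lam) := by
    have e1 : LinearMap.mulRight F (S 1) = LinearMap.id := by
      rw [antipode_one, LinearMap.mulRight_one]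
    have hA1 := hA 1
    have hB1 := hB 1
    rw [e1, LinearMap.comp_id] at hA1 hB1
    rw [map_smul, hA1, hB1]
  exact hQ h5

variable [IsSemisimpleRing H]

/-- A two-sided integral of a semisimple Hopf algebra, normalized by the counit and by the twisted
trace. -/
theorem exists_hopf_integral (F H : Type*) [Field F] [Ring H] [HopfAlgebra F H]
    [FiniteDimensional F H] [IsSemisimpleRing H] : ∃ t : H, counit (R := F) t = 1 ∧ (∀ h, h * t = counit (R := F) h • t) ∧
    (∀ h, t * h = counit (R := F) h • t) ∧ twistedTrace F H t = 1 := by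
  obtain ⟨t, h1, h2, h3⟩ := exists_integral (Bialgebra.counitAlgHom F H)
  exact ⟨t, h1, h2, h3, twistedTrace_integral h1 h3⟩

/-- An element can be recovered from its image under the antipode: `h = t₁ λ(t₂ S(h))`. -/
theorem antipode_injective (F H : Type*) [Field F] [Ring H] [HopfAlgebra F H]
    [FiniteDimensional F H] [IsSemisimpleRing H] : Function.Injective (antipode F (A := H)) := by
  obtain ⟨t, h1, h2, h3, h4⟩ := exists_hopf_integral F H
  refine (injective_iff_map_eq_zero _).mpr fun h hh => ?_
  have h5 := leftHit_mulRight_antipode h3 leftHit_twistedTrace h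
  rw [h4, one_smul, hh] at h5
  rw [← h5, leftHit_apply _ (ℛ F t)]
  simp

theorem antipode_surjective (F H : Type*) [Field F] [Ring H] [HopfAlgebra F H]
    [FiniteDimensional F H] [IsSemisimpleRing H] : Function.Surjective (antipode F (A := H)) :=
  LinearMap.surjective_of_injective (antipode_injective F H)

/-- The bilinear form of the twisted trace is nondegenerate. -/
theorem eq_zero_of_twistedTrace_mul_eq_zero {x : H} (hx : ∀ y, lam (y * x) = 0) : x = 0 := by
  obtain ⟨t, h1, h2, h3, h4⟩ := exists_hopf_integral F H
  obtain ⟨h, rfl⟩ := antipode_surjective F H x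
  have h5 := leftHit_mulRight_antipode h3 leftHit_twistedTrace h
  rw [h4, one_smul, leftHit_apply _ (ℛ F t)] at h5
  rw [← h5]
  simp [hx]

end LarsonRadford

/-! ### The modular element and the fourth power of the antipode -/

section LarsonRadford

open WithConv Coalgebra HopfAlgebra Algebra.TensorProduct

variable {F H : Type*} [Field F] [Ring H] [HopfAlgebra F H]

local notation "S" => antipode F (A := H)
local notation "Δ" => comul (R := F) (A := H)
local notation "ε" => counit (R := F) (A := H)
local notation "lam" => twistedTrace F H

/-- The element `g = λ(t₁) t₂` satisfies `h g = g S⁴(h)`: both integral properties of `t` and the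
Nakayama automorphism `S²` of `λ` move `h` across. -/
theorem mul_rightHit_twistedTrace {t : H} (h2 : ∀ h, h * t = ε h • t) (h3 : ∀ h, t * h = ε h • t)
    (h : H) : h * rightHit lam t = rightHit lam t * S (S (S (S h))) := by
  let r := ℛ F t
  have e1 := congrArg (fun z => TensorProduct.lid F H ((lam).rTensor H z)) (one_tmul_mul_comul h2 h)
  have e2 := congrArg (fun z => TensorProduct.lid F H ((lam).rTensor H z))
    (comul_mul_tmul_one h3 (S (S (S h))))
  simp only [← r.eq, Finset.sum_mul, Finset.mul_sum, tmul_mul_tmul, mul_one, one_mul, map_sum,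
    LinearMap.rTensor_tmul, TensorProduct.lid_tmul] at e1 e2
  simp only [rightHit_apply _ r, Finset.sum_mul, Finset.mul_sum, smul_mul_assoc, mul_smul_comm]
  rw [e1, ← e2]
  simp only [twistedTrace_mul _ (S h)]

variable [FiniteDimensional F H]

/-- The modular element `g` of the dual: `λ(x₁) x₂ = λ(x) g`. -/
theorem rightHit_twistedTrace {t : H} (h3 : ∀ h, t * h = ε h • t) (h4 : lam t = 1) (x : H) :
    rightHit lam x = lam x • rightHit lam t := by
  rw [← sub_eq_zero]
  refine (Module.forall_dual_apply_eq_zero_iff F _).mp fun f => ?_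
  rw [map_sub, sub_eq_zero, map_smul]
  -- `f(λ(x₁) x₂)` is again an integral of the dual in `x`.
  have hμ : ∀ x, leftHit (f ∘ₗ rightHit lam) x = (f ∘ₗ rightHit lam) x • 1 := by
    intro x
    let G : H ⊗[F] (H ⊗[F] H) →ₗ[F] H := (TensorProduct.rid F H).toLinearMap ∘ₗ
      (LinearMap.mul' F F ∘ₗ TensorProduct.map lam f).lTensor H
    have hG : leftHit (f ∘ₗ rightHit lam) x = G ((Δ).lTensor H (Δ x)) := by
      have : ∀ y, f (rightHit lam y) = (LinearMap.mul' F F ∘ₗ TensorProduct.map lam f) (Δ y) := by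
        intro y
        rw [rightHit_apply _ (ℛ F y)]
        conv_rhs => rw [← (ℛ F y).eq]
        simp
      rw [leftHit_apply _ (ℛ F x)]
      conv_rhs => rw [← (ℛ F x).eq]
      simp [G, this]
    rw [hG, ← Coalgebra.coassoc_apply]
    have h5 : ∀ z : H ⊗[F] H, G (TensorProduct.assoc F H H H ((Δ).rTensor H z))
        = (LinearMap.mul' F F ∘ₗ TensorProduct.map lam f) z • 1 := by
      intro z
      induction z with
      | zero => simp
      | add x y hx hy => simp only [map_add, add_smul, hx, hy]
      | tmul a b =>
        have h6 := leftHit_twistedTrace (F := F) a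
        rw [leftHit_apply _ (ℛ F a)] at h6
        rw [LinearMap.rTensor_tmul, ← (ℛ F a).eq]
        simp only [sum_tmul, map_sum]
        simp only [G, TensorProduct.assoc_tmul, LinearMap.comp_apply, LinearMap.lTensor_tmul,
          TensorProduct.map_tmul, LinearMap.mul'_apply, LinearEquiv.coe_coe,
          TensorProduct.rid_tmul]
        simp only [mul_comm _ (f b), mul_smul, ← Finset.smul_sum]
        rw [h6]
    rw [h5, LinearMap.comp_apply f, rightHit_apply _ (ℛ F x)]
    conv_lhs => rw [← (ℛ F x).eq]
    simp
  have h5 := congrArg (fun φ => φ x) (dual_integral_unique h3 h4 hμ)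
  simpa [mul_comm] using h5

/-- The modular element is grouplike. -/
theorem isGroupLike_rightHit_twistedTrace {t : H} (h3 : ∀ h, t * h = ε h • t) (h4 : lam t = 1) :
    IsGroupLikeElem F (rightHit lam t) := by
  constructor
  · have : ∀ z : H ⊗[F] H, ε (TensorProduct.lid F H ((lam).rTensor H z))
      = lam (TensorProduct.rid F H ((ε).lTensor H z)) := by
      intro z
      induction z with
      | zero => simp
      | add x y hx hy => simp only [map_add, hx, hy]
      | tmul a b => simp [mul_comm]
    refine (this (Δ t)).trans ?_
    rw [Coalgebra.lTensor_counit_comul, TensorProduct.rid_tmul, one_smul, h4]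
  · let G : (H ⊗[F] H) ⊗[F] H →ₗ[F] H ⊗[F] H :=
      ((TensorProduct.lid F H).toLinearMap ∘ₗ (lam).rTensor H).rTensor H
    have h5 : ∀ z : H ⊗[F] H, Δ (TensorProduct.lid F H ((lam).rTensor H z))
        = G ((TensorProduct.assoc F H H H).symm ((Δ).lTensor H z)) := by
      intro z
      induction z with
      | zero => simp
      | add x y hx hy => simp only [map_add, hx, hy]
      | tmul a b =>
        rw [LinearMap.lTensor_tmul]
        conv_rhs => rw [← (ℛ F b).eq]
        simp only [tmul_sum, map_sum]
        simp only [G, TensorProduct.assoc_symm_tmul, LinearMap.rTensor_tmul, LinearMap.comp_apply,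
          LinearEquiv.coe_coe, TensorProduct.lid_tmul, map_smul, ← smul_tmul', ← Finset.smul_sum]
        rw [(ℛ F b).eq]
    have h6 : Δ (rightHit lam t) = G ((Δ).rTensor H (Δ t)) := by
      rw [← Coalgebra.coassoc_symm_apply]
      exact h5 (Δ t)
    have h7 : ∀ z : H ⊗[F] H, G ((Δ).rTensor H z)
        = rightHit lam t ⊗ₜ TensorProduct.lid F H ((lam).rTensor H z) := by
      intro z
      induction z with
      | zero => simp
      | add x y hx hy => simp only [map_add, hx, hy, tmul_add]
      | tmul a b =>
        change rightHit lam a ⊗ₜ b = _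
        rw [rightHit_twistedTrace h3 h4]
        simp [smul_tmul']
    rw [h6, h7]
    rfl

/-- Grouplike elements of a finite-dimensional Hopf algebra have finite order. -/
theorem IsGroupLikeElem.exists_pow_eq_one {g : H} (hg : IsGroupLikeElem F g) :
    ∃ N : ℕ, 0 < N ∧ g ^ N = 1 := by
  have : Finite (GroupLike F H) := (linearIndep_groupLikeVal (R := F) (A := H)).finite
  refine ⟨Nat.card (GroupLike F H), Nat.card_pos, ?_⟩
  have := pow_card_eq_one' (x := (⟨g, hg⟩ : GroupLike F H))
  exact congrArg GroupLike.val this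

variable [CharZero F] [IsSemisimpleRing H]

/-- The square of the antipode is inner. -/
theorem exists_antipode_antipode_inner (F H : Type*) [Field F] [Ring H] [HopfAlgebra F H]
    [FiniteDimensional F H] [CharZero F] [IsSemisimpleRing H] :
    ∃ u w : H, u * w = 1 ∧ w * u = 1 ∧ (∀ x, twistedTrace F H x = leftTrace F H (u * x)) ∧
      ∀ y, u * y = antipode F (antipode F y) * u := by
  -- Nondegeneracy of the trace form writes the twisted trace as `Tr(L_u L_x)`; the Nakayama
  -- automorphism of the trace form is trivial, that of the twisted trace is `S²`.
  let T : H →ₗ[F] Module.Dual F H :=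
    LinearMap.llcomp F H H F (leftTrace F H) ∘ₗ LinearMap.mul F H
  have hT : Function.Injective T := by
    refine (injective_iff_map_eq_zero T).mpr fun x hx => eq_zero_of_trace_mul_eq_zero (F := F) fun y => ?_
    rw [leftTrace_mul_comm]
    exact congrArg (fun f => f y) hx
  obtain ⟨u, hu⟩ := (LinearMap.injective_iff_surjective_of_finrank_eq_finrank
    Subspace.dual_finrank_eq.symm).mp hT (twistedTrace F H)
  have hu' : ∀ x, twistedTrace F H x = leftTrace F H (u * x) := fun x =>
    (congrArg (fun f => f x) hu).symm
  have hinj : Function.Injective (LinearMap.mulRight F u) := by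
    refine (injective_iff_map_eq_zero _).mpr fun z hz => ?_
    refine eq_zero_of_twistedTrace_mul_eq_zero (F := F) fun x => ?_
    rw [hu', ← mul_assoc, leftTrace_mul_comm, ← mul_assoc]
    have hz' : z * u = 0 := hz
    rw [hz', zero_mul, map_zero]
  obtain ⟨w, hw⟩ := (LinearMap.injective_iff_surjective.mp hinj) 1
  have hw' : w * u = 1 := hw
  refine ⟨u, w, ?_, hw', hu', fun y => ?_⟩
  · refine hinj ?_
    change u * w * u = 1 * u
    rw [mul_assoc, hw', mul_one, one_mul]
  · rw [← sub_eq_zero]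
    refine eq_zero_of_trace_mul_eq_zero (F := F) fun x => ?_
    have h1 := twistedTrace_mul (F := F) x y
    rw [hu', hu'] at h1
    rw [leftTrace_mul_comm, sub_mul, map_sub, sub_eq_zero, mul_assoc, h1, ← mul_assoc,
      leftTrace_mul_comm, mul_assoc]

/-- If the square of the antipode is conjugation by `u`, with inverse `w`, then `Tr(L_{wz}) = Tr(L_z)` for
central `z`: both sides are `Tr(L_z R_w)`, where `R_w = L_w ∘ S²`. -/
theorem leftTrace_inner {u w : H} (huw : u * w = 1) (hwu : w * u = 1)
    (hu : ∀ x, lam x = leftTrace F H (u * x)) (hS : ∀ y, u * y = S (S y) * u) {z : H}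
    (hz : ∀ x, x * z = z * x) : leftTrace F H (w * z) = leftTrace F H z := by
  have h1 : ∀ y, LinearMap.trace F H (LinearMap.mulLeft F y ∘ₗ LinearMap.mulRight F w)
      = leftTrace F H y := by
    intro y
    have h2 : LinearMap.mulLeft F y ∘ₗ LinearMap.mulRight F w
        = LinearMap.mulLeft F (y * w) ∘ₗ S ∘ₗ S := by
      ext h
      have : u * h * w = S (S h) := by rw [hS, mul_assoc, huw, mul_one]
      rw [LinearMap.comp_apply, LinearMap.comp_apply, LinearMap.comp_apply, ← this]
      simp only [LinearMap.mulLeft_apply, LinearMap.mulRight_apply]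
      simp only [← mul_assoc]
      rw [mul_assoc y w u, hwu, mul_one]
    rw [h2, ← twistedTrace_apply, hu, leftTrace_mul_comm, mul_assoc, hwu, mul_one]
  rw [← h1 z, ← trace_mulRight (F := F) (w * z)]
  congr 1
  ext h
  simp only [LinearMap.comp_apply, LinearMap.mulLeft_apply, LinearMap.mulRight_apply]
  rw [← mul_assoc, hz]

/-- The trace of the square of the antipode is nonzero, and the fourth power of the antipode is the
identity. -/
theorem twistedTrace_one_ne_zero_and_antipode_pow_four (F H : Type*) [Field F] [Ring H] [HopfAlgebra F H]
    [FiniteDimensional F H] [CharZero F] [IsSemisimpleRing H] :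
    twistedTrace F H 1 ≠ 0 ∧ ∀ h : H, antipode F (antipode F (antipode F (antipode F h))) = h := by
  obtain ⟨t, h1, h2, h3, h4⟩ := exists_hopf_integral F H
  obtain ⟨u, w, huw, hwu, hu, hS⟩ := exists_antipode_antipode_inner F H
  have hgl := isGroupLike_rightHit_twistedTrace h3 h4
  obtain ⟨N, hN, hgN⟩ := hgl.exists_pow_eq_one
  have hmul := mul_rightHit_twistedTrace h2 h3
  have hone := rightHit_twistedTrace h3 h4 1
  set g := rightHit (twistedTrace F H) t
  have hug : Commute g u := by
    change g * u = u * g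
    rw [hS, hgl.antipode_antipode]
  have hS4 : ∀ h : H, antipode F (antipode F (antipode F (antipode F h))) * (u * u) = u * u * h := by
    intro h
    rw [← mul_assoc, ← hS, mul_assoc, ← hS, mul_assoc]
  -- `g u²` is central, and `g` has finite order `N`, so `u ^ (2 N)` is central.
  have hcent : ∀ h, Commute h (g * (u * u)) := by
    intro h
    change h * (g * (u * u)) = g * (u * u) * h
    rw [← mul_assoc, hmul, mul_assoc, hS4, ← mul_assoc]
  have hpow : (g * (u * u)) ^ N = u ^ (2 * N) := by
    rw [(hug.mul_right hug).mul_pow, hgN, one_mul, pow_mul, pow_two]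
  have hucent : ∀ j h, h * u ^ (2 * N * j) = u ^ (2 * N * j) * h := by
    intro j h
    rw [pow_mul, ← hpow, ← pow_mul]
    exact ((hcent h).pow_right _)
  have hnt : Nontrivial H := ⟨1, 0, fun h => by
    have := congrArg (counit (R := F)) h
    simp at this⟩
  have hunit : IsUnit (LinearMap.mulLeft F u : Module.End F H) :=
    ⟨⟨LinearMap.mulLeft F u, LinearMap.mulLeft F w, by
      rw [Module.End.mul_eq_comp, ← LinearMap.mulLeft_mul, huw, LinearMap.mulLeft_one]; rfl, by
      rw [Module.End.mul_eq_comp, ← LinearMap.mulLeft_mul, hwu, LinearMap.mulLeft_one]; rfl⟩, rfl⟩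
  have htu : twistedTrace F H 1 ≠ 0 := by
    rw [hu, mul_one, leftTrace_apply]
    refine Module.End.trace_ne_zero_of_trace_pow _ hunit (2 * N) (by omega) fun j => ?_
    rw [LinearMap.pow_mulLeft, LinearMap.pow_mulLeft, ← leftTrace_apply, ← leftTrace_apply]
    have h5 := leftTrace_inner huw hwu hu hS (hucent (j + 1))
    have h6 : 2 * N * (j + 1) = (2 * N * j + (2 * N - 1)) + 1 := by
      rw [Nat.mul_add]; omega
    have h7 : 2 * N * (j + 1) = 2 * N * j + 2 * N := by ring
    rw [← h7, ← h5]
    conv_rhs => rw [h6, pow_succ', ← mul_assoc, hwu, one_mul]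
  refine ⟨htu, ?_⟩
  -- At `x = 1` the defining property of `g` reads `λ(1) 1 = λ(1) g`.
  have hg1 : g = 1 := by
    have h5 : rightHit (twistedTrace F H) (1 : H) = twistedTrace F H 1 • 1 := by
      simp [rightHit, one_def]
    rw [h5] at hone
    exact (smul_right_injective H htu hone).symm
  intro h
  have h5 := hmul h
  rwa [hg1, mul_one, one_mul, eq_comm] at h5

end LarsonRadford

/-! ### The antipode is an involution -/

section LarsonRadford

open WithConv Coalgebra HopfAlgebra Algebra.TensorProduct

theorem LinearMap.IsIdempotentElem.trace_eq_natCast {F V : Type*} [Field F] [AddCommGroup V]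
    [Module F V] [FiniteDimensional F V] {e : V →ₗ[F] V} (he : IsIdempotentElem e) :
    LinearMap.trace F V e = (Module.finrank F (LinearMap.range e) : F) :=
  (LinearMap.IsIdempotentElem.isProj_range e he).trace

/-- If the trace of an involution `σ` is nonzero and is `n` times the trace of `P σ` for an
idempotent `P` commuting with `σ`, where `n` is the dimension, then `σ = ± 1`. -/
theorem involution_eq_one_or_neg_one {F V : Type*} [Field F] [CharZero F] [AddCommGroup V]
    [Module F V] [FiniteDimensional F V] {σ P : V →ₗ[F] V} (hσ : σ * σ = 1)
    (hP : IsIdempotentElem P) (hc : Commute P σ) (h0 : LinearMap.trace F V σ ≠ 0)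
    (ht : LinearMap.trace F V σ = (Module.finrank F V : F) * LinearMap.trace F V (P * σ)) :
    σ = 1 ∨ σ = -1 := by
  -- The projection onto the `1`-eigenspace of `σ`, of rank `a`. All traces are integers, and the
  -- equation of traces says that `n` divides `2 a - n`, which lies between `-n` and `n`.
  let E : Module.End F V := (2⁻¹ : F) • (1 + σ)
  have h2 : (2 : F) ≠ 0 := two_ne_zero
  have hE2 : σ = (2 : F) • E - 1 := by
    simp only [E, smul_smul, mul_inv_cancel₀ h2, one_smul]
    abel
  have hE : IsIdempotentElem E := by
    change E * E = E
    simp only [E, smul_mul_smul_comm, mul_add, add_mul, hσ, one_mul, mul_one]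
    rw [add_comm σ 1, ← two_smul F, smul_smul]
    congr 1
    field_simp
  have hcE : Commute P E := ((Commute.one_right P).add_right hc).smul_right _
  have hPE : IsIdempotentElem (P * E) := hP.mul_of_commute hcE hE
  have t1 : LinearMap.trace F V (1 : Module.End F V) = Module.finrank F V := LinearMap.trace_one F V
  have tE := LinearMap.IsIdempotentElem.trace_eq_natCast hE
  have tP := LinearMap.IsIdempotentElem.trace_eq_natCast hP
  have tPE := LinearMap.IsIdempotentElem.trace_eq_natCast hPE
  have hle : Module.finrank F (LinearMap.range E) ≤ Module.finrank F V := Submodule.finrank_le _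
  set a := Module.finrank F (LinearMap.range E) with ha
  set n := Module.finrank F V with hn
  set k := Module.finrank F (LinearMap.range (P * E))
  set l := Module.finrank F (LinearMap.range P)
  have tσ : LinearMap.trace F V σ = 2 * a - n := by
    rw [hE2, map_sub, map_smul, t1, tE, smul_eq_mul]
  have tPσ : LinearMap.trace F V (P * σ) = 2 * k - l := by
    rw [hE2, mul_sub, mul_one, mul_smul_comm, map_sub, map_smul, tP, tPE, smul_eq_mul]
  rw [tσ] at h0
  rw [tσ, tPσ] at ht
  have ht' : (2 * a - n : ℤ) = n * (2 * k - l) := by exact_mod_cast ht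
  have h0' : (2 * a - n : ℤ) ≠ 0 := by exact_mod_cast h0
  have hdvd : (n : ℤ) ∣ 2 * a - n := ⟨_, ht'⟩
  have habs : (n : ℤ) ≤ |2 * (a : ℤ) - n| := Int.le_of_dvd (abs_pos.mpr h0') ((dvd_abs _ _).mpr hdvd)
  have hcase : a = n ∨ a = 0 := by
    rcases abs_cases (2 * (a : ℤ) - n) with h | h <;> omega
  rcases hcase with h | h
  · left
    have hr : LinearMap.range E = ⊤ := Submodule.eq_top_of_finrank_eq h
    have hE1 : E = 1 := by
      ext v
      obtain ⟨w, rfl⟩ := LinearMap.range_eq_top.mp hr v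
      exact congrArg (fun f => f w) hE
    rw [hE2, hE1, two_smul]
    abel
  · right
    have hr : LinearMap.range E = ⊥ := Submodule.finrank_eq_zero.mp h
    rw [hE2, LinearMap.range_eq_bot.mp hr, smul_zero, zero_sub]

section Character

variable {F C : Type*} [Field F] [AddCommGroup C] [Module F C] [Coalgebra F C]

theorem leftHit_add (f g : Module.Dual F C) : leftHit (f + g) = leftHit f + leftHit g := by
  ext x
  simp [leftHit, LinearMap.lTensor_add]

theorem leftHit_smul (c : F) (f : Module.Dual F C) : leftHit (c • f) = c • leftHit f := by
  ext x
  simp [leftHit, LinearMap.lTensor_smul]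

/-- The character of the regular representation of the dual, as an element of `C`. -/
theorem exists_regular_character (F C : Type*) [Field F] [AddCommGroup C] [Module F C]
    [Coalgebra F C] [FiniteDimensional F C] :
    ∃ x : C, ∀ f : Module.Dual F C, f x = LinearMap.trace F C (leftHit f) := by
  let θ : Module.Dual F (Module.Dual F C) :=
    { toFun := fun f => LinearMap.trace F C (leftHit f)
      map_add' := fun f g => by rw [leftHit_add, map_add]
      map_smul' := fun c f => by rw [leftHit_smul, map_smul]; rfl }
  refine ⟨(Module.evalEquiv F C).symm θ, fun f => ?_⟩
  exact Module.apply_evalEquiv_symm_apply F C f θ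

end Character

variable {F H : Type*} [Field F] [Ring H] [HopfAlgebra F H]

local notation "S" => antipode F (A := H)
local notation "Δ" => comul (R := F) (A := H)
local notation "ε" => counit (R := F) (A := H)
local notation "lam" => twistedTrace F H

/-- The map `m ⊗ h ↦ m₁ ⊗ T(m₂) h`. -/
def galoisMap (T : WithConv (H →ₗ[F] H)) : H ⊗[F] H →ₗ[F] H ⊗[F] H :=
  (LinearMap.mul' F H ∘ₗ T.ofConv.rTensor H).lTensor H ∘ₗ (TensorProduct.assoc F H H H).toLinearMap
    ∘ₗ (Δ).rTensor H

theorem galoisMap_tmul (T : WithConv (H →ₗ[F] H)) {ι : Type*} {m : H} (r : Coalgebra.Repr F m ι) (h : H) :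
    galoisMap T (m ⊗ₜ h) = ∑ i ∈ r.index, r.left i ⊗ₜ (T (r.right i) * h) := by
  simp [galoisMap, ← r.eq, sum_tmul]

theorem galoisMap_comp (T U : WithConv (H →ₗ[F] H)) (z : H ⊗[F] H) :
    galoisMap T (galoisMap U z) = galoisMap (T * U) z := by
  induction z with
  | zero => simp
  | add x y hx hy => simp only [map_add, hx, hy]
  | tmul m h =>
    let K : H ⊗[F] (H ⊗[F] H) →ₗ[F] H ⊗[F] H :=
      (LinearMap.mulRight F h ∘ₗ LinearMap.mul' F H ∘ₗ TensorProduct.map T.ofConv U.ofConv).lTensor H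
    have h1 : galoisMap T (galoisMap U (m ⊗ₜ h)) = K (TensorProduct.assoc F H H H ((Δ).rTensor H (Δ m))) := by
      rw [galoisMap_tmul _ (ℛ F m), map_sum]
      conv_rhs => rw [← (ℛ F m).eq]
      rw [map_sum, map_sum, map_sum]
      refine Finset.sum_congr rfl fun i _ => ?_
      rw [galoisMap_tmul _ (ℛ F _), LinearMap.rTensor_tmul]
      conv_rhs => rw [← (ℛ F _).eq]
      simp [sum_tmul, K, mul_assoc]
    rw [h1, Coalgebra.coassoc_apply, galoisMap_tmul _ (ℛ F m)]
    conv_lhs => rw [← (ℛ F m).eq]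
    simp only [map_sum, LinearMap.lTensor_tmul, K]
    rfl

theorem galoisMap_one (z : H ⊗[F] H) : galoisMap (F := F) (1 : WithConv (H →ₗ[F] H)) z = z := by
  induction z with
  | zero => simp
  | add x y hx hy => simp only [map_add, hx, hy]
  | tmul m h =>
    rw [galoisMap_tmul _ (ℛ F m)]
    conv_rhs => rw [← sum_smul_counit (ℛ F m)]
    simp only [LinearMap.convOne_apply, ← Algebra.smul_def, tmul_smul, sum_tmul, smul_tmul']

/-- The map `m ⊗ h ↦ m₁ ⊗ m₂ h` as a linear automorphism. -/
def galoisEquiv (F H : Type*) [Field F] [Ring H] [HopfAlgebra F H] : (H ⊗[F] H) ≃ₗ[F] (H ⊗[F] H) :=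
  LinearEquiv.ofLinearMap (galoisMap (toConv LinearMap.id)) (galoisMap (toConv (antipode F)))
    (by ext1; ext; simp [galoisMap_comp, galoisMap_one])
    (by ext1; ext; simp [galoisMap_comp, galoisMap_one])

/-- The regular representation of the dual absorbs tensor products. -/
theorem leftHit_mul_galois (f : Module.Dual F H) (z : H ⊗[F] H) :
    (leftHit f).lTensor H (galoisEquiv F H z)
      = galoisEquiv F H (leftHit (f ∘ₗ LinearMap.mul' F H) z) := by
  change (leftHit f).lTensor H (galoisMap (toConv LinearMap.id) z)
      = galoisMap (toConv LinearMap.id) (leftHit (f ∘ₗ LinearMap.mul' F H) z)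
  induction z with
  | zero => simp
  | add x y hx hy => simp only [map_add, hx, hy]
  | tmul m h =>
    let s := ℛ F h
    let K : H ⊗[F] (H ⊗[F] H) →ₗ[F] H ⊗[F] H :=
      ((TensorProduct.rid F H).toLinearMap ∘ₗ f.lTensor H ∘ₗ LinearMap.mulRight F (Δ h)).lTensor H
    have h1 : (leftHit f).lTensor H (galoisMap (toConv LinearMap.id) (m ⊗ₜ h))
        = K ((Δ).lTensor H (Δ m)) := by
      rw [galoisMap_tmul _ (ℛ F m), map_sum]
      conv_rhs => rw [← (ℛ F m).eq]
      rw [map_sum, map_sum]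
      refine Finset.sum_congr rfl fun i _ => ?_
      simp [K, leftHit]
    have h2 : ∀ z : H ⊗[F] H, galoisMap (toConv LinearMap.id) (TensorProduct.rid F (H ⊗[F] H)
        ((f ∘ₗ LinearMap.mul' F H).lTensor (H ⊗[F] H)
        (TensorProduct.tensorTensorTensorComm F H H H H (z ⊗ₜ Δ h))))
        = K (TensorProduct.assoc F H H H ((Δ).rTensor H z)) := by
      intro z
      induction z with
      | zero => simp
      | add x y hx hy => simp only [map_add, add_tmul, hx, hy]
      | tmul a b =>
        rw [← s.eq, tmul_sum, LinearMap.rTensor_tmul]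
        conv_rhs => rw [← (ℛ F a).eq]
        simp only [map_sum, tensorTensorTensorComm_tmul, LinearMap.lTensor_tmul,
          TensorProduct.rid_tmul, LinearMap.comp_apply, LinearMap.mul'_apply, map_smul,
          galoisMap_tmul _ (ℛ F a), sum_tmul, TensorProduct.assoc_tmul, K, LinearEquiv.coe_coe,
          LinearMap.mulRight_apply, ← s.eq, Finset.mul_sum, tmul_mul_tmul, tmul_sum, tmul_smul,
          Finset.smul_sum]
        rw [Finset.sum_comm]
        rfl
    rw [h1, ← Coalgebra.coassoc_apply, ← h2]
    rfl

variable [FiniteDimensional F H]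

/-- The regular character of a tensor product of coalgebras is the tensor product of the regular
characters. -/
theorem trace_leftHit_tensor {x : H} (hx : ∀ f : Module.Dual F H, f x = LinearMap.trace F H (leftHit f))
    (B : Module.Dual F (H ⊗[F] H)) : LinearMap.trace F (H ⊗[F] H) (leftHit B) = B (x ⊗ₜ x) := by
  obtain ⟨t, rfl⟩ := (TensorProduct.dualDistribEquiv F H H).surjective B
  induction t with
  | zero =>
    rw [map_zero]
    simp [leftHit]
  | add a b ha hb => rw [map_add, leftHit_add, map_add, ha, hb]; rfl
  | tmul f g =>
    have h1 : leftHit (TensorProduct.dualDistribEquiv F H H (f ⊗ₜ g))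
        = TensorProduct.map (leftHit f) (leftHit g) := by
      ext a b
      simp only [leftHit, AlgebraTensorModule.curry_apply, curry_apply, LinearMap.coe_restrictScalars,
        LinearMap.comp_apply, TensorProduct.comul_tmul, LinearEquiv.coe_coe, TensorProduct.map_tmul]
      rw [← (ℛ F a).eq, ← (ℛ F b).eq]
      simp only [sum_tmul, tmul_sum, map_sum]
      refine Finset.sum_congr rfl fun i _ => Finset.sum_congr rfl fun j _ => ?_
      simp [TensorProduct.dualDistribEquiv, smul_tmul', smul_smul, mul_comm]
    rw [h1, LinearMap.trace_tensorProduct', ← hx, ← hx]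
    simp [TensorProduct.dualDistribEquiv]

/-- The tensor product of the regular representation with itself is a multiple of the regular
representation, so the regular character `x` satisfies `x² = n x`. -/
theorem regular_character_mul_self {x : H}
    (hx : ∀ f : Module.Dual F H, f x = LinearMap.trace F H (leftHit f)) :
    x * x = (Module.finrank F H : F) • x := by
  rw [← sub_eq_zero]
  refine (Module.forall_dual_apply_eq_zero_iff F _).mp fun f => ?_
  rw [map_sub, sub_eq_zero, map_smul]
  have h1 := trace_leftHit_tensor hx (f ∘ₗ LinearMap.mul' F H)
  have h2 : (galoisEquiv F H).conj (leftHit (f ∘ₗ LinearMap.mul' F H)) = (leftHit f).lTensor H := by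
    apply LinearMap.ext
    intro z
    obtain ⟨z, rfl⟩ := (galoisEquiv F H).surjective z
    rw [leftHit_mul_galois, LinearEquiv.conj_apply_apply, LinearEquiv.symm_apply_apply]
  rw [← LinearMap.trace_conj' _ (galoisEquiv F H), h2, LinearMap.lTensor,
    LinearMap.trace_tensorProduct', LinearMap.trace_id, ← hx] at h1
  exact h1.symm

variable [CharZero F] [IsSemisimpleRing H]

/-- **Larson–Radford**: the antipode of a finite-dimensional semisimple Hopf algebra over a field
of characteristic zero is an involution. -/
theorem antipode_antipode_of_isSemisimpleRing (x : H) : S (S x) = x := by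
  obtain ⟨hl1, hS4⟩ := twistedTrace_one_ne_zero_and_antipode_pow_four F H
  obtain ⟨x₀, hx⟩ := exists_regular_character F H
  have hx2 := regular_character_mul_self hx
  have hnt : Nontrivial H := ⟨1, 0, fun h => by
    have := congrArg (counit (R := F)) h
    simp at this⟩
  set n := Module.finrank F H
  have hn : (n : F) ≠ 0 := by exact_mod_cast (Module.finrank_pos (R := F) (M := H)).ne'
  let σ : Module.End F H := S ∘ₗ S
  have hσ : σ * σ = 1 := by ext h; exact hS4 h
  have hσΔ : ∀ h, Δ (σ h) = TensorProduct.map σ σ (Δ h) := by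
    intro h
    change Δ (S (S h)) = _
    rw [comul_antipode, comul_antipode]
    rw [← (ℛ F h).eq]
    simp [σ]
  -- The regular character is invariant under automorphisms of the coalgebra.
  have hSx : σ x₀ = x₀ := by
    rw [← sub_eq_zero]
    refine (Module.forall_dual_apply_eq_zero_iff F _).mp fun f => ?_
    rw [map_sub, sub_eq_zero]
    have h1 := hx (f ∘ₗ σ)
    have h2 : σ * leftHit (f ∘ₗ σ) = leftHit f * σ := by
      ext h
      simp only [Module.End.mul_apply]
      rw [leftHit_apply _ (ℛ F h), leftHit, LinearMap.comp_apply, LinearMap.comp_apply, LinearMap.comp_apply, hσΔ]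
      conv_rhs => rw [← (ℛ F h).eq]
      simp
      rfl
    have h3 : leftHit (f ∘ₗ σ) = σ * leftHit f * σ := by
      rw [mul_assoc, ← h2, ← mul_assoc, hσ, one_mul]
    rw [h3, LinearMap.trace_mul_comm, ← mul_assoc, hσ, one_mul, ← hx] at h1
    exact h1
  -- `h ↦ h₁ λ(h₂) = λ(h) 1` has rank one.
  have hlx : lam x₀ = LinearMap.trace F H σ := by
    rw [hx]
    have h1 : leftHit lam = (lam).smulRight (1 : H) := by
      ext h
      exact leftHit_twistedTrace h
    rw [h1, LinearMap.trace_smulRight, twistedTrace_apply, LinearMap.mulLeft_one]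
    rfl
  -- `x₀ / n` is an idempotent.
  let P : Module.End F H := LinearMap.mulLeft F ((n : F)⁻¹ • x₀)
  have hP : IsIdempotentElem P := by
    change P * P = P
    rw [Module.End.mul_eq_comp]
    simp only [P, ← LinearMap.mulLeft_mul]
    rw [smul_mul_smul_comm, hx2, smul_smul, mul_assoc, inv_mul_cancel₀ hn, mul_one]
  have hc : Commute P σ := by
    change P * σ = σ * P
    ext h
    have : S (S x₀) = x₀ := hSx
    simp [P, σ, antipode_mul_antidistrib, this]
  have hPσ : LinearMap.trace F H σ = (n : F) * LinearMap.trace F H (P * σ) := by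
    have h1 : P * σ = (n : F)⁻¹ • (LinearMap.mulLeft F x₀ ∘ₗ S ∘ₗ S) := by
      ext h
      simp [P, σ]
    rw [h1, map_smul, ← twistedTrace_apply, hlx, smul_eq_mul, ← mul_assoc, mul_inv_cancel₀ hn, one_mul]
  have h0 : LinearMap.trace F H σ ≠ 0 := by
    rw [← hlx, hx]
    have h1 : leftHit lam = (lam).smulRight (1 : H) := by
      ext h
      exact leftHit_twistedTrace h
    rwa [h1, LinearMap.trace_smulRight]
  rcases involution_eq_one_or_neg_one hσ hP hc h0 hPσ with h | h
  · exact congrArg (fun f => f x) h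
  · exfalso
    have h1 : S (S (1 : H)) = -1 := congrArg (fun f => f 1) h
    have h2 := congrArg ε h1
    have h3 : (-1 : F) ≠ 1 := fun h => by
      have : (2 : F) = 0 := by linear_combination -h
      exact two_ne_zero this
    simp at h2
    exact h3 h2.symm

end LarsonRadford

/-! ### The dual Hopf algebra -/

/-- Hopf algebras whose antipode is an involution. -/
class InvolutiveAntipode (F H : Type*) [Field F] [Ring H] [HopfAlgebra F H] : Prop where
  antipode_antipode : ∀ x : H, HopfAlgebra.antipode F (HopfAlgebra.antipode F x) = x

namespace DualHopf

open WithConv Coalgebra HopfAlgebra Algebra.TensorProduct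

variable {F H : Type*} [Field F] [Ring H] [HopfAlgebra F H]

local notation "S" => antipode F (A := H)
local notation "H⋆" => Module.Dual F H

/-- The translate `x ↦ α (y x)`. -/
def transL (α : H⋆) (y : H) : H⋆ := α ∘ₗ LinearMap.mulLeft F y

/-- The translate `x ↦ α (x y)`. -/
def transR (α : H⋆) (y : H) : H⋆ := α ∘ₗ LinearMap.mulRight F y

@[simp] theorem transL_apply (α : H⋆) (x y : H) : transL α y x = α (y * x) := rfl
@[simp] theorem transR_apply (α : H⋆) (x y : H) : transR α y x = α (x * y) := rfl

/-- Evaluation of a linear map on the coproduct of a product. -/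
theorem repr_mul_sum {M : Type*} [AddCommMonoid M] [Module F M] (f : H ⊗[F] H →ₗ[F] M) {ι κ : Type*}
    {x y : H} (r : Coalgebra.Repr F x ι) (s : Coalgebra.Repr F y κ) :
    f (comul (x * y)) = ∑ i ∈ r.index, ∑ j ∈ s.index,
      f ((r.left i * s.left j) ⊗ₜ (r.right i * s.right j)) := by
  rw [Bialgebra.comul_mul, ← r.eq, ← s.eq, Finset.sum_mul_sum, map_sum]
  simp only [map_sum, Algebra.TensorProduct.tmul_mul_tmul]

section

variable [InvolutiveAntipode F H]

theorem antipode_antipode (x : H) : S (S x) = x := InvolutiveAntipode.antipode_antipode x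

theorem sum_right_mul_antipode_left {ι : Type*} {x : H} (r : Coalgebra.Repr F x ι) :
    ∑ i ∈ r.index, r.right i * S (r.left i) = counit (R := F) x • (1 : H) := by
  have h := congrArg S (sum_mul_antipode_eq_smul r)
  simpa [antipode_mul_antidistrib, antipode_antipode] using h

theorem sum_antipode_right_mul_left {ι : Type*} {x : H} (r : Coalgebra.Repr F x ι) :
    ∑ i ∈ r.index, S (r.right i) * r.left i = counit (R := F) x • (1 : H) := by
  have h := congrArg S (sum_antipode_mul_eq_smul r)
  simpa [antipode_mul_antidistrib, antipode_antipode] using h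

end

variable [FiniteDimensional F H]

/-- The pairing of `H⋆ ⊗ H⋆` with `H ⊗ H`, as an isomorphism onto the dual; it is used to check
identities in `H⋆ ⊗ H⋆`. -/
def pairing (F H : Type*) [Field F] [Ring H] [HopfAlgebra F H] [FiniteDimensional F H] :
    Module.Dual F H ⊗[F] Module.Dual F H ≃ₗ[F] Module.Dual F (H ⊗[F] H) :=
  TensorProduct.dualDistribEquiv F H H

theorem pairing_tmul (α β : H⋆) (x y : H) : pairing F H (α ⊗ₜ β) (x ⊗ₜ y) = α x * β y := by
  simp [pairing, TensorProduct.dualDistribEquiv]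

theorem pairing_ext {t u : H⋆ ⊗[F] H⋆}
    (h : ∀ x y : H, pairing F H t (x ⊗ₜ y) = pairing F H u (x ⊗ₜ y)) : t = u := by
  apply (pairing F H).injective
  ext x y
  exact h x y

theorem pairing_dual_comul (α : H⋆) (x y : H) :
    pairing F H ((HopfMaps.of F H).dual.comul α) (x ⊗ₜ y) = α (x * y) := by
  change pairing F H ((pairing F H).symm _) _ = _
  rw [LinearEquiv.apply_symm_apply]
  simp [HopfMaps.of, AlgMaps.mulT]

/-- The comultiplication of the co-opposite of the dual. -/
def copComul (F H : Type*) [Field F] [Ring H] [HopfAlgebra F H] [FiniteDimensional F H] :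
    Module.Dual F H →ₗ[F] Module.Dual F H ⊗[F] Module.Dual F H :=
  (TensorProduct.comm F _ _).toLinearMap ∘ₗ (HopfMaps.of F H).dual.comul

theorem pairing_comm (t : H⋆ ⊗[F] H⋆) (x y : H) :
    pairing F H (TensorProduct.comm F _ _ t) (x ⊗ₜ y) = pairing F H t (y ⊗ₜ x) := by
  induction t with
  | zero => simp
  | add a b ha hb => simp only [map_add, LinearMap.add_apply, ha, hb]
  | tmul a b => simp only [TensorProduct.comm_tmul, pairing_tmul, mul_comm]

theorem pairing_copComul (α : H⋆) (x y : H) :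
    pairing F H (copComul F H α) (x ⊗ₜ y) = α (y * x) := by
  rw [copComul, LinearMap.comp_apply, LinearEquiv.coe_coe, pairing_comm, pairing_dual_comul]

theorem pairing_eq_lid (t : H⋆ ⊗[F] H⋆) (x y : H) :
    pairing F H t (x ⊗ₜ y) = TensorProduct.lid F H⋆ ((Module.Dual.eval F H x).rTensor H⋆ t) y := by
  induction t with
  | zero => simp
  | add a b ha hb => simp only [map_add, LinearMap.add_apply, ha, hb]
  | tmul a b => simp [pairing_tmul]

theorem pairing_eq_rid (t : H⋆ ⊗[F] H⋆) (x y : H) :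
    pairing F H t (x ⊗ₜ y) = TensorProduct.rid F H⋆ ((Module.Dual.eval F H y).lTensor H⋆ t) x := by
  induction t with
  | zero => simp
  | add a b ha hb => simp only [map_add, LinearMap.add_apply, ha, hb]
  | tmul a b => simp [pairing_tmul, mul_comm]

theorem eval_rTensor_copComul (α : H⋆) (x : H) :
    TensorProduct.lid F H⋆ ((Module.Dual.eval F H x).rTensor H⋆ (copComul F H α)) = transR α x := by
  ext y
  rw [← pairing_eq_lid, pairing_copComul, transR_apply]

theorem eval_lTensor_copComul (α : H⋆) (x : H) :
    TensorProduct.rid F H⋆ ((Module.Dual.eval F H x).lTensor H⋆ (copComul F H α)) = transL α x := by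
  ext y
  rw [← pairing_eq_rid, pairing_copComul, transL_apply]

/-- The pairing of `H⋆ ⊗ (H⋆ ⊗ H⋆)` with `H ⊗ (H ⊗ H)`. -/
def pairing₃ (F H : Type*) [Field F] [Ring H] [HopfAlgebra F H] [FiniteDimensional F H] :
    Module.Dual F H ⊗[F] (Module.Dual F H ⊗[F] Module.Dual F H)
      ≃ₗ[F] Module.Dual F (H ⊗[F] (H ⊗[F] H)) :=
  TensorProduct.congr (LinearEquiv.refl F _) (pairing F H)
    ≪≫ₗ TensorProduct.dualDistribEquiv F H (H ⊗[F] H)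

theorem pairing₃_tmul (α : H⋆) (t : H⋆ ⊗[F] H⋆) (x y z : H) :
    pairing₃ F H (α ⊗ₜ t) (x ⊗ₜ (y ⊗ₜ z)) = α x * pairing F H t (y ⊗ₜ z) := by
  simp [pairing₃, TensorProduct.dualDistribEquiv]

theorem pairing₃_assoc (t : H⋆ ⊗[F] H⋆) (γ : H⋆) (x y z : H) :
    pairing₃ F H (TensorProduct.assoc F _ _ _ (t ⊗ₜ γ)) (x ⊗ₜ (y ⊗ₜ z))
      = pairing F H t (x ⊗ₜ y) * γ z := by
  induction t with
  | zero => simp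
  | add a b ha hb => simp only [map_add, add_tmul, LinearMap.add_apply, ha, hb, add_mul]
  | tmul a b => simp only [TensorProduct.assoc_tmul, pairing₃_tmul, pairing_tmul, mul_assoc]

theorem copComul_coassoc : (TensorProduct.assoc F H⋆ H⋆ H⋆).toLinearMap
    ∘ₗ (copComul F H).rTensor H⋆ ∘ₗ copComul F H = (copComul F H).lTensor H⋆ ∘ₗ copComul F H := by
  ext1 α
  apply (pairing₃ F H).injective
  ext x y z
  have h1 : ∀ t : H⋆ ⊗[F] H⋆, pairing₃ F H (TensorProduct.assoc F H⋆ H⋆ H⋆ ((copComul F H).rTensor H⋆ t))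
      (x ⊗ₜ (y ⊗ₜ z)) = pairing F H t ((y * x) ⊗ₜ z) := by
    intro t
    induction t with
    | zero => simp
    | add a b ha hb => simp only [map_add, LinearMap.add_apply, ha, hb]
    | tmul a b => rw [LinearMap.rTensor_tmul, pairing₃_assoc, pairing_copComul, pairing_tmul]
  have h2 : ∀ t : H⋆ ⊗[F] H⋆, pairing₃ F H ((copComul F H).lTensor H⋆ t)
      (x ⊗ₜ (y ⊗ₜ z)) = pairing F H t (x ⊗ₜ (z * y)) := by
    intro t
    induction t with
    | zero => simp
    | add a b ha hb => simp only [map_add, LinearMap.add_apply, ha, hb]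
    | tmul a b => rw [LinearMap.lTensor_tmul, pairing₃_tmul, pairing_copComul, pairing_tmul]
  refine (h1 _).trans (Eq.trans ?_ (h2 _).symm)
  rw [pairing_copComul, pairing_copComul, mul_assoc]

theorem of_dual_mul (α β : H⋆) :
    (HopfMaps.of F H).dual.mul α β = (toConv α * toConv β).ofConv := by
  ext x
  have : ∀ z : H ⊗[F] H, TensorProduct.dualDistrib F H H (α ⊗ₜ β) z
      = LinearMap.mul' F F (TensorProduct.map α β z) := by
    intro z
    induction z with
    | zero => simp
    | add x y hx hy => simp only [map_add, hx, hy]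
    | tmul a b => simp
  exact this (comul x)

/-- The convolution product on the dual. -/
scoped instance instRing : Ring H⋆ :=
  { (inferInstance : AddCommGroup H⋆) with
    mul := fun α β => (HopfMaps.of F H).dual.mul α β
    one := counit
    left_distrib := fun a b c => map_add _ _ _
    right_distrib := fun a b c => LinearMap.map_add₂ _ _ _ _
    zero_mul := fun a => LinearMap.map_zero₂ _ _
    mul_zero := fun a => map_zero _
    mul_assoc := fun a b c => by
      change (HopfMaps.of F H).dual.mul ((HopfMaps.of F H).dual.mul a b) c
        = (HopfMaps.of F H).dual.mul a ((HopfMaps.of F H).dual.mul b c)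
      simp only [of_dual_mul, toConv_ofConv, mul_assoc]
    one_mul := fun a => by
      change (HopfMaps.of F H).dual.mul counit a = a
      rw [of_dual_mul]
      exact congrArg ofConv (one_mul (toConv a))
    mul_one := fun a => by
      change (HopfMaps.of F H).dual.mul a counit = a
      rw [of_dual_mul]
      exact congrArg ofConv (mul_one (toConv a)) }

theorem dual_mul (α β : H⋆) : (HopfMaps.of F H).dual.mul α β = α * β := rfl

theorem one_apply (x : H) : (1 : H⋆) x = counit x := rfl

theorem mul_apply {ι : Type*} (α β : H⋆) {x : H} (r : Coalgebra.Repr F x ι) :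
    (α * β) x = ∑ i ∈ r.index, α (r.left i) * β (r.right i) := by
  rw [← dual_mul, of_dual_mul]
  exact r.convMul_apply _ _

scoped instance instAlgebra : Algebra F H⋆ :=
  Algebra.ofModule (fun _ _ _ => LinearMap.map_smul₂ _ _ _ _) (fun _ _ _ => map_smul _ _ _)

/-- The dual carries the *co-opposite* of the comultiplication dual to the product of `H`, because
this is the one for which `H⋆ ⊗ H` with the tensor product comultiplication is the coalgebra of the
Drinfeld double. -/
scoped instance instCoalgebra : Coalgebra F H⋆ where
  comul := copComul F H
  counit := Module.Dual.eval F H 1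
  coassoc := copComul_coassoc
  rTensor_counit_comp_comul := by
    ext1 α
    apply (TensorProduct.lid F H⋆).injective
    refine (eval_rTensor_copComul α 1).trans ?_
    ext x
    simp
  lTensor_counit_comp_comul := by
    ext1 α
    apply (TensorProduct.rid F H⋆).injective
    refine (eval_lTensor_copComul α 1).trans ?_
    ext x
    simp

theorem counit_apply (α : H⋆) : counit (R := F) α = α 1 := rfl

theorem comul_def' : (comul : H⋆ →ₗ[F] H⋆ ⊗[F] H⋆)
    = (TensorProduct.comm F _ _).toLinearMap ∘ₗ (HopfMaps.of F H).dual.comul := rfl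

theorem pairing_comul (α : H⋆) (x y : H) :
    pairing F H (comul α) (x ⊗ₜ y) = α (y * x) := pairing_copComul α x y

theorem pairing_mul (t u : H⋆ ⊗[F] H⋆) {ι κ : Type*} {x y : H} (r : Coalgebra.Repr F x ι)
    (s : Coalgebra.Repr F y κ) : pairing F H (t * u) (x ⊗ₜ y)
      = ∑ i ∈ r.index, ∑ j ∈ s.index, pairing F H t (r.left i ⊗ₜ s.left j)
        * pairing F H u (r.right i ⊗ₜ s.right j) := by
  induction t with
  | zero => simp
  | add a b ha hb => simp only [map_add, LinearMap.add_apply, ha, hb, add_mul, Finset.sum_add_distrib]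
  | tmul a b =>
    induction u with
    | zero => simp
    | add a b ha hb => simp only [map_add, LinearMap.add_apply, ha, hb, mul_add, Finset.sum_add_distrib]
    | tmul c d =>
      rw [Algebra.TensorProduct.tmul_mul_tmul, pairing_tmul, mul_apply _ _ r, mul_apply _ _ s,
        Finset.sum_mul_sum]
      refine Finset.sum_congr rfl fun i _ => Finset.sum_congr rfl fun j _ => ?_
      rw [pairing_tmul, pairing_tmul]
      ring

scoped instance instBialgebra : Bialgebra F H⋆ :=
  Bialgebra.mk' F H⋆ (by rw [counit_apply, one_apply, Bialgebra.counit_one])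
    (by
      intro α β
      have h : (α * β) 1 = α 1 * β 1 := by
        let r : Coalgebra.Repr F (1 : H) Unit :=
          { index := {()}, left := fun _ => 1, right := fun _ => 1
            eq := by rw [Bialgebra.comul_one]; simp [Algebra.TensorProduct.one_def] }
        rw [mul_apply _ _ r]
        simp [r]
      exact h)
    (by
      apply pairing_ext
      intro x y
      rw [pairing_comul, Algebra.TensorProduct.one_def, pairing_tmul, one_apply, one_apply,
        one_apply, Bialgebra.counit_mul, mul_comm])
    (by
      intro α β
      apply pairing_ext
      intro x y
      rw [pairing_comul, pairing_mul _ _ (ℛ F x) (ℛ F y)]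
      have h := repr_mul_sum (LinearMap.mul' F F ∘ₗ TensorProduct.map α β) (ℛ F y) (ℛ F x)
      have h2 : (α * β) (y * x) = (LinearMap.mul' F F ∘ₗ TensorProduct.map α β) (comul (y * x)) := by
        rw [mul_apply _ _ (ℛ F (y * x))]
        conv_rhs => rw [← (ℛ F (y * x)).eq]
        simp
      rw [h2, h, Finset.sum_comm]
      simp [pairing_comul])

theorem mul'_apply_eq (t : H⋆ ⊗[F] H⋆) {ι : Type*} {x : H} (r : Coalgebra.Repr F x ι) :
    LinearMap.mul' F H⋆ t x = ∑ i ∈ r.index, pairing F H t (r.left i ⊗ₜ r.right i) := by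
  induction t with
  | zero => simp
  | add a b ha hb => simp only [map_add, LinearMap.add_apply, ha, hb, Finset.sum_add_distrib]
  | tmul a b =>
    rw [LinearMap.mul'_apply, mul_apply _ _ r]
    simp only [pairing_tmul]

theorem pairing_map (f g : H →ₗ[F] H) (t : H⋆ ⊗[F] H⋆) (x y : H) :
    pairing F H (TensorProduct.map f.dualMap g.dualMap t) (x ⊗ₜ y) = pairing F H t (f x ⊗ₜ g y) := by
  induction t with
  | zero => simp
  | add a b ha hb => simp only [map_add, LinearMap.add_apply, ha, hb]
  | tmul a b => simp [pairing_tmul]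

variable [InvolutiveAntipode F H]

/-- The antipode of the co-opposite of the dual is the inverse of the transposed antipode, which is
the transposed antipode since that is an involution. -/
scoped instance instHopfAlgebra : HopfAlgebra F H⋆ where
  antipode := (antipode F (A := H)).dualMap
  mul_antipode_rTensor_comul := by
    ext α x
    change LinearMap.mul' F H⋆ (TensorProduct.map (antipode F (A := H)).dualMap
      (LinearMap.id (M := H)).dualMap (comul α)) x = _
    rw [mul'_apply_eq _ (ℛ F x)]
    simp only [pairing_map, pairing_comul, LinearMap.id_apply]
    rw [← map_sum, sum_right_mul_antipode_left, map_smul]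
    simp [counit_apply, Algebra.algebraMap_eq_smul_one, one_apply, mul_comm]
  mul_antipode_lTensor_comul := by
    ext α x
    change LinearMap.mul' F H⋆ (TensorProduct.map (LinearMap.id (M := H)).dualMap
      (antipode F (A := H)).dualMap (comul α)) x = _
    rw [mul'_apply_eq _ (ℛ F x)]
    simp only [pairing_map, pairing_comul, LinearMap.id_apply]
    rw [← map_sum, sum_antipode_right_mul_left, map_smul]
    simp [counit_apply, Algebra.algebraMap_eq_smul_one, one_apply, mul_comm]

theorem dual_antipode_apply (α : H⋆) (x : H) : antipode F α x = α (S x) := rfl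

instance : InvolutiveAntipode F H⋆ where
  antipode_antipode α := by
    ext x
    rw [dual_antipode_apply, dual_antipode_apply, antipode_antipode]

theorem antipodeInv_dual : (HopfMaps.of F H).dual.antipodeInv = antipode F (A := H⋆) := by
  have h : (HopfMaps.of F H).dual.antipode * (HopfMaps.of F H).dual.antipode
      = (1 : Module.End F H⋆) := by
    ext α x
    exact congrArg α (antipode_antipode x)
  exact Ring.inverse_unit ⟨_, _, h, h⟩

theorem antipodeInv_of : (HopfMaps.of F H).antipodeInv = antipode F (A := H) := by
  have h : (HopfMaps.of F H).antipode * (HopfMaps.of F H).antipode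
      = (1 : Module.End F H) := by
    ext x
    exact antipode_antipode x
  exact Ring.inverse_unit ⟨_, _, h, h⟩

end DualHopf

instance {F H : Type*} [Field F] [CharZero F] [Ring H] [HopfAlgebra F H] [FiniteDimensional F H]
    [IsSemisimpleRing H] : InvolutiveAntipode F H :=
  ⟨antipode_antipode_of_isSemisimpleRing⟩

/-! ### Convolution on a tensor product of coalgebras -/

section TensorConv

open WithConv Coalgebra HopfAlgebra

variable {F C D R : Type*} [Field F] [AddCommGroup C] [Module F C] [Coalgebra F C]
  [AddCommGroup D] [Module F D] [Coalgebra F D] [Ring R] [Algebra F R]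

theorem conv_tmul (X Y : WithConv (C ⊗[F] D →ₗ[F] R)) {a : C} {b : D} {ι κ : Type*}
    (r : Coalgebra.Repr F a ι) (s : Coalgebra.Repr F b κ) :
    (X * Y) (a ⊗ₜ b) = ∑ i ∈ r.index, ∑ j ∈ s.index,
      X (r.left i ⊗ₜ s.left j) * Y (r.right i ⊗ₜ s.right j) := by
  rw [LinearMap.convMul_apply, TensorProduct.comul_tmul, ← r.eq, ← s.eq]
  simp only [sum_tmul, tmul_sum, map_sum]
  rw [Finset.sum_comm]
  rfl

theorem sum_counit_smul_right {ι : Type*} {c : C} (r : Coalgebra.Repr F c ι) :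
    ∑ i ∈ r.index, counit (R := F) (r.left i) • r.right i = c :=
  Coalgebra.sum_counit_smul r

/-- A linear map on the first factor, extended by the counit of the second. -/
def liftL (D : Type*) [AddCommGroup D] [Module F D] [Coalgebra F D] (X : WithConv (C →ₗ[F] R)) :
    WithConv (C ⊗[F] D →ₗ[F] R) :=
  toConv (X.ofConv ∘ₗ (TensorProduct.rid F C).toLinearMap ∘ₗ counit.lTensor C)

/-- A linear map on the second factor, extended by the counit of the first. -/
def liftR (C : Type*) [AddCommGroup C] [Module F C] [Coalgebra F C] (Y : WithConv (D →ₗ[F] R)) :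
    WithConv (C ⊗[F] D →ₗ[F] R) :=
  toConv (Y.ofConv ∘ₗ (TensorProduct.lid F D).toLinearMap ∘ₗ counit.rTensor D)

theorem liftL_tmul (X : WithConv (C →ₗ[F] R)) (a : C) (b : D) :
    liftL D X (a ⊗ₜ b) = counit (R := F) b • X a := by
  simp [liftL]

theorem liftR_tmul (Y : WithConv (D →ₗ[F] R)) (a : C) (b : D) :
    liftR C Y (a ⊗ₜ b) = counit (R := F) a • Y b := by
  simp [liftR]

theorem sum_counit_mul_counit {ι : Type*} {c : C} (r : Coalgebra.Repr F c ι) :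
    ∑ i ∈ r.index, counit (R := F) (r.left i) * counit (R := F) (r.right i) = counit (R := F) c := by
  conv_rhs => rw [← sum_counit_smul_right r]
  simp

theorem conv_ext {X Y : WithConv (C ⊗[F] D →ₗ[F] R)} (h : ∀ a b, X (a ⊗ₜ b) = Y (a ⊗ₜ b)) :
    X = Y := by
  apply WithConv.ext
  ext a b
  exact h a b

theorem liftL_mul (X Y : WithConv (C →ₗ[F] R)) : liftL D (X * Y) = liftL D X * liftL D Y := by
  refine conv_ext fun a b => ?_
  rw [conv_tmul _ _ (ℛ F a) (ℛ F b), liftL_tmul, (ℛ F a).convMul_apply,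
    ← sum_counit_mul_counit (ℛ F b), Finset.sum_smul_sum, Finset.sum_comm]
  simp [liftL_tmul, smul_smul, mul_comm]

theorem liftR_mul (X Y : WithConv (D →ₗ[F] R)) : liftR C (X * Y) = liftR C X * liftR C Y := by
  refine conv_ext fun a b => ?_
  rw [conv_tmul _ _ (ℛ F a) (ℛ F b), liftR_tmul, (ℛ F b).convMul_apply,
    ← sum_counit_mul_counit (ℛ F a), Finset.sum_smul_sum]
  simp [liftR_tmul, smul_smul, mul_comm]

theorem conv_one_tmul (a : C) (b : D) : (1 : WithConv (C ⊗[F] D →ₗ[F] R)) (a ⊗ₜ b)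
    = (counit (R := F) a * counit (R := F) b) • 1 := by
  rw [LinearMap.convOne_apply, Algebra.algebraMap_eq_smul_one, TensorProduct.counit_tmul,
    smul_eq_mul, mul_comm]

theorem liftL_one : liftL D (1 : WithConv (C →ₗ[F] R)) = 1 := by
  refine conv_ext fun a b => ?_
  rw [liftL_tmul, conv_one_tmul, LinearMap.convOne_apply, Algebra.algebraMap_eq_smul_one,
    smul_smul, mul_comm]

theorem liftR_one : liftR C (1 : WithConv (D →ₗ[F] R)) = 1 := by
  refine conv_ext fun a b => ?_
  rw [liftR_tmul, conv_one_tmul, LinearMap.convOne_apply, Algebra.algebraMap_eq_smul_one,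
    smul_smul]

theorem liftL_mul_liftR_tmul (X : WithConv (C →ₗ[F] R)) (Y : WithConv (D →ₗ[F] R)) (a : C) (b : D) :
    (liftL D X * liftR C Y) (a ⊗ₜ b) = X a * Y b := by
  rw [conv_tmul _ _ (ℛ F a) (ℛ F b)]
  conv_rhs => rw [← sum_smul_counit (ℛ F a), ← sum_counit_smul_right (ℛ F b)]
  simp only [liftL_tmul, liftR_tmul, map_sum, map_smul, Finset.sum_mul_sum]
  refine Finset.sum_congr rfl fun i _ => Finset.sum_congr rfl fun j _ => ?_
  rw [smul_mul_smul_comm, smul_mul_smul_comm, mul_comm]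

theorem liftR_mul_liftL_tmul (X : WithConv (C →ₗ[F] R)) (Y : WithConv (D →ₗ[F] R)) (a : C) (b : D) :
    (liftR C Y * liftL D X) (a ⊗ₜ b) = Y b * X a := by
  rw [conv_tmul _ _ (ℛ F a) (ℛ F b), Finset.sum_comm]
  conv_rhs => rw [← sum_counit_smul_right (ℛ F a), ← sum_smul_counit (ℛ F b)]
  simp only [liftL_tmul, liftR_tmul, map_sum, map_smul, Finset.sum_mul_sum]
  refine Finset.sum_congr rfl fun i _ => Finset.sum_congr rfl fun j _ => ?_
  rw [smul_mul_smul_comm, smul_mul_smul_comm, mul_comm]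

theorem liftR_liftL_comm {X : WithConv (C →ₗ[F] R)} {Y : WithConv (D →ₗ[F] R)}
    (h : ∀ a b, Commute (X a) (Y b)) : Commute (liftR C Y) (liftL D X) := by
  refine conv_ext fun a b => ?_
  rw [liftR_mul_liftL_tmul, liftL_mul_liftR_tmul, h]

end TensorConv

/-! ### The pairing as a convolution-invertible map, and the straightening map -/

namespace DualHopf

open WithConv Coalgebra HopfAlgebra

variable {F H R : Type*} [Field F] [Ring H] [HopfAlgebra F H] [Ring R] [Algebra F R]

local notation "S" => antipode F (A := H)
local notation "H⋆" => Module.Dual F H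

/-- The map `α ⊗ h ↦ ⟨α, f h⟩ 1`. -/
def pairConv (R : Type*) [Ring R] [Algebra F R] (f : H →ₗ[F] H) :
    WithConv (Module.Dual F H ⊗[F] H →ₗ[F] R) :=
  toConv (Algebra.linearMap F R ∘ₗ contractLeft F H ∘ₗ f.lTensor (Module.Dual F H))

theorem pairConv_tmul (f : H →ₗ[F] H) (α : H⋆) (h : H) :
    pairConv R f (α ⊗ₜ h) = α (f h) • (1 : R) := by
  simp [pairConv, Algebra.algebraMap_eq_smul_one]

variable [FiniteDimensional F H]

theorem sum_right_smul_left {ι : Type*} {α : H⋆} (r : Coalgebra.Repr F α ι) (x : H) :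
    ∑ i ∈ r.index, r.right i x • r.left i = transL α x := by
  rw [← eval_lTensor_copComul]
  change _ = TensorProduct.rid F H⋆ ((Module.Dual.eval F H x).lTensor H⋆ (comul α))
  rw [← r.eq]
  simp

theorem sum_left_smul_right {ι : Type*} {α : H⋆} (r : Coalgebra.Repr F α ι) (x : H) :
    ∑ i ∈ r.index, r.left i x • r.right i = transR α x := by
  rw [← eval_rTensor_copComul]
  change _ = TensorProduct.lid F H⋆ ((Module.Dual.eval F H x).rTensor H⋆ (comul α))
  rw [← r.eq]
  simp

/-- Convolution with the pairing on the right translates the functional by `h₂`. -/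
theorem conv_mul_pairConv (X : WithConv (H⋆ ⊗[F] H →ₗ[F] R)) (f : H →ₗ[F] H) (α : H⋆) {y : H}
    {ι : Type*} (s : Coalgebra.Repr F y ι) : (X * pairConv R f) (α ⊗ₜ y)
      = ∑ j ∈ s.index, X (transL α (f (s.right j)) ⊗ₜ s.left j) := by
  rw [conv_tmul _ _ (ℛ F α) s, Finset.sum_comm]
  refine Finset.sum_congr rfl fun j _ => ?_
  rw [← sum_right_smul_left (ℛ F α), sum_tmul, map_sum]
  refine Finset.sum_congr rfl fun i _ => ?_
  rw [pairConv_tmul, mul_smul_comm, mul_one, ← smul_tmul', map_smul]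

/-- Convolution with the pairing on the left translates the functional by `h₁`. -/
theorem pairConv_mul_conv (X : WithConv (H⋆ ⊗[F] H →ₗ[F] R)) (f : H →ₗ[F] H) (α : H⋆) {y : H}
    {ι : Type*} (s : Coalgebra.Repr F y ι) : (pairConv R f * X) (α ⊗ₜ y)
      = ∑ j ∈ s.index, X (transR α (f (s.left j)) ⊗ₜ s.right j) := by
  rw [conv_tmul _ _ (ℛ F α) s, Finset.sum_comm]
  refine Finset.sum_congr rfl fun j _ => ?_
  rw [← sum_left_smul_right (ℛ F α), sum_tmul, map_sum]
  refine Finset.sum_congr rfl fun i _ => ?_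
  rw [pairConv_tmul, smul_mul_assoc, one_mul, ← smul_tmul', map_smul]

section

variable [InvolutiveAntipode F H]

theorem pairConv_id_mul_antipode :
    pairConv R (LinearMap.id : H →ₗ[F] H) * pairConv R S = 1 := by
  refine conv_ext fun α y => ?_
  rw [conv_mul_pairConv _ _ _ (ℛ F y), conv_one_tmul]
  simp only [pairConv_tmul, transL_apply, LinearMap.id_apply]
  rw [← Finset.sum_smul, ← map_sum, sum_antipode_right_mul_left, map_smul, smul_eq_mul, mul_comm]
  rfl

theorem pairConv_antipode_mul_id :
    pairConv R S * pairConv R (LinearMap.id : H →ₗ[F] H) = 1 := by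
  refine conv_ext fun α y => ?_
  rw [pairConv_mul_conv _ _ _ (ℛ F y), conv_one_tmul]
  simp only [pairConv_tmul, transR_apply, LinearMap.id_apply]
  rw [← Finset.sum_smul, ← map_sum, sum_right_mul_antipode_left, map_smul, smul_eq_mul, mul_comm]
  rfl

end

theorem reverse₃_dual_comul₃ (α : H⋆) :
    reverse₃ F H⋆ ((HopfMaps.of F H).dual.comul₃ α) = (comul (R := F)).lTensor H⋆ (comul α) := by
  rw [← Coalgebra.coassoc_apply]
  have : reverse₃ F H⋆ ∘ₗ TensorProduct.map LinearMap.id (HopfMaps.of F H).dual.comul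
      = (TensorProduct.assoc F H⋆ H⋆ H⋆).toLinearMap ∘ₗ (copComul F H).rTensor H⋆
        ∘ₗ (TensorProduct.comm F _ _).toLinearMap := by
    ext1
    ext1 a
    ext1 b
    rfl
  exact congrArg (fun f => f ((HopfMaps.of F H).dual.comul α)) this

/-- The straightening map of the double is conjugation by the pairing, up to antipodes. -/
theorem comp_straighten (X : WithConv (H⋆ ⊗[F] H →ₗ[F] R)) (f g : H →ₗ[F] H) (α : H⋆) (h : H) :
    X ((HopfMaps.of F H).straighten f.dualMap g.dualMap (h ⊗ₜ α))
      = (pairConv R f * (X * pairConv R g)) (α ⊗ₜ h) := by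
  let T : (H ⊗[F] (H ⊗[F] H)) ⊗[F] (H⋆ ⊗[F] (H⋆ ⊗[F] H⋆)) →ₗ[F] H⋆ ⊗[F] H :=
    (TensorProduct.lid F _).toLinearMap
    ∘ₗ TensorProduct.map
      (contractRight F H ∘ₗ TensorProduct.map LinearMap.id f.dualMap)
      ((TensorProduct.rid F _).toLinearMap
        ∘ₗ TensorProduct.map (TensorProduct.comm F H (Module.Dual F H)).toLinearMap
          (contractRight F H ∘ₗ TensorProduct.map LinearMap.id g.dualMap)
        ∘ₗ (TensorProduct.tensorTensorTensorComm F H H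
            (Module.Dual F H) (Module.Dual F H)).toLinearMap)
    ∘ₗ (TensorProduct.tensorTensorTensorComm F H (H ⊗[F] H)
        (Module.Dual F H) (Module.Dual F H ⊗[F] Module.Dual F H)).toLinearMap
  have hT : ∀ (h₁ h₂ h₃ : H) (a b c : H⋆), T ((h₁ ⊗ₜ (h₂ ⊗ₜ h₃)) ⊗ₜ (a ⊗ₜ (b ⊗ₜ c)))
      = (a (f h₁) * c (g h₃)) • (b ⊗ₜ h₂) := by
    intro h₁ h₂ h₃ a b c
    simp [T, smul_smul, mul_comm]
  have h1 : (HopfMaps.of F H).straighten f.dualMap g.dualMap (h ⊗ₜ α)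
      = T ((comul (R := F)).lTensor H (comul h) ⊗ₜ (comul (R := F)).lTensor H⋆ (comul α)) := by
    rw [← reverse₃_dual_comul₃]
    rfl
  let r := ℛ F α
  let s := ℛ F h
  rw [h1, conv_tmul _ _ r s]
  have h2 : (comul (R := F)).lTensor H (comul h)
      = ∑ j ∈ s.index, ∑ l ∈ (ℛ F (s.right j)).index,
        s.left j ⊗ₜ[F] ((ℛ F (s.right j)).left l ⊗ₜ[F] (ℛ F (s.right j)).right l) := by
    simp only [← tmul_sum, (ℛ F _).eq]
    conv_lhs => rw [← s.eq]
    rw [map_sum]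
    rfl
  have h3 : (comul (R := F)).lTensor H⋆ (comul α)
      = ∑ i ∈ r.index, ∑ k ∈ (ℛ F (r.right i)).index,
        r.left i ⊗ₜ[F] ((ℛ F (r.right i)).left k ⊗ₜ[F] (ℛ F (r.right i)).right k) := by
    simp only [← tmul_sum, (ℛ F _).eq]
    conv_lhs => rw [← r.eq]
    rw [map_sum]
    rfl
  rw [h2, h3]
  simp only [tmul_sum, sum_tmul, map_sum, hT, map_smul]
  refine Finset.sum_congr rfl fun i _ => ?_
  rw [Finset.sum_comm]
  refine Finset.sum_congr rfl fun j _ => ?_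
  rw [conv_tmul _ _ (ℛ F (r.right i)) (ℛ F (s.right j)), Finset.mul_sum]
  refine Finset.sum_congr rfl fun k _ => ?_
  rw [Finset.mul_sum]
  refine Finset.sum_congr rfl fun l _ => ?_
  rw [pairConv_tmul, pairConv_tmul, mul_smul_comm, mul_one, smul_mul_smul_comm, one_mul]

end DualHopf

/-! ### Representations of the Drinfeld double -/

namespace DualHopf

open WithConv Coalgebra HopfAlgebra

variable {F H R : Type*} [Field F] [Ring H] [HopfAlgebra F H] [Ring R] [Algebra F R]
  [FiniteDimensional F H]

local notation "S" => antipode F (A := H)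
local notation "H⋆" => Module.Dual F H
local notation "𝔻" => HopfMaps.drinfeldDouble (HopfMaps.of F H)

/-- The map `α ⊗ h ↦ A(α)` on `H⋆ ⊗ H`. -/
abbrev convA (A : H⋆ →ₐ[F] R) : WithConv (H⋆ ⊗[F] H →ₗ[F] R) := liftL H (toConv A.toLinearMap)

/-- The map `α ⊗ h ↦ B(h)` on `H⋆ ⊗ H`. -/
abbrev convB (B : H →ₐ[F] R) : WithConv (H⋆ ⊗[F] H →ₗ[F] R) := liftR H⋆ (toConv B.toLinearMap)

/-- The pairing `α ⊗ h ↦ ⟨α, h⟩ 1`. -/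
abbrev pair (F H R : Type*) [Field F] [Ring H] [HopfAlgebra F H] [Ring R] [Algebra F R] :
    WithConv (Module.Dual F H ⊗[F] H →ₗ[F] R) :=
  pairConv R LinearMap.id

/-- The convolution inverse `α ⊗ h ↦ ⟨α, S h⟩ 1` of the pairing. -/
abbrev pairInv (F H R : Type*) [Field F] [Ring H] [HopfAlgebra F H] [Ring R] [Algebra F R] :
    WithConv (Module.Dual F H ⊗[F] H →ₗ[F] R) :=
  pairConv R (antipode F)

/-- The commutation relation of the double, for representations `A` of `H⋆` and `B` of `H`. In the
convolution algebra of maps from `H⋆ ⊗ H`, with the pairing `P`, it reads `B A = P (A B) P⁻¹`. -/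
def DoubleRel (A : H⋆ →ₐ[F] R) (B : H →ₐ[F] R) : Prop :=
  convB B * convA A = pair F H R * (convA A * convB B) * pairInv F H R

/-- The map `α ⊗ h ↦ A(α) B(h)`. -/
def doubleMap (A : H⋆ →ₐ[F] R) (B : H →ₐ[F] R) : H⋆ ⊗[F] H →ₗ[F] R :=
  (convA A * convB B).ofConv

theorem doubleMap_tmul (A : H⋆ →ₐ[F] R) (B : H →ₐ[F] R) (α : H⋆) (h : H) :
    doubleMap A B (α ⊗ₜ h) = A α * B h :=
  liftL_mul_liftR_tmul (toConv A.toLinearMap) (toConv B.toLinearMap) α h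

variable [InvolutiveAntipode F H]

theorem pair_mul_pairInv : pair F H R * pairInv F H R = 1 := pairConv_id_mul_antipode

theorem pairInv_mul_pair : pairInv F H R * pair F H R = 1 := pairConv_antipode_mul_id

theorem drinfeldDouble_mul_eq (α β : H⋆) (h k : H) :
    (𝔻).mul (α ⊗ₜ h) (β ⊗ₜ k) = TensorProduct.map (LinearMap.mulLeft F α) (LinearMap.mulRight F k)
      ((HopfMaps.of F H).straighten LinearMap.id.dualMap (antipode F (A := H)).dualMap (h ⊗ₜ β)) := by
  have h0 : (𝔻).mul (α ⊗ₜ h) (β ⊗ₜ k) = TensorProduct.map ((HopfMaps.of F H).dual.mulT) (HopfMaps.of F H).mulT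
      ((TensorProduct.tensorTensorTensorAssoc F H⋆ H⋆ H H).symm ((α ⊗ₜ
        ((HopfMaps.of F H).straighten LinearMap.id (HopfMaps.of F H).dual.antipodeInv (h ⊗ₜ β)))
          ⊗ₜ k)) := rfl
  rw [h0, antipodeInv_dual, LinearMap.dualMap_id]
  generalize ((HopfMaps.of F H).straighten _ _ (h ⊗ₜ β)) = t
  induction t with
  | zero => simp
  | add a b ha hb => simp only [map_add, tmul_add, add_tmul, ha, hb]
  | tmul a b => rfl

/-- A pair that satisfies the commutation relation is a representation of the double: the product of
the double is defined by the straightening map, which is conjugation by the pairing. -/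
theorem doubleMap_mul {A : H⋆ →ₐ[F] R} {B : H →ₐ[F] R} (hAB : DoubleRel A B) (x y : H⋆ ⊗[F] H) :
    doubleMap A B ((𝔻).mul x y) = doubleMap A B x * doubleMap A B y := by
  induction x with
  | zero => simp
  | add a b ha hb => simp only [map_add, LinearMap.add_apply, ha, hb, add_mul]
  | tmul α h =>
    induction y with
    | zero => simp
    | add a b ha hb => simp only [map_add, ha, hb, mul_add]
    | tmul β k =>
      have h1 : ∀ t : H⋆ ⊗[F] H, doubleMap A B (TensorProduct.map (LinearMap.mulLeft F α)
          (LinearMap.mulRight F k) t) = A α * doubleMap A B t * B k := by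
        intro t
        induction t with
        | zero => simp
        | add a b ha hb => simp only [map_add, ha, hb, mul_add, add_mul]
        | tmul a b => simp only [TensorProduct.map_tmul, LinearMap.mulLeft_apply,
            LinearMap.mulRight_apply, doubleMap_tmul, map_mul, mul_assoc]
      rw [drinfeldDouble_mul_eq, h1]
      have h2 := comp_straighten (convA A * convB B) LinearMap.id S β h
      rw [← mul_assoc, ← hAB, liftR_mul_liftL_tmul] at h2
      have h3 : doubleMap A B ((HopfMaps.of F H).straighten LinearMap.id.dualMap
        (antipode F (A := H)).dualMap (h ⊗ₜ β)) = B h * A β := h2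
      rw [h3, doubleMap_tmul, doubleMap_tmul]
      simp only [mul_assoc]

theorem doubleMap_one (A : H⋆ →ₐ[F] R) (B : H →ₐ[F] R) : doubleMap A B (𝔻).one = 1 := by
  change doubleMap A B ((1 : H⋆) ⊗ₜ (1 : H)) = 1
  rw [doubleMap_tmul, map_one, map_one, one_mul]

/-- The commutation relation in the form `A B = P⁻¹ B A P`. -/
theorem doubleRel_iff {A : H⋆ →ₐ[F] R} {B : H →ₐ[F] R} : DoubleRel A B ↔
    convA A * convB B = pairInv F H R * (convB B * convA A) * pair F H R := by
  constructor
  · intro h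
    rw [h]
    simp only [← mul_assoc]
    rw [pairInv_mul_pair, one_mul, mul_assoc _ (pairInv F H R), pairInv_mul_pair, mul_one]
  · intro h
    rw [DoubleRel, h]
    simp only [← mul_assoc]
    rw [pair_mul_pairInv, one_mul, mul_assoc _ (pair F H R), pair_mul_pairInv, mul_one]

theorem drinfeldDouble_comul : (𝔻).comul = (comul (R := F) : H⋆ ⊗[F] H →ₗ[F] _) := rfl

theorem drinfeldDouble_counit : (𝔻).counit = (counit (R := F) : H⋆ ⊗[F] H →ₗ[F] F) := by
  ext a b
  simp [HopfMaps.drinfeldDouble, HopfMaps.dual, HopfMaps.of, counit_apply, mul_comm]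

/-- The antipode of the double, through a map into an algebra. -/
theorem comp_drinfeldDouble_antipode (X : WithConv (H⋆ ⊗[F] H →ₗ[F] R)) (t : H⋆ ⊗[F] H) :
    X ((𝔻).antipode t) = (pairInv F H R * toConv (X.ofConv ∘ₗ TensorProduct.map
      (antipode F (A := H⋆)) (antipode F (A := H))) * pair F H R) t := by
  induction t with
  | zero => simp
  | add a b ha hb => simp only [map_add, ha, hb]
  | tmul α h =>
    have h1 : X ((𝔻).antipode (α ⊗ₜ h)) = X (TensorProduct.map (antipode F (A := H⋆))
      (antipode F (A := H)) ((HopfMaps.of F H).straighten (HopfMaps.of F H).dual.antipodeInv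
        LinearMap.id (h ⊗ₜ α))) := rfl
    rw [h1, antipodeInv_dual, ← LinearMap.dualMap_id, mul_assoc, ← comp_straighten]
    rfl

theorem doubleMap_antipode (A : H⋆ →ₐ[F] R) (B : H →ₐ[F] R) (t : H⋆ ⊗[F] H) :
    doubleMap A B ((𝔻).antipode t) = (pairInv F H R * (liftL H (toConv (A.toLinearMap ∘ₗ antipode F))
      * liftR H⋆ (toConv (B.toLinearMap ∘ₗ antipode F))) * pair F H R) t := by
  have h1 : toConv ((convA A * convB B).ofConv ∘ₗ TensorProduct.map
      (antipode F (A := H⋆)) (antipode F (A := H))) = liftL H (toConv (A.toLinearMap ∘ₗ antipode F))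
      * liftR H⋆ (toConv (B.toLinearMap ∘ₗ antipode F)) := by
    refine conv_ext fun a b => ?_
    rw [liftL_mul_liftR_tmul]
    exact liftL_mul_liftR_tmul (toConv A.toLinearMap) (toConv B.toLinearMap) _ _
  rw [← h1]
  exact comp_drinfeldDouble_antipode (convA A * convB B) t

/-- `τ ∘ S` is a convolution inverse of `τ = doubleMap A B`. -/
theorem doubleMap_conv_antipode {A : H⋆ →ₐ[F] R} {B : H →ₐ[F] R} (hAB : DoubleRel A B) :
    toConv (doubleMap A B) * toConv (doubleMap A B ∘ₗ (𝔻).antipode) = 1 ∧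
    toConv (doubleMap A B ∘ₗ (𝔻).antipode) * toConv (doubleMap A B) = 1 := by
  have h1 : toConv (doubleMap A B ∘ₗ (𝔻).antipode)
      = pairInv F H R * (liftL H (toConv (A.toLinearMap ∘ₗ antipode F))
      * liftR H⋆ (toConv (B.toLinearMap ∘ₗ antipode F))) * pair F H R := by
    apply WithConv.ext
    ext1
    ext a b
    exact doubleMap_antipode A B (a ⊗ₜ b)
  have h2 : toConv (doubleMap A B) = pairInv F H R * (convB B * convA A) * pair F H R :=
    doubleRel_iff.mp hAB
  have eA1 : convA A * liftL H (toConv (A.toLinearMap ∘ₗ antipode F)) = 1 := by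
    rw [← liftL_mul, conv_algHom_mul_antipode, liftL_one]
  have eA2 : liftL H (toConv (A.toLinearMap ∘ₗ antipode F)) * convA A = 1 := by
    rw [← liftL_mul, conv_antipode_mul_algHom, liftL_one]
  have eB1 : convB B * liftR H⋆ (toConv (B.toLinearMap ∘ₗ antipode F)) = 1 := by
    rw [← liftR_mul, conv_algHom_mul_antipode, liftR_one]
  have eB2 : liftR H⋆ (toConv (B.toLinearMap ∘ₗ antipode F)) * convB B = 1 := by
    rw [← liftR_mul, conv_antipode_mul_algHom, liftR_one]
  have e1 : ∀ X : WithConv (H⋆ ⊗[F] H →ₗ[F] R), pair F H R * (pairInv F H R * X) = X := fun X => by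
    rw [← mul_assoc, pair_mul_pairInv, one_mul]
  have e2 : ∀ X : WithConv (H⋆ ⊗[F] H →ₗ[F] R), convA A * (liftL H (toConv (A.toLinearMap ∘ₗ antipode F)) * X) = X := fun X => by
    rw [← mul_assoc, eA1, one_mul]
  have e3 : ∀ X : WithConv (H⋆ ⊗[F] H →ₗ[F] R), convB B * (liftR H⋆ (toConv (B.toLinearMap ∘ₗ antipode F)) * X) = X := fun X => by
    rw [← mul_assoc, eB1, one_mul]
  have e4 : ∀ X : WithConv (H⋆ ⊗[F] H →ₗ[F] R), liftL H (toConv (A.toLinearMap ∘ₗ antipode F)) * (convA A * X) = X := fun X => by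
    rw [← mul_assoc, eA2, one_mul]
  have e5 : ∀ X : WithConv (H⋆ ⊗[F] H →ₗ[F] R), liftR H⋆ (toConv (B.toLinearMap ∘ₗ antipode F)) * (convB B * X) = X := fun X => by
    rw [← mul_assoc, eB2, one_mul]
  rw [h1, h2]
  constructor
  · simp only [mul_assoc]
    rw [e1, e2, e3, pairInv_mul_pair]
  · simp only [mul_assoc]
    rw [e1, e5, e4, pairInv_mul_pair]

/-- The relation is multiplicative for pairs that commute with each other. -/
theorem rel_mul {a₁ b₁ a₂ b₂ : WithConv (H⋆ ⊗[F] H →ₗ[F] R)}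
    (h₁ : b₁ * a₁ = pair F H R * (a₁ * b₁) * pairInv F H R)
    (h₂ : b₂ * a₂ = pair F H R * (a₂ * b₂) * pairInv F H R)
    (c₁ : Commute b₂ a₁) (c₂ : Commute b₁ a₂) :
    (b₁ * b₂) * (a₁ * a₂) = pair F H R * ((a₁ * a₂) * (b₁ * b₂)) * pairInv F H R := by
  have e1 : (b₁ * b₂) * (a₁ * a₂) = (b₁ * a₁) * (b₂ * a₂) := by
    rw [mul_assoc, ← mul_assoc b₂, c₁.eq]
    simp only [mul_assoc]
  have e2 : (a₁ * a₂) * (b₁ * b₂) = (a₁ * b₁) * (a₂ * b₂) := by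
    rw [mul_assoc, ← mul_assoc a₂, ← c₂.eq]
    simp only [mul_assoc]
  rw [e1, e2, h₁, h₂]
  simp only [mul_assoc]
  rw [← mul_assoc (pairInv F H R) (pair F H R), pairInv_mul_pair, one_mul]

section

variable {R' : Type*} [Ring R'] [Algebra F R']

/-- Postcomposition with an algebra homomorphism, as a ring homomorphism of convolution rings. -/
theorem comp_conv_mul {C : Type*} [AddCommGroup C] [Module F C] [Coalgebra F C] (φ : R →ₐ[F] R')
    (X Y : WithConv (C →ₗ[F] R)) : toConv (φ.toLinearMap ∘ₗ (X * Y).ofConv)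
      = toConv (φ.toLinearMap ∘ₗ X.ofConv) * toConv (φ.toLinearMap ∘ₗ Y.ofConv) := by
  rw [LinearMap.algHom_comp_convMul_distrib]

theorem comp_pairConv (φ : R →ₐ[F] R') (f : H →ₗ[F] H) :
    toConv (φ.toLinearMap ∘ₗ (pairConv R f).ofConv) = pairConv R' f := by
  refine conv_ext fun a b => ?_
  rw [pairConv_tmul]
  change φ (pairConv R f (a ⊗ₜ b)) = _
  rw [pairConv_tmul, map_smul, map_one]

theorem comp_convA (φ : R →ₐ[F] R') (A : H⋆ →ₐ[F] R) :
    toConv (φ.toLinearMap ∘ₗ (convA A).ofConv) = convA (φ.comp A) := rfl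

theorem comp_convB (φ : R →ₐ[F] R') (B : H →ₐ[F] R) :
    toConv (φ.toLinearMap ∘ₗ (convB B).ofConv) = convB (φ.comp B) := rfl

theorem DoubleRel.comp {A : H⋆ →ₐ[F] R} {B : H →ₐ[F] R} (hAB : DoubleRel A B) (φ : R →ₐ[F] R') :
    DoubleRel (φ.comp A) (φ.comp B) := by
  have h := congrArg (fun X => toConv (φ.toLinearMap ∘ₗ ofConv X)) hAB
  simpa only [comp_conv_mul, comp_pairConv, comp_convA, comp_convB, DoubleRel] using h

open Algebra.TensorProduct

theorem toConv_map_comul {C : Type*} [Ring C] [HopfAlgebra F C] (f : C →ₐ[F] R) (g : C →ₐ[F] R') :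
    toConv ((Algebra.TensorProduct.map f g).comp (Bialgebra.comulAlgHom F C)).toLinearMap
      = toConv ((includeLeft : R →ₐ[F] R ⊗[F] R').comp f).toLinearMap
        * toConv ((includeRight : R' →ₐ[F] R ⊗[F] R').comp g).toLinearMap := by
  have h := congrArg (fun X => toConv ((Algebra.TensorProduct.map f g).toLinearMap ∘ₗ ofConv X))
    (toConv_comul (F := F) (H := C))
  simp only [comp_conv_mul] at h
  refine h.trans ?_
  congr 2 <;> · apply LinearMap.ext; intro x; simp

theorem convA_map_comul (A : H⋆ →ₐ[F] R) (A' : H⋆ →ₐ[F] R') :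
    convA ((Algebra.TensorProduct.map A A').comp (Bialgebra.comulAlgHom F H⋆))
      = convA ((includeLeft : R →ₐ[F] R ⊗[F] R').comp A)
        * convA ((includeRight : R' →ₐ[F] R ⊗[F] R').comp A') := by
  rw [convA, toConv_map_comul, liftL_mul]

theorem convB_map_comul (B : H →ₐ[F] R) (B' : H →ₐ[F] R') :
    convB ((Algebra.TensorProduct.map B B').comp (Bialgebra.comulAlgHom F H))
      = convB ((includeLeft : R →ₐ[F] R ⊗[F] R').comp B)
        * convB ((includeRight : R' →ₐ[F] R ⊗[F] R').comp B') := by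
  rw [convB, toConv_map_comul, liftR_mul]

/-- The relation is preserved by tensor products of representations. -/
theorem DoubleRel.tensor {A : H⋆ →ₐ[F] R} {B : H →ₐ[F] R} {A' : H⋆ →ₐ[F] R'} {B' : H →ₐ[F] R'}
    (hAB : DoubleRel A B) (hAB' : DoubleRel A' B') :
    DoubleRel ((Algebra.TensorProduct.map A A').comp (Bialgebra.comulAlgHom F H⋆))
      ((Algebra.TensorProduct.map B B').comp (Bialgebra.comulAlgHom F H)) := by
  rw [DoubleRel, convA_map_comul, convB_map_comul]
  refine rel_mul (hAB.comp _) (hAB'.comp _) ?_ ?_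
  · refine liftR_liftL_comm fun a b => ?_
    change (A a ⊗ₜ[F] (1 : R')) * ((1 : R) ⊗ₜ[F] B' b) = ((1 : R) ⊗ₜ[F] B' b) * (A a ⊗ₜ[F] (1 : R'))
    simp
  · refine liftR_liftL_comm fun a b => ?_
    change ((1 : R) ⊗ₜ[F] A' a) * (B b ⊗ₜ[F] (1 : R')) = (B b ⊗ₜ[F] (1 : R')) * ((1 : R) ⊗ₜ[F] A' a)
    simp

/-- A tensor product of maps after the comultiplication, as a convolution product. -/
theorem map_comul_eq_conv {C : Type*} [AddCommGroup C] [Module F C] [Coalgebra F C]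
    (f : C →ₗ[F] R) (g : C →ₗ[F] R') (c : C) : TensorProduct.map f g (comul c)
      = (toConv ((includeLeft : R →ₐ[F] R ⊗[F] R').toLinearMap ∘ₗ f)
        * toConv ((includeRight : R' →ₐ[F] R ⊗[F] R').toLinearMap ∘ₗ g)) c := by
  rw [(ℛ F c).convMul_apply, ← (ℛ F c).eq]
  simp

theorem doubleMap_tensor (A : H⋆ →ₐ[F] R) (B : H →ₐ[F] R) (A' : H⋆ →ₐ[F] R') (B' : H →ₐ[F] R')
    (t : H⋆ ⊗[F] H) :
    doubleMap ((Algebra.TensorProduct.map A A').comp (Bialgebra.comulAlgHom F H⋆))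
      ((Algebra.TensorProduct.map B B').comp (Bialgebra.comulAlgHom F H)) t
      = TensorProduct.map (doubleMap A B) (doubleMap A' B') (comul t) := by
  induction t with
  | zero => simp
  | add a b ha hb => simp only [map_add, ha, hb]
  | tmul α h =>
    rw [map_comul_eq_conv, conv_tmul _ _ (ℛ F α) (ℛ F h), doubleMap_tmul]
    simp only [AlgHom.comp_apply, Bialgebra.comulAlgHom_apply]
    rw [← (ℛ F α).eq, ← (ℛ F h).eq]
    simp only [map_sum, Finset.sum_mul_sum, Algebra.TensorProduct.map_tmul, tmul_mul_tmul]
    refine Finset.sum_congr rfl fun i _ => Finset.sum_congr rfl fun j _ => ?_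
    change _ = (doubleMap A B _ ⊗ₜ[F] (1 : R')) * ((1 : R) ⊗ₜ[F] doubleMap A' B' _)
    rw [tmul_mul_tmul, mul_one, one_mul, doubleMap_tmul, doubleMap_tmul]

end

end DualHopf

/-! ### The local operators on a Hopf algebra and their relations -/

namespace DualHopf

open WithConv Coalgebra HopfAlgebra

variable {F H : Type*} [Field F] [Ring H] [HopfAlgebra F H] [FiniteDimensional F H]

local notation "S" => antipode F (A := H)
local notation "H⋆" => Module.Dual F H
local notation "𝔻" => HopfMaps.drinfeldDouble (HopfMaps.of F H)

/-- Left multiplication, as a representation of `H` on itself. -/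
def opL (F H : Type*) [Field F] [Ring H] [HopfAlgebra F H] : H →ₐ[F] Module.End F H :=
  Algebra.lmul F H

/-- The representation `y ↦ (m ↦ m S(y))` of `H` on itself. -/
def opR (F H : Type*) [Field F] [Ring H] [HopfAlgebra F H] : H →ₐ[F] Module.End F H :=
  AlgHom.ofLinearMap ((LinearMap.mul F H).flip ∘ₗ antipode F)
    (by ext; simp) (fun x y => by ext; simp [antipode_mul_antidistrib, mul_assoc])

theorem opL_apply (y m : H) : opL F H y m = y * m := rfl
theorem opR_apply (y m : H) : opR F H y m = m * S y := rfl

theorem opL_opR_comm (x y : H) : Commute (opL F H x) (opR F H y) := by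
  apply LinearMap.ext
  intro m
  change x * (m * S y) = x * m * S y
  rw [mul_assoc]

theorem leftHit_one (x : H) : leftHit (1 : H⋆) x = x := by
  rw [leftHit_apply _ (ℛ F x)]
  exact sum_smul_counit _

theorem leftHit_mul (α β : H⋆) (x : H) : leftHit (α * β) x = leftHit α (leftHit β x) := by
  let K : H ⊗[F] (H ⊗[F] H) →ₗ[F] H := (TensorProduct.rid F H).toLinearMap ∘ₗ
    (LinearMap.mul' F F ∘ₗ TensorProduct.map α β).lTensor H
  have h1 : leftHit (α * β) x = K ((comul (R := F)).lTensor H (comul x)) := by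
    rw [leftHit_apply _ (ℛ F x)]
    conv_rhs => rw [← (ℛ F x).eq]
    simp only [map_sum, LinearMap.lTensor_tmul, K, LinearMap.comp_apply, LinearEquiv.coe_coe,
      TensorProduct.rid_tmul]
    refine Finset.sum_congr rfl fun i _ => ?_
    rw [mul_apply _ _ (ℛ F ((ℛ F x).right i))]
    conv_rhs => rw [← (ℛ F ((ℛ F x).right i)).eq]
    simp
  have h2 : leftHit α (leftHit β x) = K (TensorProduct.assoc F H H H
      ((comul (R := F)).rTensor H (comul x))) := by
    rw [leftHit_apply β (ℛ F x)]
    conv_rhs => rw [← (ℛ F x).eq]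
    simp only [map_sum, LinearMap.rTensor_tmul, map_smul]
    refine Finset.sum_congr rfl fun i _ => ?_
    rw [leftHit_apply α (ℛ F ((ℛ F x).left i))]
    conv_rhs => rw [← (ℛ F ((ℛ F x).left i)).eq]
    simp [K, sum_tmul, Finset.smul_sum, smul_smul, mul_comm]
  rw [h1, h2, Coalgebra.coassoc_apply]

/-- The action `m ↦ m₁ γ(m₂)` of the dual on `H`. -/
def opRhoR (F H : Type*) [Field F] [Ring H] [HopfAlgebra F H] [FiniteDimensional F H] :
    Module.Dual F H →ₐ[F] Module.End F H :=
  AlgHom.ofLinearMap { toFun := leftHit, map_add' := leftHit_add, map_smul' := leftHit_smul }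
    (LinearMap.ext leftHit_one) (fun α β => LinearMap.ext (leftHit_mul α β))

theorem opRhoR_apply (γ : H⋆) {ι : Type*} {m : H} (r : Coalgebra.Repr F m ι) :
    opRhoR F H γ m = ∑ i ∈ r.index, γ (r.right i) • r.left i :=
  leftHit_apply _ r

theorem rightHit_add (f g : H⋆) : rightHit (f + g) = rightHit f + rightHit g := by
  ext x
  simp [rightHit, LinearMap.rTensor_add]

theorem rightHit_smul (c : F) (f : H⋆) : rightHit (c • f) = c • rightHit f := by
  ext x
  simp [rightHit, LinearMap.rTensor_smul]

variable [InvolutiveAntipode F H]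

theorem rightHit_antipode_one (x : H) : rightHit (antipode F (1 : H⋆)) x = x := by
  rw [rightHit_apply _ (ℛ F x)]
  simp only [dual_antipode_apply, one_apply, counit_antipode]
  exact sum_counit_smul_right _

theorem rightHit_antipode_mul (α β : H⋆) (x : H) : rightHit (antipode F (α * β)) x
    = rightHit (antipode F α) (rightHit (antipode F β) x) := by
  let K : H ⊗[F] (H ⊗[F] H) →ₗ[F] H := (TensorProduct.lid F H).toLinearMap ∘ₗ
    (LinearMap.mul' F F ∘ₗ TensorProduct.map (antipode F β) (antipode F α)).rTensor H
      ∘ₗ (TensorProduct.assoc F H H H).symm.toLinearMap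
  have h1 : rightHit (antipode F (α * β)) x = K (TensorProduct.assoc F H H H
      ((comul (R := F)).rTensor H (comul x))) := by
    rw [rightHit_apply _ (ℛ F x)]
    conv_rhs => rw [← (ℛ F x).eq]
    simp only [map_sum, LinearMap.rTensor_tmul, K, LinearMap.comp_apply, LinearEquiv.coe_coe,
      TensorProduct.lid_tmul, LinearEquiv.symm_apply_apply]
    refine Finset.sum_congr rfl fun i _ => ?_
    rw [antipode_mul_antidistrib, mul_apply _ _ (ℛ F ((ℛ F x).left i))]
    conv_rhs => rw [← (ℛ F ((ℛ F x).left i)).eq]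
    simp
  have h2 : rightHit (antipode F α) (rightHit (antipode F β) x)
      = K ((comul (R := F)).lTensor H (comul x)) := by
    rw [rightHit_apply (antipode F β) (ℛ F x)]
    conv_rhs => rw [← (ℛ F x).eq]
    simp only [map_sum, LinearMap.lTensor_tmul, map_smul]
    refine Finset.sum_congr rfl fun i _ => ?_
    rw [rightHit_apply (antipode F α) (ℛ F ((ℛ F x).right i))]
    conv_rhs => rw [← (ℛ F ((ℛ F x).right i)).eq]
    simp [K, tmul_sum, Finset.smul_sum, smul_smul]
  rw [h1, h2, Coalgebra.coassoc_apply]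

/-- The action `m ↦ γ(S(m₁)) m₂` of the dual on `H`. -/
def opRhoL (F H : Type*) [Field F] [Ring H] [HopfAlgebra F H] [FiniteDimensional F H]
    [InvolutiveAntipode F H] : Module.Dual F H →ₐ[F] Module.End F H :=
  AlgHom.ofLinearMap
    { toFun := fun γ => rightHit (antipode F γ)
      map_add' := fun a b => by rw [map_add, rightHit_add]
      map_smul' := fun c a => by rw [map_smul, rightHit_smul, RingHom.id_apply] }
    (LinearMap.ext rightHit_antipode_one) (fun α β => LinearMap.ext (rightHit_antipode_mul α β))

theorem opRhoL_apply (γ : H⋆) {ι : Type*} {m : H} (r : Coalgebra.Repr F m ι) :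
    opRhoL F H γ m = ∑ i ∈ r.index, γ (S (r.left i)) • r.right i :=
  rightHit_apply _ r

theorem opRhoR_opRhoL_comm (α β : H⋆) : Commute (opRhoR F H α) (opRhoL F H β) := by
  apply LinearMap.ext
  intro x
  change leftHit α (rightHit (antipode F β) x) = rightHit (antipode F β) (leftHit α x)
  let K : H ⊗[F] (H ⊗[F] H) →ₗ[F] H := (TensorProduct.lid F H).toLinearMap ∘ₗ
    TensorProduct.map (antipode F β) ((TensorProduct.rid F H).toLinearMap ∘ₗ α.lTensor H)
  have h1 : leftHit α (rightHit (antipode F β) x) = K ((comul (R := F)).lTensor H (comul x)) := by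
    rw [rightHit_apply (antipode F β) (ℛ F x)]
    conv_rhs => rw [← (ℛ F x).eq]
    simp only [map_sum, LinearMap.lTensor_tmul, map_smul]
    refine Finset.sum_congr rfl fun i _ => ?_
    rw [leftHit_apply α (ℛ F ((ℛ F x).right i))]
    conv_rhs => rw [← (ℛ F ((ℛ F x).right i)).eq]
    simp [K, tmul_sum, Finset.smul_sum, smul_smul, mul_comm]
  have h2 : rightHit (antipode F β) (leftHit α x) = K (TensorProduct.assoc F H H H
      ((comul (R := F)).rTensor H (comul x))) := by
    rw [leftHit_apply α (ℛ F x)]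
    conv_rhs => rw [← (ℛ F x).eq]
    simp only [map_sum, LinearMap.rTensor_tmul, map_smul]
    refine Finset.sum_congr rfl fun i _ => ?_
    rw [rightHit_apply (antipode F β) (ℛ F ((ℛ F x).left i))]
    conv_rhs => rw [← (ℛ F ((ℛ F x).left i)).eq]
    simp [K, sum_tmul, Finset.smul_sum, smul_smul]
  rw [h1, h2, Coalgebra.coassoc_apply]

/-- A representation of the coproduct of a product. -/
def reprMul {ι κ : Type*} {x y : H} (r : Coalgebra.Repr F x ι) (s : Coalgebra.Repr F y κ) :
    Coalgebra.Repr F (x * y) (ι × κ) where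
  index := r.index ×ˢ s.index
  left p := r.left p.1 * s.left p.2
  right p := r.right p.1 * s.right p.2
  eq := by
    rw [Bialgebra.comul_mul, ← r.eq, ← s.eq, Finset.sum_mul_sum, Finset.sum_product]
    simp only [Algebra.TensorProduct.tmul_mul_tmul]

/-- A representation of the coproduct of an antipode. -/
def reprAntipode {ι : Type*} {x : H} (r : Coalgebra.Repr F x ι) :
    Coalgebra.Repr F (S x) ι where
  index := r.index
  left i := S (r.right i)
  right i := S (r.left i)
  eq := by rw [comul_antipode, ← r.eq]; simp

theorem conv_ext_end {X Y : WithConv (H⋆ ⊗[F] H →ₗ[F] Module.End F H)}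
    (h : ∀ a b m, X (a ⊗ₜ b) m = Y (a ⊗ₜ b) m) : X = Y :=
  conv_ext fun a b => LinearMap.ext (h a b)

/-- The relation of right coaction and left multiplication: `A B = B A P`. -/
theorem convA_mul_convB_opRhoR_opL : convA (opRhoR F H) * convB (opL F H)
    = convB (opL F H) * convA (opRhoR F H) * pair F H _ := by
  refine conv_ext_end fun γ y m => ?_
  let r := ℛ F y
  let s := ℛ F m
  rw [liftL_mul_liftR_tmul, conv_mul_pairConv _ _ _ r]
  simp only [liftR_mul_liftL_tmul]
  change opRhoR F H γ (opL F H y m) = (∑ j ∈ r.index, opL F H (r.left j)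
    * opRhoR F H (transL γ (LinearMap.id (r.right j)))) m
  rw [opL_apply, opRhoR_apply _ (reprMul r s)]
  simp [reprMul, LinearMap.sum_apply, opRhoR_apply _ s, opL_apply, Finset.sum_product]

/-- The relation of right coaction and right multiplication: `A B = P⁻¹ B A`. -/
theorem convA_mul_convB_opRhoR_opR : convA (opRhoR F H) * convB (opR F H)
    = pairInv F H _ * (convB (opR F H) * convA (opRhoR F H)) := by
  refine conv_ext_end fun γ y m => ?_
  let r := ℛ F y
  let s := ℛ F m
  rw [liftL_mul_liftR_tmul, pairConv_mul_conv _ _ _ r]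
  simp only [liftR_mul_liftL_tmul]
  change opRhoR F H γ (opR F H y m) = (∑ j ∈ r.index, opR F H (r.right j)
    * opRhoR F H (transR γ (S (r.left j)))) m
  rw [opR_apply, opRhoR_apply _ (reprMul s (reprAntipode r))]
  simp only [LinearMap.sum_apply, Module.End.mul_apply, opRhoR_apply _ s, map_sum, map_smul,
    opR_apply, transR_apply]
  rw [Finset.sum_comm]
  simp [reprMul, reprAntipode, Finset.sum_product]

/-- The relation of left coaction and left multiplication: `A B = P⁻¹ B A`. -/
theorem convA_mul_convB_opRhoL_opL : convA (opRhoL F H) * convB (opL F H)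
    = pairInv F H _ * (convB (opL F H) * convA (opRhoL F H)) := by
  refine conv_ext_end fun γ y m => ?_
  let r := ℛ F y
  let s := ℛ F m
  rw [liftL_mul_liftR_tmul, pairConv_mul_conv _ _ _ r]
  simp only [liftR_mul_liftL_tmul]
  change opRhoL F H γ (opL F H y m) = (∑ j ∈ r.index, opL F H (r.right j)
    * opRhoL F H (transR γ (S (r.left j)))) m
  rw [opL_apply, opRhoL_apply _ (reprMul r s)]
  simp [reprMul, LinearMap.sum_apply, opRhoL_apply _ s, opL_apply, Finset.sum_product,
    antipode_mul_antidistrib]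

/-- The relation of left coaction and right multiplication: `A B = B A P`. -/
theorem convA_mul_convB_opRhoL_opR : convA (opRhoL F H) * convB (opR F H)
    = convB (opR F H) * convA (opRhoL F H) * pair F H _ := by
  refine conv_ext_end fun γ y m => ?_
  let r := ℛ F y
  let s := ℛ F m
  rw [liftL_mul_liftR_tmul, conv_mul_pairConv _ _ _ r]
  simp only [liftR_mul_liftL_tmul]
  change opRhoL F H γ (opR F H y m) = (∑ j ∈ r.index, opR F H (r.left j)
    * opRhoL F H (transL γ (LinearMap.id (r.right j)))) m
  rw [opR_apply, opRhoL_apply _ (reprMul s (reprAntipode r))]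
  simp only [LinearMap.sum_apply, Module.End.mul_apply, opRhoL_apply _ s, map_sum, map_smul,
    opR_apply, transL_apply]
  rw [Finset.sum_comm]
  simp [reprMul, reprAntipode, Finset.sum_product, antipode_mul_antidistrib, antipode_antipode]

end DualHopf

namespace DualHopf

open WithConv Coalgebra HopfAlgebra

variable {F H : Type*} [Field F] [Ring H] [HopfAlgebra F H] [FiniteDimensional F H]

local notation "S" => antipode F (A := H)
local notation "H⋆" => Module.Dual F H
local notation "𝔻" => HopfMaps.drinfeldDouble (HopfMaps.of F H)

/-! ### The Heisenberg double as an endomorphism algebra -/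

/-- The map `y ⊗ γ ↦ L_y ∘ ρ(γ)` from the Heisenberg double to the endomorphisms of `H`. -/
def heisenbergRep (F H : Type*) [Field F] [Ring H] [HopfAlgebra F H] [FiniteDimensional F H] :
    H ⊗[F] Module.Dual F H →ₗ[F] Module.End F H :=
  LinearMap.mul' F (Module.End F H) ∘ₗ
    TensorProduct.map (opL F H).toLinearMap (opRhoR F H).toLinearMap

theorem heisenbergRep_tmul (y : H) (γ : H⋆) :
    heisenbergRep F H (y ⊗ₜ γ) = opL F H y * opRhoR F H γ := rfl

variable [InvolutiveAntipode F H]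

/-- The map `T ↦ (m ↦ T(m₂) S(m₁))` recovers `y γ(m)` from the operator of `y ⊗ γ`. -/
theorem heisenbergRep_recover (t : H ⊗[F] H⋆) (m : H) :
    LinearMap.mul' F H (TensorProduct.map (heisenbergRep F H t) S (TensorProduct.comm F H H (comul m)))
      = dualTensorHom F H H (TensorProduct.comm F _ _ t) m := by
  induction t with
  | zero => simp
  | add a b ha hb => simp only [map_add, LinearMap.add_apply, TensorProduct.map_add_left, ha, hb]
  | tmul y γ =>
    let K : H ⊗[F] (H ⊗[F] H) →ₗ[F] H := LinearMap.mulLeft F y ∘ₗ LinearMap.mul' F H ∘ₗ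
      (TensorProduct.comm F H H).toLinearMap ∘ₗ
      TensorProduct.map S ((TensorProduct.rid F H).toLinearMap ∘ₗ γ.lTensor H)
    have h1 : LinearMap.mul' F H (TensorProduct.map (heisenbergRep F H (y ⊗ₜ γ)) S
        (TensorProduct.comm F H H (comul m))) = K ((comul (R := F)).lTensor H (comul m)) := by
      rw [← (ℛ F m).eq]
      simp only [map_sum, LinearMap.lTensor_tmul, TensorProduct.comm_tmul, TensorProduct.map_tmul,
        LinearMap.mul'_apply]
      refine Finset.sum_congr rfl fun i _ => ?_
      rw [heisenbergRep_tmul, Module.End.mul_apply, opRhoR_apply _ (ℛ F _), opL_apply]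
      conv_rhs => rw [← (ℛ F ((ℛ F m).right i)).eq]
      simp [K, tmul_sum, Finset.mul_sum, Finset.sum_mul, mul_assoc]
    have h2 : K (TensorProduct.assoc F H H H ((comul (R := F)).rTensor H (comul m)))
        = γ m • y := by
      rw [← (ℛ F m).eq]
      simp only [map_sum, LinearMap.rTensor_tmul]
      have h3 : ∀ i, K (TensorProduct.assoc F H H H (comul ((ℛ F m).left i) ⊗ₜ[F] (ℛ F m).right i))
          = (counit (R := F) ((ℛ F m).left i) * γ ((ℛ F m).right i)) • y := by
        intro i
        have h4 := sum_right_mul_antipode_left (ℛ F ((ℛ F m).left i))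
        have h5 : K (TensorProduct.assoc F H H H (comul ((ℛ F m).left i) ⊗ₜ[F] (ℛ F m).right i))
            = γ ((ℛ F m).right i) • (y * ∑ j ∈ (ℛ F ((ℛ F m).left i)).index,
              (ℛ F ((ℛ F m).left i)).right j * S ((ℛ F ((ℛ F m).left i)).left j)) := by
          conv_lhs => rw [← (ℛ F ((ℛ F m).left i)).eq]
          simp [K, sum_tmul, Finset.mul_sum, Finset.smul_sum]
        rw [h5, h4, mul_smul_comm, mul_one, smul_smul, mul_comm]
      simp only [h3]
      rw [← Finset.sum_smul]
      congr 1
      conv_rhs => rw [← sum_counit_smul_right (ℛ F m)]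
      simp
    rw [h1, ← Coalgebra.coassoc_apply, h2]
    simp

theorem heisenbergRep_injective : Function.Injective (heisenbergRep F H) := by
  refine (injective_iff_map_eq_zero _).mpr fun t ht => ?_
  have h1 : dualTensorHom F H H (TensorProduct.comm F _ _ t) = 0 := by
    ext m
    rw [← heisenbergRep_recover, ht]
    simp
  have h2 : TensorProduct.comm F _ _ t = 0 :=
    (dualTensorHomEquiv F H H).injective (h1.trans (map_zero _).symm)
  exact (TensorProduct.comm F H H⋆).injective (h2.trans (map_zero _).symm)

/-- The Heisenberg double is linearly isomorphic to the endomorphisms of `H`. -/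
def heisenbergEquiv (F H : Type*) [Field F] [Ring H] [HopfAlgebra F H] [FiniteDimensional F H]
    [InvolutiveAntipode F H] : H ⊗[F] Module.Dual F H ≃ₗ[F] Module.End F H :=
  LinearMap.linearEquivOfInjective (heisenbergRep F H) heisenbergRep_injective
    (((TensorProduct.comm F H (Module.Dual F H)).trans (dualTensorHomEquiv F H H)).finrank_eq)

theorem heisenbergEquiv_tmul (y : H) (γ : H⋆) :
    heisenbergEquiv F H (y ⊗ₜ γ) = opL F H y * opRhoR F H γ := rfl

/-! ### The Drinfeld double is a Hopf algebra -/

/-- The action of the dual in a faithful representation of the double on `H ⊗ H`. -/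
def faithfulA (F H : Type*) [Field F] [Ring H] [HopfAlgebra F H] [FiniteDimensional F H]
    [InvolutiveAntipode F H] : Module.Dual F H →ₐ[F] Module.End F H ⊗[F] Module.End F H :=
  (Algebra.TensorProduct.map (opRhoR F H) (opRhoR F H)).comp
    (Bialgebra.comulAlgHom F (Module.Dual F H))

/-- The action of `H` in a faithful representation of the double on `H ⊗ H`. -/
def faithfulB (F H : Type*) [Field F] [Ring H] [HopfAlgebra F H] :
    H →ₐ[F] Module.End F H ⊗[F] Module.End F H :=
  (Algebra.TensorProduct.map (opR F H) (opL F H)).comp (Bialgebra.comulAlgHom F H)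

/-- The relation `A B = B A P` of an arriving edge end is preserved by algebra homomorphisms. -/
theorem comp_rel_arr {R R' : Type*} [Ring R] [Algebra F R] [Ring R'] [Algebra F R']
    {A : H⋆ →ₐ[F] R} {B : H →ₐ[F] R} (h : convA A * convB B = convB B * convA A * pair F H R)
    (φ : R →ₐ[F] R') :
    convA (φ.comp A) * convB (φ.comp B) = convB (φ.comp B) * convA (φ.comp A) * pair F H R' := by
  have h := congrArg (fun X => toConv (φ.toLinearMap ∘ₗ ofConv X)) h
  simpa only [comp_conv_mul, comp_pairConv, comp_convA, comp_convB] using h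

/-- The relation `A B = P⁻¹ B A` of a departing edge end is preserved by algebra homomorphisms. -/
theorem comp_rel_dep {R R' : Type*} [Ring R] [Algebra F R] [Ring R'] [Algebra F R']
    {A : H⋆ →ₐ[F] R} {B : H →ₐ[F] R} (h : convA A * convB B = pairInv F H R * (convB B * convA A))
    (φ : R →ₐ[F] R') :
    convA (φ.comp A) * convB (φ.comp B) = pairInv F H R' * (convB (φ.comp B) * convA (φ.comp A)) := by
  have h := congrArg (fun X => toConv (φ.toLinearMap ∘ₗ ofConv X)) h
  simpa only [comp_conv_mul, comp_pairConv, comp_convA, comp_convB] using h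

theorem commute_leg {R R' : Type*} [Ring R] [Algebra F R] [Ring R'] [Algebra F R'] (a : R) (b : R') :
    Commute ((Algebra.TensorProduct.includeLeft : R →ₐ[F] R ⊗[F] R') a)
      ((Algebra.TensorProduct.includeRight : R' →ₐ[F] R ⊗[F] R') b) := by
  simp [commute_iff_eq]

open Algebra.TensorProduct in
/-- Tensoring a representation for a departing edge end with one for an arriving edge end gives a
representation of the double. -/
theorem doubleRel_of_dep_arr {R R' : Type*} [Ring R] [Algebra F R] [Ring R'] [Algebra F R']
    {A : H⋆ →ₐ[F] R} {B : H →ₐ[F] R} (h : convA A * convB B = pairInv F H R * (convB B * convA A))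
    {A' : H⋆ →ₐ[F] R'} {B' : H →ₐ[F] R'}
    (h' : convA A' * convB B' = convB B' * convA A' * pair F H R') :
    DoubleRel ((Algebra.TensorProduct.map A A').comp (Bialgebra.comulAlgHom F H⋆))
      ((Algebra.TensorProduct.map B B').comp (Bialgebra.comulAlgHom F H)) := by
  rw [doubleRel_iff, convA_map_comul, convB_map_comul]
  have h1 := comp_rel_dep h (includeLeft : R →ₐ[F] R ⊗[F] R')
  have h2 := comp_rel_arr h' (includeRight : R' →ₐ[F] R ⊗[F] R')
  have c1 : Commute (convB ((includeLeft : R →ₐ[F] R ⊗[F] R').comp B))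
      (convA ((includeRight : R' →ₐ[F] R ⊗[F] R').comp A')) :=
    liftR_liftL_comm fun a b => (commute_leg _ _).symm
  have c2 : Commute (convB ((includeRight : R' →ₐ[F] R ⊗[F] R').comp B'))
      (convA ((includeLeft : R →ₐ[F] R ⊗[F] R').comp A)) :=
    liftR_liftL_comm fun a b => commute_leg _ _
  set a₁ := convA ((includeLeft : R →ₐ[F] R ⊗[F] R').comp A)
  set a₂ := convA ((includeRight : R' →ₐ[F] R ⊗[F] R').comp A')
  set b₁ := convB ((includeLeft : R →ₐ[F] R ⊗[F] R').comp B)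
  set b₂ := convB ((includeRight : R' →ₐ[F] R ⊗[F] R').comp B')
  calc a₁ * a₂ * (b₁ * b₂) = (a₁ * b₁) * (a₂ * b₂) := by
        rw [mul_assoc, ← mul_assoc a₂, ← c1.eq]; simp only [mul_assoc]
    _ = pairInv F H _ * (b₁ * a₁) * (b₂ * a₂ * pair F H _) := by rw [h1, h2]
    _ = pairInv F H _ * (b₁ * (a₁ * b₂) * a₂) * pair F H _ := by simp only [mul_assoc]
    _ = _ := by rw [← c2.eq]; simp only [mul_assoc]

theorem faithful_rel : DoubleRel (R := Module.End F H ⊗[F] Module.End F H)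
    (faithfulA F H) (faithfulB F H) :=
  doubleRel_of_dep_arr convA_mul_convB_opRhoR_opR convA_mul_convB_opRhoR_opL

/-- The straightening map of the double is invertible. -/
theorem straighten_inv (t : H⋆ ⊗[F] H) :
    (HopfMaps.of F H).straighten LinearMap.id.dualMap (antipode F (A := H)).dualMap (TensorProduct.comm F _ _
      ((HopfMaps.of F H).straighten (antipode F (A := H)).dualMap LinearMap.id.dualMap
        (TensorProduct.comm F _ _ t))) = t := by
  -- both maps are conjugations of the identity map by the pairing, in the convolution algebra of
  -- maps into the algebra `H⋆ ⊗ H`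
  let X : WithConv (H⋆ ⊗[F] H →ₗ[F] H⋆ ⊗[F] H) := toConv LinearMap.id
  have key : ∀ (Y : WithConv (H⋆ ⊗[F] H →ₗ[F] H⋆ ⊗[F] H)) (f g : H →ₗ[F] H) (t : H⋆ ⊗[F] H),
      Y ((HopfMaps.of F H).straighten f.dualMap g.dualMap (TensorProduct.comm F _ _ t))
        = (pairConv (H⋆ ⊗[F] H) f * (Y * pairConv (H⋆ ⊗[F] H) g)) t := by
    intro Y f g t
    induction t with
    | zero => simp
    | add a b ha hb => simp only [map_add, ha, hb]
    | tmul a b => exact comp_straighten Y f g a b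
  have h1 := key X LinearMap.id S ((HopfMaps.of F H).straighten (antipode F (A := H)).dualMap LinearMap.id.dualMap
        (TensorProduct.comm F _ _ t))
  have h2 := key (pairConv (H⋆ ⊗[F] H) LinearMap.id * (X * pairConv (H⋆ ⊗[F] H) S)) S LinearMap.id t
  have h3 : pairConv (H⋆ ⊗[F] H) S * (pairConv (H⋆ ⊗[F] H) LinearMap.id * (X * pairConv (H⋆ ⊗[F] H) S) * pairConv (H⋆ ⊗[F] H) LinearMap.id) = X := by
    simp only [mul_assoc]
    rw [pairConv_antipode_mul_id, ← mul_assoc, pairConv_antipode_mul_id, one_mul, mul_one]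
  rw [h3] at h2
  exact h1.trans h2

/-- The representation of the double on `H ⊗ H` is faithful: `B(h) A(α)` determines `α ⊗ h` as the
Heisenberg double acts faithfully on `H`, and `A(α) B(h)` is obtained from it by straightening. -/
theorem faithful_injective : Function.Injective (doubleMap (R := Module.End F H ⊗[F] Module.End F H) (faithfulA F H) (faithfulB F H)) := by
  -- evaluating the first leg at `1` and applying the counit recovers the operator of `z ⊗ δ`
  let ν : WithConv (H⋆ ⊗[F] H →ₗ[F] Module.End F H ⊗[F] Module.End F H) :=
    convB (R := Module.End F H ⊗[F] Module.End F H) (faithfulB F H)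
      * convA (R := Module.End F H ⊗[F] Module.End F H) (faithfulA F H)
  let ev : Module.End F H ⊗[F] Module.End F H →ₗ[F] Module.End F H :=
    (TensorProduct.lid F _).toLinearMap ∘ₗ
      (counit (R := F) ∘ₗ (LinearMap.applyₗ (1 : H) : Module.End F H →ₗ[F] H)).rTensor _
  have hev : ∀ (U V : Module.End F H), ev (U ⊗ₜ V) = counit (R := F) (U 1) • V := by
    intro U V
    simp [ev]
  have h1 : ∀ t : H⋆ ⊗[F] H, ev (ν t)
      = heisenbergRep F H (TensorProduct.comm F _ _ t) := by
    intro t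
    induction t with
    | zero => simp
    | add a b ha hb => simp only [map_add, ha, hb]
    | tmul α h =>
      simp only [ν]
      rw [liftR_mul_liftL_tmul, TensorProduct.comm_tmul, heisenbergRep_tmul]
      change ev (TensorProduct.map (opR F H).toLinearMap (opL F H).toLinearMap (comul h)
        * TensorProduct.map (opRhoR F H).toLinearMap (opRhoR F H).toLinearMap (comul α)) = _
      have h2 : ∀ (a : H) (β : H⋆), counit (R := F) ((opR F H a * opRhoR F H β) 1)
          = counit (R := F) a * counit (R := F) β := by
        intro a β
        have h3 : opRhoR F H β (1 : H) = β 1 • 1 := by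
          change leftHit β 1 = _
          simp [leftHit, Algebra.TensorProduct.one_def]
        rw [Module.End.mul_apply, h3, map_smul, opR_apply, one_mul, map_smul, counit_antipode,
          smul_eq_mul, mul_comm]
        rfl
      conv_lhs => rw [← (ℛ F h).eq, ← (ℛ F α).eq]
      conv_rhs => rw [← sum_counit_smul_right (ℛ F h), ← sum_counit_smul_right (ℛ F α)]
      simp only [map_sum, map_smul, Finset.sum_mul_sum, TensorProduct.map_tmul,
        Algebra.TensorProduct.tmul_mul_tmul]
      refine Finset.sum_congr rfl fun i _ => Finset.sum_congr rfl fun j _ => ?_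
      rw [hev]
      refine (congrArg (· • _) (h2 _ _)).trans ?_
      rw [smul_mul_smul_comm]
      rfl
  have h2 : Function.Injective ν.ofConv := by
    refine (injective_iff_map_eq_zero _).mpr fun t ht => ?_
    have h3 := h1 t
    have h4 : ν t = 0 := ht
    rw [h4, map_zero] at h3
    have h5 := heisenbergRep_injective (h3.symm.trans (map_zero _).symm)
    exact (TensorProduct.comm F H⋆ H).injective (h5.trans (map_zero _).symm)
  have h3 : ∀ t : H⋆ ⊗[F] H, doubleMap (R := Module.End F H ⊗[F] Module.End F H) (faithfulA F H) (faithfulB F H) t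
      = ν ((HopfMaps.of F H).straighten
        (antipode F (A := H)).dualMap LinearMap.id.dualMap (TensorProduct.comm F _ _ t)) := by
    intro t
    induction t with
    | zero => simp
    | add a b ha hb => simp only [map_add, ha, hb]
    | tmul a b =>
      rw [TensorProduct.comm_tmul]
      refine Eq.trans ?_ (comp_straighten (R := Module.End F H ⊗[F] Module.End F H) ν S LinearMap.id a b).symm
      have := doubleRel_iff.mp (faithful_rel (F := F) (H := H))
      rw [mul_assoc] at this
      exact congrArg (fun X => X (a ⊗ₜ b)) this
  intro x y hxy
  rw [h3, h3] at hxy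
  have h4 := h2 hxy
  rw [← straighten_inv x, h4, straighten_inv y]

end DualHopf

theorem AlgMaps.twisted_comm_mul {F A B : Type*} [Field F] [AddCommMonoid A] [Module F A]
    [AddCommMonoid B] [Module F B] (a : AlgMaps F A) (b : AlgMaps F B) (x x' : A) (y y' : B) :
    (a.twisted b (TensorProduct.comm F B A).toLinearMap).mul (x ⊗ₜ y) (x' ⊗ₜ y')
      = a.mul x x' ⊗ₜ b.mul y y' := by
  simp [AlgMaps.twisted, AlgMaps.mulT]

namespace DualHopf

open WithConv Coalgebra HopfAlgebra

variable {F H : Type*} [Field F] [Ring H] [HopfAlgebra F H] [FiniteDimensional F H]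
  [InvolutiveAntipode F H]

local notation "S" => antipode F (A := H)
local notation "H⋆" => Module.Dual F H
local notation "𝔻" => HopfMaps.drinfeldDouble (HopfMaps.of F H)
local notation "𝔼" => Module.End F H ⊗[F] Module.End F H

theorem doubleRel_counit :
    DoubleRel (Bialgebra.counitAlgHom F H⋆) (Bialgebra.counitAlgHom F H) := by
  have h1 : convA (Bialgebra.counitAlgHom F H⋆) = 1 := liftL_one
  have h2 : convB (Bialgebra.counitAlgHom F H) = 1 := liftR_one
  rw [DoubleRel, h1, h2, mul_one, mul_one, pair_mul_pairInv]

theorem doubleMap_counit (t : H⋆ ⊗[F] H) :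
    doubleMap (Bialgebra.counitAlgHom F H⋆) (Bialgebra.counitAlgHom F H) t = (𝔻).counit t := by
  induction t with
  | zero => simp
  | add a b ha hb => simp only [map_add, ha, hb]
  | tmul α h =>
    rw [doubleMap_tmul]
    rfl

theorem map_twisted_mul {D R : Type*} [AddCommMonoid D] [Module F D] [Ring R] [Algebra F R]
    (d : AlgMaps F D) (τ : D →ₗ[F] R) (hτ : ∀ x y, τ (d.mul x y) = τ x * τ y) (s t : D ⊗[F] D) :
    TensorProduct.map τ τ ((d.twisted d (TensorProduct.comm F D D).toLinearMap).mul s t)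
      = TensorProduct.map τ τ s * TensorProduct.map τ τ t := by
  induction s with
  | zero => simp
  | add a b ha hb => simp only [map_add, LinearMap.add_apply, ha, hb, add_mul]
  | tmul a b =>
    induction t with
    | zero => simp
    | add a b ha hb => simp only [map_add, ha, hb, mul_add]
    | tmul c d =>
      rw [AlgMaps.twisted_comm_mul]
      simp [hτ]

/-- The comultiplication `Δ` is multiplicative if `(τ ⊗ τ) ∘ Δ` is, for an injective multiplicative `τ`. -/
theorem comul_mul_of_injective {D R : Type*} [AddCommMonoid D] [Module F D] [Ring R] [Algebra F R]
    (d : HopfMaps F D) (τ : D →ₗ[F] R) (hτ : ∀ x y, τ (d.mul x y) = τ x * τ y)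
    (hinj : Function.Injective (TensorProduct.map τ τ)) (T : D →ₗ[F] R ⊗[F] R)
    (hT : ∀ t, TensorProduct.map τ τ (d.comul t) = T t) (hTmul : ∀ x y, T (d.mul x y) = T x * T y)
    (x y : D) : d.comul (d.mul x y)
      = (d.twisted d.toAlgMaps (TensorProduct.comm F D D).toLinearMap).mul (d.comul x) (d.comul y) := by
  apply hinj
  rw [map_twisted_mul d.toAlgMaps τ hτ, hT, hT, hT, hTmul]

/-- A faithful representation `τ` of the double shows that it is a Hopf algebra: products are compared
in the representation, coproducts in `τ ⊗ τ`, and `τ ∘ S` is the convolution inverse of `τ`. -/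
theorem isHopfAlgebra_of_injective {R : Type*} [Ring R] [Algebra F R] {A : H⋆ →ₐ[F] R}
    {B : H →ₐ[F] R} (hAB : DoubleRel A B) (hinj : Function.Injective (doubleMap A B)) :
    (𝔻).IsHopfAlgebra := by
  let τ : H⋆ ⊗[F] H →ₗ[F] R := doubleMap A B
  have hmul : ∀ x y, τ ((𝔻).mul x y) = τ x * τ y := doubleMap_mul hAB
  have hone : τ (𝔻).one = 1 := doubleMap_one _ _
  obtain ⟨hS1, hS2⟩ := doubleMap_conv_antipode hAB
  have hmulT : ∀ (f g : H⋆ ⊗[F] H →ₗ[F] H⋆ ⊗[F] H) (t : (H⋆ ⊗[F] H) ⊗[F] (H⋆ ⊗[F] H)),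
      τ ((𝔻).mulT (TensorProduct.map f g t))
        = LinearMap.mul' F R (TensorProduct.map (τ ∘ₗ f) (τ ∘ₗ g) t) := by
    intro f g t
    induction t with
    | zero => simp
    | add a b ha hb => simp only [map_add, ha, hb]
    | tmul a b => simpa [AlgMaps.mulT] using hmul _ _
  refine { mul_assoc := ?_, one_mul := ?_, mul_one := ?_, coassoc := ?_, counit_left := ?_,
           counit_right := ?_, comul_one := ?_, comul_mul := ?_, counit_one := ?_,
           counit_mul := ?_, antipode_left := ?_, antipode_right := ?_ }
  · intro x y z
    exact hinj (by rw [hmul, hmul, hmul, hmul, mul_assoc])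
  · intro x
    exact hinj (by rw [hmul]; rw [hone, one_mul])
  · intro x
    exact hinj (by rw [hmul]; rw [hone, mul_one])
  · intro x
    exact Coalgebra.coassoc_apply (R := F) x
  · intro x
    rw [drinfeldDouble_counit]
    refine (congrArg (TensorProduct.lid F (H⋆ ⊗[F] H)) (Coalgebra.rTensor_counit_comul (R := F) x)).trans ?_
    simp
  · intro x
    rw [drinfeldDouble_counit]
    refine (congrArg (TensorProduct.rid F (H⋆ ⊗[F] H)) (Coalgebra.lTensor_counit_comul (R := F) x)).trans ?_
    simp
  · have h1 : (𝔻).one = (1 : H⋆) ⊗ₜ (1 : H) := rfl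
    rw [h1, drinfeldDouble_comul, TensorProduct.comul_tmul, Bialgebra.comul_one,
      Bialgebra.comul_one]
    rfl
  · exact comul_mul_of_injective (R := R) (𝔻) τ hmul
      (TensorProduct.map_injective_of_flat_flat τ τ hinj hinj) _
      (fun t => (doubleMap_tensor A B A B t).symm) (doubleMap_mul (hAB.tensor hAB))
  · rw [← doubleMap_counit]
    exact doubleMap_one _ _
  · intro x y
    rw [← doubleMap_counit, ← doubleMap_counit, ← doubleMap_counit]
    exact doubleMap_mul doubleRel_counit x y
  · intro x
    apply hinj
    rw [hmulT, map_smul, hone, drinfeldDouble_counit]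
    refine (congrArg (fun X => X x) hS2).trans ?_
    rw [LinearMap.convOne_apply, Algebra.algebraMap_eq_smul_one]
  · intro x
    apply hinj
    rw [hmulT, map_smul, hone, drinfeldDouble_counit]
    refine (congrArg (fun X => X x) hS1).trans ?_
    rw [LinearMap.convOne_apply, Algebra.algebraMap_eq_smul_one]

/-- The Drinfeld double is a Hopf algebra. -/
theorem drinfeldDouble_isHopfAlgebra : (𝔻).IsHopfAlgebra :=
  isHopfAlgebra_of_injective faithful_rel faithful_injective

end DualHopf

/-! ### Tensor powers of Hopf algebras -/

section Pi

variable {F A B M : Type*} [Field F] [AddCommMonoid A] [Module F A] [AddCommMonoid B] [Module F B]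
  [AddCommMonoid M] [Module F M] {ι : Type*}

theorem AlgMaps.pi_mul_tprod (a : AlgMaps F A) (x y : ι → A) :
    (a.pi ι).mul (PiTensorProduct.tprod F x) (PiTensorProduct.tprod F y)
      = PiTensorProduct.tprod F fun i => a.mul (x i) (y i) :=
  PiTensorProduct.map₂_tprod_tprod _ _ _

/-- Linear maps out of a tensor power are determined on pure tensors. -/
theorem PiTensorProduct.induction_linear {f g : (⨂[F] _ : ι, A) →ₗ[F] M}
    (h : ∀ x, f (PiTensorProduct.tprod F x) = g (PiTensorProduct.tprod F x)) (x : ⨂[F] _ : ι, A) :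
    f x = g x := by
  have : f = g := PiTensorProduct.ext (MultilinearMap.ext h)
  rw [this]

theorem AlgMaps.IsAlgebra.pi {a : AlgMaps F A} (ha : a.IsAlgebra) : (a.pi ι).IsAlgebra where
  mul_assoc x y z := by
    induction x using PiTensorProduct.induction_on with
    | add x₁ x₂ h₁ h₂ => simp only [map_add, LinearMap.add_apply, h₁, h₂]
    | smul_tprod r x =>
      induction y using PiTensorProduct.induction_on with
      | add x₁ x₂ h₁ h₂ => simp only [map_add, LinearMap.add_apply, h₁, h₂]
      | smul_tprod s y =>
        induction z using PiTensorProduct.induction_on with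
        | add x₁ x₂ h₁ h₂ => simp only [map_add, h₁, h₂]
        | smul_tprod t z =>
          simp only [map_smul, LinearMap.smul_apply, AlgMaps.pi_mul_tprod, ha.mul_assoc]
  one_mul x := by
    refine PiTensorProduct.induction_linear (f := (a.pi ι).mul (a.pi ι).one) (g := LinearMap.id)
      (fun x => ?_) x
    refine (AlgMaps.pi_mul_tprod a _ _).trans ?_
    simp only [ha.one_mul, LinearMap.id_apply]
  mul_one x := by
    refine PiTensorProduct.induction_linear (f := (a.pi ι).mul.flip (a.pi ι).one)
      (g := LinearMap.id) (fun x => ?_) x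
    refine (AlgMaps.pi_mul_tprod a _ _).trans ?_
    simp only [ha.mul_one, LinearMap.id_apply]

theorem AlgMaps.op_pi_mul (a : AlgMaps F A) (x y : ⨂[F] _ : ι, A) :
    (a.op.pi ι).mul x y = (a.pi ι).mul y x := by
  induction x using PiTensorProduct.induction_on with
  | add x₁ x₂ h₁ h₂ => simp only [map_add, LinearMap.add_apply, h₁, h₂]
  | smul_tprod r x =>
    induction y using PiTensorProduct.induction_on with
    | add x₁ x₂ h₁ h₂ => simp only [map_add, LinearMap.add_apply, h₁, h₂]
    | smul_tprod s y =>
      simp only [map_smul, LinearMap.smul_apply, AlgMaps.pi_mul_tprod]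
      rw [smul_comm]
      rfl

theorem AlgMaps.op_pi (a : AlgMaps F A) : a.op.pi ι = (a.pi ι).op := by
  have h : (a.op.pi ι).mul = (a.pi ι).op.mul := by
    apply LinearMap.ext
    intro x
    apply LinearMap.ext
    intro y
    exact a.op_pi_mul x y
  have h' : (a.op.pi ι).one = (a.pi ι).op.one := rfl
  cases h1 : a.op.pi ι
  cases h2 : (a.pi ι).op
  simp_all

/-- Multilinear maps on tensor products are determined on families of pure tensors. -/
theorem MultilinearMap.ext_tmul [Module.Free F A] [Module.Free F B] [Finite ι]
    {f g : MultilinearMap F (fun _ : ι => A ⊗[F] B) M}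
    (h : ∀ (a : ι → A) (b : ι → B), f (fun i => a i ⊗ₜ b i) = g (fun i => a i ⊗ₜ b i))
    (t : ι → A ⊗[F] B) : f t = g t := by
  have : f = g := by
    refine Module.Basis.ext_multilinear (fun _ => (Module.Free.chooseBasis F A).tensorProduct
      (Module.Free.chooseBasis F B)) fun v => ?_
    simp only [Module.Basis.tensorProduct_apply']
    exact h _ _
  rw [this]

variable [Fintype ι]

variable [Module.Free F A]

theorem HopfMaps.pi_comul_tprod (h : HopfMaps F A) (x : ι → A) :
    (h.pi ι).comul (PiTensorProduct.tprod F x)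
      = unzip ι F A A (PiTensorProduct.tprod F fun i => h.comul (x i)) := by
  simp [HopfMaps.pi]

theorem HopfMaps.pi_counit_tprod (h : HopfMaps F A) (x : ι → A) :
    (h.pi ι).counit (PiTensorProduct.tprod F x) = ∏ i, h.counit (x i) := by
  simp [HopfMaps.pi, PiTensorProduct.constantBaseRingEquiv_tprod]

theorem HopfMaps.pi_antipode_tprod (h : HopfMaps F A) (x : ι → A) :
    (h.pi ι).antipode (PiTensorProduct.tprod F x)
      = PiTensorProduct.tprod F fun i => h.antipode (x i) := by
  simp [HopfMaps.pi]

theorem PiTensorProduct.tprod_smul (c : ι → F) (x : ι → A) :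
    PiTensorProduct.tprod F (fun i => c i • x i) = (∏ i, c i) • PiTensorProduct.tprod F x :=
  MultilinearMap.map_smul_univ _ _ _

theorem HopfMaps.pi_mulT_map (h : HopfMaps F A) (f g : A →ₗ[F] A) (t : ι → A ⊗[F] A) :
    (h.pi ι).mulT (TensorProduct.map (PiTensorProduct.map fun _ => f) (PiTensorProduct.map fun _ => g)
      (unzip ι F A A (PiTensorProduct.tprod F t)))
      = PiTensorProduct.tprod F fun i => h.mulT (TensorProduct.map f g (t i)) := by
  refine MultilinearMap.ext_tmul
    (f := ((h.pi ι).mulT ∘ₗ TensorProduct.map (PiTensorProduct.map fun _ => f)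
      (PiTensorProduct.map fun _ => g) ∘ₗ unzip ι F A A).compMultilinearMap (PiTensorProduct.tprod F))
    (g := (PiTensorProduct.tprod F).compLinearMap
      fun _ => h.mulT ∘ₗ TensorProduct.map f g) (fun a b => ?_) t
  simp only [LinearMap.compMultilinearMap_apply, LinearMap.comp_apply, unzip_tprod,
    TensorProduct.map_tmul, PiTensorProduct.map_tprod, MultilinearMap.compLinearMap_apply]
  exact AlgMaps.pi_mul_tprod _ _ _

theorem HopfMaps.pi_twisted_mul (h : HopfMaps F A) (s t : ι → A ⊗[F] A) :
    ((h.pi ι).twisted (h.pi ι).toAlgMaps (TensorProduct.comm F _ _).toLinearMap).mul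
      (unzip ι F A A (PiTensorProduct.tprod F s)) (unzip ι F A A (PiTensorProduct.tprod F t))
      = unzip ι F A A (PiTensorProduct.tprod F fun i =>
        (h.twisted h.toAlgMaps (TensorProduct.comm F A A).toLinearMap).mul (s i) (t i)) := by
  let μ := ((h.pi ι).twisted (h.pi ι).toAlgMaps (TensorProduct.comm F _ _).toLinearMap).mul
  let ν := (h.twisted h.toAlgMaps (TensorProduct.comm F A A).toLinearMap).mul
  let U := unzip ι F A A
  have h1 : ∀ (a b : ι → A), μ (U (PiTensorProduct.tprod F fun i => a i ⊗ₜ b i)) (U (PiTensorProduct.tprod F t))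
      = U (PiTensorProduct.tprod F fun i => ν (a i ⊗ₜ b i) (t i)) := by
    intro a b
    refine MultilinearMap.ext_tmul
      (f := (μ (U (PiTensorProduct.tprod F fun i => a i ⊗ₜ b i)) ∘ₗ U).compMultilinearMap
        (PiTensorProduct.tprod F))
      (g := (U.compMultilinearMap (PiTensorProduct.tprod F)).compLinearMap
        fun i => ν (a i ⊗ₜ b i)) (fun c d => ?_) t
    simp only [LinearMap.compMultilinearMap_apply, LinearMap.comp_apply,
      MultilinearMap.compLinearMap_apply, U, unzip_tprod, μ, ν, AlgMaps.twisted_comm_mul]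
    exact congrArg₂ (· ⊗ₜ[F] ·) (AlgMaps.pi_mul_tprod _ _ _) (AlgMaps.pi_mul_tprod _ _ _)
  exact MultilinearMap.ext_tmul
    (f := (μ.flip (U (PiTensorProduct.tprod F t)) ∘ₗ U).compMultilinearMap (PiTensorProduct.tprod F))
    (g := (U.compMultilinearMap (PiTensorProduct.tprod F)).compLinearMap
      fun i => ν.flip (t i)) h1 s

theorem HopfMaps.pi_coassoc_left (h : HopfMaps F A) (t : ι → A ⊗[F] A) :
    TensorProduct.assoc F _ _ _ (TensorProduct.map (h.pi ι).comul LinearMap.id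
      (unzip ι F A A (PiTensorProduct.tprod F t)))
      = TensorProduct.map LinearMap.id (unzip ι F A A) (unzip ι F A (A ⊗[F] A)
        (PiTensorProduct.tprod F fun i => TensorProduct.assoc F A A A
          (TensorProduct.map h.comul LinearMap.id (t i)))) := by
  let P := TensorProduct.map (LinearMap.id (R := F) (M := ⨂[F] _ : ι, A)) (unzip ι F A A) ∘ₗ unzip ι F A (A ⊗[F] A)
  have h1 : ∀ (b : ι → A) (s : ι → A ⊗[F] A), TensorProduct.assoc F _ _ _
      (unzip ι F A A (PiTensorProduct.tprod F s) ⊗ₜ[F] PiTensorProduct.tprod F b)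
      = P (PiTensorProduct.tprod F fun i => TensorProduct.assoc F A A A (s i ⊗ₜ b i)) := by
    intro b s
    refine MultilinearMap.ext_tmul
      (f := ((TensorProduct.assoc F _ _ _).toLinearMap ∘ₗ (TensorProduct.mk F _ _).flip
        (PiTensorProduct.tprod F b) ∘ₗ unzip ι F A A).compMultilinearMap (PiTensorProduct.tprod F))
      (g := (P.compMultilinearMap (PiTensorProduct.tprod F)).compLinearMap
        fun i => (TensorProduct.assoc F A A A).toLinearMap ∘ₗ (TensorProduct.mk F _ _).flip (b i))
      (fun c d => ?_) s
    simp [P, unzip_tprod]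
  refine MultilinearMap.ext_tmul
    (f := ((TensorProduct.assoc F _ _ _).toLinearMap ∘ₗ TensorProduct.map (h.pi ι).comul LinearMap.id
      ∘ₗ unzip ι F A A).compMultilinearMap (PiTensorProduct.tprod F))
    (g := (P.compMultilinearMap (PiTensorProduct.tprod F)).compLinearMap
      fun i => (TensorProduct.assoc F A A A).toLinearMap ∘ₗ TensorProduct.map h.comul LinearMap.id)
    (fun a b => ?_) t
  have h2 := h1 b (fun i => h.comul (a i))
  simpa [unzip_tprod, HopfMaps.pi_comul_tprod] using h2

theorem HopfMaps.pi_coassoc_right (h : HopfMaps F A) (t : ι → A ⊗[F] A) :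
    TensorProduct.map LinearMap.id (h.pi ι).comul (unzip ι F A A (PiTensorProduct.tprod F t))
      = TensorProduct.map LinearMap.id (unzip ι F A A) (unzip ι F A (A ⊗[F] A)
        (PiTensorProduct.tprod F fun i => TensorProduct.map LinearMap.id h.comul (t i))) := by
  refine MultilinearMap.ext_tmul
    (f := (TensorProduct.map LinearMap.id (h.pi ι).comul
      ∘ₗ unzip ι F A A).compMultilinearMap (PiTensorProduct.tprod F))
    (g := ((TensorProduct.map LinearMap.id (unzip ι F A A) ∘ₗ unzip ι F A (A ⊗[F] A)).compMultilinearMap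
      (PiTensorProduct.tprod F)).compLinearMap fun i => TensorProduct.map LinearMap.id h.comul)
    (fun a b => ?_) t
  simp [unzip_tprod, HopfMaps.pi_comul_tprod]

theorem HopfMaps.pi_comul_mul_tprod {h : HopfMaps F A} (hh : h.IsHopfAlgebra) (x y : ι → A) :
    (h.pi ι).comul ((h.pi ι).mul (PiTensorProduct.tprod F x) (PiTensorProduct.tprod F y))
      = ((h.pi ι).twisted (h.pi ι).toAlgMaps (TensorProduct.comm F _ _).toLinearMap).mul
        ((h.pi ι).comul (PiTensorProduct.tprod F x))
        ((h.pi ι).comul (PiTensorProduct.tprod F y)) := by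
  refine (congrArg (h.pi ι).comul (AlgMaps.pi_mul_tprod _ _ _)).trans ?_
  rw [HopfMaps.pi_comul_tprod, HopfMaps.pi_comul_tprod, HopfMaps.pi_comul_tprod,
    HopfMaps.pi_twisted_mul]
  exact congrArg (fun t => unzip ι F A A (PiTensorProduct.tprod F t))
    (funext fun i => hh.comul_mul (x i) (y i))

/-- A tensor power of a Hopf algebra is a Hopf algebra. -/
theorem HopfMaps.IsHopfAlgebra.pi {h : HopfMaps F A} (hh : h.IsHopfAlgebra) :
    (h.pi ι).IsHopfAlgebra where
  toIsAlgebra := hh.toIsAlgebra.pi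
  coassoc x := by
    refine PiTensorProduct.induction_linear
      (f := (TensorProduct.assoc F _ _ _).toLinearMap ∘ₗ TensorProduct.map (h.pi ι).comul LinearMap.id
        ∘ₗ (h.pi ι).comul)
      (g := TensorProduct.map LinearMap.id (h.pi ι).comul ∘ₗ (h.pi ι).comul) (fun x => ?_) x
    simp only [LinearMap.comp_apply, LinearEquiv.coe_coe, HopfMaps.pi_comul_tprod]
    rw [HopfMaps.pi_coassoc_left, HopfMaps.pi_coassoc_right]
    simp only [hh.coassoc]
  counit_left x := by
    have h1 : ∀ t : ι → A ⊗[F] A, TensorProduct.lid F _ (TensorProduct.map (h.pi ι).counit LinearMap.id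
        (unzip ι F A A (PiTensorProduct.tprod F t)))
        = PiTensorProduct.tprod F fun i => TensorProduct.lid F A
          (TensorProduct.map h.counit LinearMap.id (t i)) := by
      refine MultilinearMap.ext_tmul
        (f := ((TensorProduct.lid F _).toLinearMap ∘ₗ TensorProduct.map (h.pi ι).counit LinearMap.id
          ∘ₗ unzip ι F A A).compMultilinearMap (PiTensorProduct.tprod F))
        (g := (PiTensorProduct.tprod F).compLinearMap fun i => (TensorProduct.lid F A).toLinearMap
          ∘ₗ TensorProduct.map h.counit LinearMap.id) (fun a b => ?_)
      simp [unzip_tprod, HopfMaps.pi_counit_tprod, PiTensorProduct.tprod_smul]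
    refine PiTensorProduct.induction_linear
      (f := (TensorProduct.lid F _).toLinearMap ∘ₗ TensorProduct.map (h.pi ι).counit LinearMap.id
        ∘ₗ (h.pi ι).comul) (g := LinearMap.id) (fun x => ?_) x
    simp only [LinearMap.comp_apply, LinearEquiv.coe_coe, HopfMaps.pi_comul_tprod, h1,
      hh.counit_left, LinearMap.id_apply]
  counit_right x := by
    have h1 : ∀ t : ι → A ⊗[F] A, TensorProduct.rid F _ (TensorProduct.map LinearMap.id (h.pi ι).counit
        (unzip ι F A A (PiTensorProduct.tprod F t)))
        = PiTensorProduct.tprod F fun i => TensorProduct.rid F A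
          (TensorProduct.map LinearMap.id h.counit (t i)) := by
      refine MultilinearMap.ext_tmul
        (f := ((TensorProduct.rid F _).toLinearMap ∘ₗ TensorProduct.map LinearMap.id (h.pi ι).counit
          ∘ₗ unzip ι F A A).compMultilinearMap (PiTensorProduct.tprod F))
        (g := (PiTensorProduct.tprod F).compLinearMap fun i => (TensorProduct.rid F A).toLinearMap
          ∘ₗ TensorProduct.map LinearMap.id h.counit) (fun a b => ?_)
      simp [unzip_tprod, HopfMaps.pi_counit_tprod, PiTensorProduct.tprod_smul]
    refine PiTensorProduct.induction_linear
      (f := (TensorProduct.rid F _).toLinearMap ∘ₗ TensorProduct.map LinearMap.id (h.pi ι).counit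
        ∘ₗ (h.pi ι).comul) (g := LinearMap.id) (fun x => ?_) x
    simp only [LinearMap.comp_apply, LinearEquiv.coe_coe, HopfMaps.pi_comul_tprod, h1,
      hh.counit_right, LinearMap.id_apply]
  comul_one := by
    refine (HopfMaps.pi_comul_tprod h _).trans ?_
    simp only [hh.comul_one]
    exact unzip_tprod ι _ _
  comul_mul x y := by
    induction x using PiTensorProduct.induction_on with
    | add x₁ x₂ h₁ h₂ => simp only [map_add, LinearMap.add_apply, h₁, h₂]
    | smul_tprod r x =>
      induction y using PiTensorProduct.induction_on with
      | add x₁ x₂ h₁ h₂ => simp only [map_add, h₁, h₂]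
      | smul_tprod s y =>
        have h1 := HopfMaps.pi_comul_mul_tprod hh x y
        simp only [map_smul, LinearMap.smul_apply]
        rw [← h1]
  counit_one := by
    refine (HopfMaps.pi_counit_tprod h _).trans ?_
    simp only [hh.counit_one, Finset.prod_const_one]
  counit_mul x y := by
    induction x using PiTensorProduct.induction_on with
    | add x₁ x₂ h₁ h₂ => simp only [map_add, LinearMap.add_apply, h₁, h₂, add_mul]
    | smul_tprod r x =>
      induction y using PiTensorProduct.induction_on with
      | add x₁ x₂ h₁ h₂ => simp only [map_add, h₁, h₂, mul_add]
      | smul_tprod s y =>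
        have h1 : (h.pi ι).counit ((h.pi ι).mul (PiTensorProduct.tprod F x) (PiTensorProduct.tprod F y))
            = (h.pi ι).counit (PiTensorProduct.tprod F x) * (h.pi ι).counit (PiTensorProduct.tprod F y) := by
          rw [HopfMaps.pi_counit_tprod, HopfMaps.pi_counit_tprod, ← Finset.prod_mul_distrib]
          refine (congrArg (h.pi ι).counit (AlgMaps.pi_mul_tprod _ _ _)).trans ?_
          simp only [HopfMaps.pi_counit_tprod, hh.counit_mul]
        simp only [map_smul, LinearMap.smul_apply, h1, smul_eq_mul]
        ring
  antipode_left x := by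
    refine PiTensorProduct.induction_linear
      (f := (h.pi ι).mulT ∘ₗ TensorProduct.map (h.pi ι).antipode LinearMap.id ∘ₗ (h.pi ι).comul)
      (g := (h.pi ι).counit.smulRight (h.pi ι).one) (fun x => ?_) x
    simp only [LinearMap.comp_apply, HopfMaps.pi_comul_tprod, LinearMap.smulRight_apply,
      HopfMaps.pi_counit_tprod]
    have h1 := HopfMaps.pi_mulT_map h h.antipode LinearMap.id (fun i => h.comul (x i))
    rw [PiTensorProduct.map_id] at h1
    refine h1.trans ?_
    simp only [hh.antipode_left]
    exact PiTensorProduct.tprod_smul _ _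
  antipode_right x := by
    refine PiTensorProduct.induction_linear
      (f := (h.pi ι).mulT ∘ₗ TensorProduct.map LinearMap.id (h.pi ι).antipode ∘ₗ (h.pi ι).comul)
      (g := (h.pi ι).counit.smulRight (h.pi ι).one) (fun x => ?_) x
    simp only [LinearMap.comp_apply, HopfMaps.pi_comul_tprod, LinearMap.smulRight_apply,
      HopfMaps.pi_counit_tprod]
    have h1 := HopfMaps.pi_mulT_map h LinearMap.id h.antipode (fun i => h.comul (x i))
    rw [PiTensorProduct.map_id] at h1
    refine h1.trans ?_
    simp only [hh.antipode_right]
    exact PiTensorProduct.tprod_smul _ _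

end Pi

/-! ### The adjoint action along an algebra homomorphism -/

/-- The multiplication and the unit of a Mathlib algebra. -/
def AlgMaps.ofRing (F R : Type*) [Field F] [Ring R] [Algebra F R] : AlgMaps F R where
  mul := LinearMap.mul F R
  one := 1

section Adjoint

open WithConv Coalgebra HopfAlgebra

variable {F D R : Type*} [Field F] [Ring D] [HopfAlgebra F D] [InvolutiveAntipode F D]
  [Ring R] [Algebra F R]

/-- The right adjoint action `X ◁ k = τ(S(k₂)) X τ(k₁)` along `τ`. -/
def adjointAct (τ : D →ₐ[F] R) : R →ₗ[F] D →ₗ[F] R :=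
  LinearMap.mk₂ F (fun X k => (AlgMaps.ofRing F R).sandwich (τ.toLinearMap ∘ₗ antipode F)
      τ.toLinearMap X (TensorProduct.comm F D D (comul k)))
    (fun X Y k => by
      generalize TensorProduct.comm F D D (comul k) = t
      induction t with
      | zero => simp
      | add a b ha hb => simp only [map_add, ha, hb]; abel
      | tmul a b => simp [AlgMaps.sandwich, AlgMaps.ofRing])
    (fun c X k => by
      generalize TensorProduct.comm F D D (comul k) = t
      induction t with
      | zero => simp
      | add a b ha hb => simp only [map_add, ha, hb, smul_add]
      | tmul a b => simp [AlgMaps.sandwich, AlgMaps.ofRing])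
    (fun X k l => by simp only [map_add])
    (fun c X k => by simp only [map_smul])

theorem adjointAct_apply (τ : D →ₐ[F] R) (X : R) (k : D) : adjointAct τ X k
    = (AlgMaps.ofRing F R).sandwich (τ.toLinearMap ∘ₗ antipode F)
      τ.toLinearMap X (TensorProduct.comm F D D (comul k)) := rfl

theorem adjointAct_repr (τ : D →ₐ[F] R) (X : R) {k : D} {ι : Type*} (r : Coalgebra.Repr F k ι) :
    adjointAct τ X k
      = ∑ i ∈ r.index, τ (antipode F (r.right i)) * X * τ (r.left i) := by
  rw [adjointAct_apply, ← r.eq]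
  simp [AlgMaps.sandwich, AlgMaps.ofRing]

theorem adjointAct_one_left (τ : D →ₐ[F] R) (k : D) :
    adjointAct τ 1 k = counit (R := F) k • 1 := by
  rw [adjointAct_repr τ 1 (ℛ F k)]
  simp only [mul_one, ← map_mul, ← map_sum]
  rw [DualHopf.sum_antipode_right_mul_left, map_smul, map_one]

theorem adjointAct_one_right (τ : D →ₐ[F] R) (X : R) : adjointAct τ X 1 = X := by
  rw [adjointAct_apply, Bialgebra.comul_one, Algebra.TensorProduct.one_def]
  simp [AlgMaps.sandwich, AlgMaps.ofRing]

theorem adjointAct_mul_right (τ : D →ₐ[F] R) (X : R) (k l : D) :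
    adjointAct τ X (k * l) = adjointAct τ (adjointAct τ X k) l := by
  rw [adjointAct_repr τ X (DualHopf.reprMul (ℛ F k) (ℛ F l)), adjointAct_repr τ _ (ℛ F l),
    adjointAct_repr τ X (ℛ F k)]
  simp only [DualHopf.reprMul, antipode_mul_antidistrib, map_mul, Finset.sum_product,
    Finset.mul_sum, Finset.sum_mul]
  rw [Finset.sum_comm]
  simp only [mul_assoc]

open MulOpposite in
theorem adjointAct_mul_left (τ : D →ₐ[F] R) (X Y : R) {k : D} {ι : Type*}
    (r : Coalgebra.Repr F k ι) : adjointAct τ (Y * X) k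
      = ∑ i ∈ r.index, adjointAct τ Y (r.right i) * adjointAct τ X (r.left i) := by
  -- In the convolution algebra of maps into `Rᵐᵒᵖ` the action on `X` is `t X s` with `s t = 1`.
  let o : R ≃ₗ[F] Rᵐᵒᵖ := opLinearEquiv F
  let t : WithConv (D →ₗ[F] Rᵐᵒᵖ) := toConv (o.toLinearMap ∘ₗ τ.toLinearMap)
  let s : WithConv (D →ₗ[F] Rᵐᵒᵖ) := toConv (o.toLinearMap ∘ₗ τ.toLinearMap ∘ₗ antipode F)
  let c : R → WithConv (D →ₗ[F] Rᵐᵒᵖ) := fun X => toConv (counit.smulRight (op X))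
  have hst : s * t = 1 := by
    apply WithConv.ext
    ext x
    change (s * t) x = (1 : WithConv (D →ₗ[F] Rᵐᵒᵖ)) x
    rw [(ℛ F x).convMul_apply, LinearMap.convOne_apply, Algebra.algebraMap_eq_smul_one]
    change ∑ i ∈ (ℛ F x).index, op (τ (antipode F ((ℛ F x).left i))) * op (τ ((ℛ F x).right i)) = _
    simp only [← op_mul, ← map_mul]
    rw [← Finset.op_sum, ← map_sum, DualHopf.sum_right_mul_antipode_left, map_smul, map_one]
    rfl
  have hc : c X * c Y = c (Y * X) := by
    apply WithConv.ext
    ext x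
    change (c X * c Y) x = c (Y * X) x
    rw [conv_const_mul]
    change op X * (counit (R := F) x • op Y) = counit (R := F) x • op (Y * X)
    rw [mul_smul_comm, op_mul]
  have hact : ∀ Z, t * (c Z * s) = toConv (o.toLinearMap ∘ₗ adjointAct τ Z) := by
    intro Z
    apply WithConv.ext
    ext x
    change (t * (c Z * s)) x = op (adjointAct τ Z x)
    rw [(ℛ F x).convMul_apply, adjointAct_repr τ Z (ℛ F x), Finset.op_sum]
    refine Finset.sum_congr rfl fun i _ => ?_
    rw [conv_const_mul]
    change op (τ _) * (op Z * op (τ (antipode F _))) = _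
    rw [← op_mul, ← op_mul]
  have h1 : t * (c (Y * X) * s) = (t * (c X * s)) * (t * (c Y * s)) := by
    have e : ∀ Z : WithConv (D →ₗ[F] Rᵐᵒᵖ), s * (t * Z) = Z := fun Z => by
      rw [← mul_assoc, hst, one_mul]
    simp only [mul_assoc]
    rw [e, ← mul_assoc (c X), hc]
  rw [hact, hact, hact] at h1
  have h2 := congrArg (fun f : WithConv (D →ₗ[F] Rᵐᵒᵖ) => f k) h1
  simp only [r.convMul_apply] at h2
  have h3 := congrArg unop h2
  rw [Finset.unop_sum] at h3
  exact h3

/-- The adjoint action is a module algebra structure for the opposite product. The order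
`τ(S(k₂)) X τ(k₁)` requires `S(k₂) k₁ = ε(k)`, which holds as the antipode is an involution. -/
theorem adjointAct_isRightModuleAlgebra (τ : D →ₐ[F] R) :
    IsRightModuleAlgebra (HopfMaps.of F D) (AlgMaps.ofRing F R).op (adjointAct τ) where
  act_one := adjointAct_one_right τ
  act_mul := adjointAct_mul_right τ
  mul_act X Y k := by
    refine (adjointAct_mul_left τ X Y (ℛ F k)).trans ?_
    change _ = (AlgMaps.ofRing F R).op.mulT (TensorProduct.map _ _ (comul k))
    conv_rhs => rw [← (ℛ F k).eq]
    simp [AlgMaps.mulT, AlgMaps.op, AlgMaps.ofRing]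
  one_act := adjointAct_one_left τ

end Adjoint

/-! ### Mathlib structures from structure maps -/

section Carrier

variable {F A B : Type*} [Field F] [AddCommMonoid A] [Module F A] [AddCommMonoid B] [Module F B]

/-- The vector space underlying an algebra given by structure maps, as a carrier of Mathlib's
algebra structure. -/
@[nolint unusedArguments]
def AlgMaps.IsAlgebra.Carrier {a : AlgMaps F A} (_ : a.IsAlgebra) : Type _ := A

namespace AlgMaps.IsAlgebra

variable {a : AlgMaps F A} (ha : a.IsAlgebra)

instance instRing : Ring ha.Carrier where
  __ := Module.addCommMonoidToAddCommGroup F (M := A)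
  mul x y := a.mul x y
  one := a.one
  mul_assoc := ha.mul_assoc
  one_mul := ha.one_mul
  mul_one := ha.mul_one
  zero_mul x := LinearMap.map_zero₂ a.mul x
  mul_zero x := (a.mul x).map_zero
  left_distrib x y z := (a.mul x).map_add y z
  right_distrib x y z := LinearMap.map_add₂ a.mul x y z

instance instModule : Module F ha.Carrier := inferInstanceAs (Module F A)

instance instAlgebra : Algebra F ha.Carrier :=
  Algebra.ofModule (fun r x y => LinearMap.map_smul₂ a.mul r x y) (fun r x y => (a.mul x).map_smul r y)

end AlgMaps.IsAlgebra

namespace HopfMaps.IsHopfAlgebra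

variable {h : HopfMaps F A} (hh : h.IsHopfAlgebra)

/-- The vector space underlying a Hopf algebra given by structure maps, as a carrier of Mathlib's
Hopf algebra structure. -/
@[nolint unusedArguments]
def Carrier {h : HopfMaps F A} (_ : h.IsHopfAlgebra) : Type _ := A

instance instRing : Ring hh.Carrier := inferInstanceAs (Ring hh.toIsAlgebra.Carrier)

instance instAlgebra : Algebra F hh.Carrier := inferInstanceAs (Algebra F hh.toIsAlgebra.Carrier)

instance : Coalgebra F hh.Carrier where
  comul := h.comul
  counit := h.counit
  coassoc := LinearMap.ext hh.coassoc
  rTensor_counit_comp_comul := LinearMap.ext fun x => by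
    apply (TensorProduct.lid F A).injective
    exact (hh.counit_left x).trans (one_smul F (show A from x)).symm
  lTensor_counit_comp_comul := LinearMap.ext fun x => by
    apply (TensorProduct.rid F A).injective
    exact (hh.counit_right x).trans (one_smul F (show A from x)).symm

theorem twisted_mul_eq (s t : hh.Carrier ⊗[F] hh.Carrier) :
    (h.twisted h.toAlgMaps (TensorProduct.comm F A A).toLinearMap).mul s t = s * t := by
  induction s with
  | zero => exact (LinearMap.map_zero₂ _ _).trans (zero_mul t).symm
  | add a b ha hb =>
    exact (LinearMap.map_add₂ _ _ _ _).trans ((congrArg₂ (· + ·) ha hb).trans (add_mul a b t).symm)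
  | tmul a b =>
    induction t with
    | zero =>
      exact (LinearMap.map_zero _).trans (mul_zero (M₀ := hh.Carrier ⊗[F] hh.Carrier) (a ⊗ₜ b)).symm
    | add c d hc hd =>
      exact (LinearMap.map_add _ _ _).trans ((congrArg₂ (· + ·) hc hd).trans (mul_add _ c d).symm)
    | tmul c d =>
      rw [Algebra.TensorProduct.tmul_mul_tmul]
      exact AlgMaps.twisted_comm_mul _ _ _ _ _ _

instance instBialgebra : Bialgebra F hh.Carrier :=
  Bialgebra.mk' F hh.Carrier hh.counit_one (fun {x y} => hh.counit_mul x y)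
    hh.comul_one (fun {x y} =>
      (hh.comul_mul x y).trans (twisted_mul_eq hh (h.comul x) (h.comul y)))

instance instHopfAlgebra : HopfAlgebra F hh.Carrier where
  antipode := h.antipode
  mul_antipode_rTensor_comul := LinearMap.ext hh.antipode_left
  mul_antipode_lTensor_comul := LinearMap.ext hh.antipode_right

theorem antipode_mul {h : HopfMaps F A} (hh : h.IsHopfAlgebra) (x y : A) : h.antipode (h.mul x y) = h.mul (h.antipode y) (h.antipode x) :=
  HopfAlgebra.antipode_mul_antidistrib (R := F) (A := hh.Carrier) x y

theorem antipode_one {h : HopfMaps F A} (hh : h.IsHopfAlgebra) : h.antipode h.one = h.one :=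
  HopfAlgebra.antipode_one (R := F) (A := hh.Carrier)
end HopfMaps.IsHopfAlgebra

/-- The adjoint action along an algebra homomorphism, for algebras given by structure maps. -/
theorem exists_isRightModuleAlgebra {h : HopfMaps F A} (hh : h.IsHopfAlgebra)
    (hS : ∀ x, h.antipode (h.antipode x) = x) {b : AlgMaps F B} (hb : b.IsAlgebra)
    {τ : A →ₗ[F] B} (hτ : h.IsAlgHom b τ) : ∃ act : B →ₗ[F] A →ₗ[F] B,
      IsRightModuleAlgebra h b.op act ∧ ∀ X k, act X k
        = b.sandwich (τ ∘ₗ h.antipode) τ X (TensorProduct.comm F A A (h.comul k)) := by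
  have : InvolutiveAntipode F hh.Carrier := ⟨hS⟩
  let τ' : hh.Carrier →ₐ[F] hb.Carrier :=
    AlgHom.ofLinearMap (A := hh.Carrier) (B := hb.Carrier) τ hτ.map_one hτ.map_mul
  exact ⟨adjointAct τ', adjointAct_isRightModuleAlgebra τ', fun X k => rfl⟩

end Carrier

/-! ### Inclusions of tensor factors -/

section Incl

variable {F A : Type*} [Field F] [AddCommMonoid A] [Module F A] {ι : Type*} [DecidableEq ι]

theorem AlgMaps.incl_apply (a : AlgMaps F A) (i : ι) (x : A) :
    a.incl i x = PiTensorProduct.tprod F (Function.update (fun _ => a.one) i x) := rfl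

variable [Fintype ι] [Module.Free F A]

theorem HopfMaps.pi_antipode_incl {h : HopfMaps F A} (hh : h.IsHopfAlgebra) (i : ι) (x : A) :
    (h.pi ι).antipode (h.incl i x) = h.incl i (h.antipode x) := by
  rw [AlgMaps.incl_apply, HopfMaps.pi_antipode_tprod, AlgMaps.incl_apply]
  congr 1
  funext j
  by_cases hj : j = i
  · subst hj; simp
  · simp [hj, hh.antipode_one]

theorem HopfMaps.pi_comul_incl {h : HopfMaps F A} (hh : h.IsHopfAlgebra) (i : ι) (x : A) :
    (h.pi ι).comul (h.incl i x) = TensorProduct.map (h.incl i) (h.incl i) (h.comul x) := by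
  rw [AlgMaps.incl_apply, HopfMaps.pi_comul_tprod]
  have h1 : (fun j => h.comul (Function.update (fun _ => h.one) i x j))
      = Function.update (fun _ => h.one ⊗ₜ[F] h.one) i (h.comul x) := by
    funext j
    by_cases hj : j = i
    · subst hj; simp
    · simp [hj, hh.comul_one]
  rw [h1]
  have h2 : ∀ t : A ⊗[F] A, unzip ι F A A (PiTensorProduct.tprod F
      (Function.update (fun _ => h.one ⊗ₜ[F] h.one) i t))
      = TensorProduct.map (h.incl i) (h.incl i) t := by
    intro t
    induction t with
    | zero => rw [MultilinearMap.map_update_zero, map_zero, map_zero]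
    | add a b ha hb => rw [MultilinearMap.map_update_add, map_add, map_add, ha, hb]
    | tmul a b =>
      rw [TensorProduct.map_tmul, AlgMaps.incl_apply, AlgMaps.incl_apply, ← unzip_tprod]
      congr 2
      funext j
      by_cases hj : j = i
      · subst hj; simp
      · simp [hj]
  exact h2 _

theorem HopfMaps.pi_antipode_antipode {h : HopfMaps F A} (hS : ∀ x, h.antipode (h.antipode x) = x)
    (x : ⨂[F] _ : ι, A) : (h.pi ι).antipode ((h.pi ι).antipode x) = x := by
  refine PiTensorProduct.induction_linear (f := (h.pi ι).antipode ∘ₗ (h.pi ι).antipode)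
    (g := LinearMap.id) (fun x => ?_) x
  simp only [LinearMap.comp_apply, HopfMaps.pi_antipode_tprod, hS, LinearMap.id_apply]

end Incl

/-! ### The antipode of the Drinfeld double -/

namespace DualHopf

open WithConv Coalgebra HopfAlgebra

variable {F H : Type*} [Field F] [Ring H] [HopfAlgebra F H] [FiniteDimensional F H]
  [InvolutiveAntipode F H]

local notation "S" => antipode F (A := H)
local notation "H⋆" => Module.Dual F H
local notation "𝔻" => HopfMaps.drinfeldDouble (HopfMaps.of F H)
local notation "𝔼" => Module.End F H ⊗[F] Module.End F H

/-- The one-term expression of the coproduct of `1`. -/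
def reprOne (F C : Type*) [Field F] [Ring C] [Bialgebra F C] : Coalgebra.Repr F (1 : C) Unit where
  index := {()}
  left _ := 1
  right _ := 1
  eq := by simp [Algebra.TensorProduct.one_def]

/-- Conjugation by the pairing is trivial on `H⋆ ⊗ 1`. -/
theorem conv_pair_tmul_one {R : Type*} [Ring R] [Algebra F R]
    (X : WithConv (H⋆ ⊗[F] H →ₗ[F] R)) (α : H⋆) :
    (pairInv F H R * X * pair F H R) (α ⊗ₜ 1) = X (α ⊗ₜ 1) := by
  rw [mul_assoc, pairConv_mul_conv _ _ _ (reprOne F H)]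
  simp only [reprOne, Finset.sum_singleton]
  rw [conv_mul_pairConv _ _ _ (reprOne F H)]
  simp only [reprOne, Finset.sum_singleton, LinearMap.id_apply, HopfAlgebra.antipode_one]
  congr 2
  apply LinearMap.ext
  intro x
  simp

/-- Conjugation by the pairing is trivial on `1 ⊗ H`. -/
theorem conv_pair_one_tmul {R : Type*} [Ring R] [Algebra F R]
    (X : WithConv (H⋆ ⊗[F] H →ₗ[F] R)) (z : H) :
    (pairInv F H R * X * pair F H R) (1 ⊗ₜ z) = X (1 ⊗ₜ z) := by
  have hR : ∀ y : H, transR (1 : H⋆) (S y) = counit (R := F) y • (1 : H⋆) := by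
    intro y
    apply LinearMap.ext
    intro x
    simp [one_apply, mul_comm]
  have hL : ∀ y : H, transL (1 : H⋆) y = counit (R := F) y • (1 : H⋆) := by
    intro y
    apply LinearMap.ext
    intro x
    simp [one_apply]
  rw [mul_assoc, pairConv_mul_conv _ _ _ (ℛ F z)]
  simp only [hR, ← smul_tmul', map_smul]
  simp only [conv_mul_pairConv _ _ _ (ℛ F _), LinearMap.id_apply, hL, ← smul_tmul', map_smul]
  simp only [← map_smul, ← map_sum, ← tmul_smul, ← tmul_sum, sum_smul_counit, sum_counit_smul_right]

section

variable {R : Type*} [Ring R] [Algebra F R]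

theorem doubleMap_antipode_tmul_one (A : H⋆ →ₐ[F] R) (B : H →ₐ[F] R) (α : H⋆) :
    doubleMap A B ((𝔻).antipode (α ⊗ₜ[F] (1 : H))) = doubleMap A B ((antipode F α) ⊗ₜ[F] (1 : H)) := by
  refine (comp_drinfeldDouble_antipode (convA A * convB B) _).trans ?_
  rw [conv_pair_tmul_one]
  change doubleMap A B (antipode F α ⊗ₜ S 1) = _
  rw [HopfAlgebra.antipode_one]

theorem doubleMap_antipode_one_tmul (A : H⋆ →ₐ[F] R) (B : H →ₐ[F] R) (z : H) :
    doubleMap A B ((𝔻).antipode ((1 : H⋆) ⊗ₜ[F] z)) = doubleMap A B ((1 : H⋆) ⊗ₜ[F] S z) := by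
  refine (comp_drinfeldDouble_antipode (convA A * convB B) _).trans ?_
  rw [conv_pair_one_tmul]
  change doubleMap A B (antipode F (1 : H⋆) ⊗ₜ S z) = _
  rw [HopfAlgebra.antipode_one]

theorem doubleMap_tmul_one_mul_one_tmul {A : H⋆ →ₐ[F] R} {B : H →ₐ[F] R} (hAB : DoubleRel A B)
    (α : H⋆) (z : H) : doubleMap A B ((𝔻).mul (α ⊗ₜ 1) (1 ⊗ₜ z)) = doubleMap A B (α ⊗ₜ z) := by
  rw [doubleMap_mul hAB]
  simp only [doubleMap_tmul, map_one, one_mul, mul_one]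

end

theorem drinfeldDouble_antipode_tmul_one (α : H⋆) :
    (𝔻).antipode (α ⊗ₜ 1) = (antipode F α) ⊗ₜ 1 :=
  faithful_injective (doubleMap_antipode_tmul_one _ _ α)

theorem drinfeldDouble_antipode_one_tmul (z : H) :
    (𝔻).antipode (1 ⊗ₜ z) = (1 : H⋆) ⊗ₜ S z :=
  faithful_injective (doubleMap_antipode_one_tmul _ _ z)

theorem drinfeldDouble_tmul_one_mul_one_tmul (α : H⋆) (z : H) :
    (𝔻).mul (α ⊗ₜ 1) (1 ⊗ₜ z) = α ⊗ₜ z :=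
  faithful_injective (doubleMap_tmul_one_mul_one_tmul faithful_rel α z)

theorem drinfeldDouble_antipode_tmul (α : H⋆) (z : H) :
    (𝔻).antipode (α ⊗ₜ z) = (𝔻).mul (1 ⊗ₜ S z) ((antipode F α) ⊗ₜ 1) := by
  rw [← drinfeldDouble_tmul_one_mul_one_tmul, drinfeldDouble_isHopfAlgebra.antipode_mul,
    drinfeldDouble_antipode_tmul_one, drinfeldDouble_antipode_one_tmul]

theorem drinfeldDouble_antipode_antipode (t : H⋆ ⊗[F] H) : (𝔻).antipode ((𝔻).antipode t) = t := by
  induction t with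
  | zero => simp
  | add a b ha hb => simp only [map_add, ha, hb]
  | tmul α z =>
    rw [drinfeldDouble_antipode_tmul, drinfeldDouble_isHopfAlgebra.antipode_mul,
      drinfeldDouble_antipode_tmul_one, drinfeldDouble_antipode_one_tmul, antipode_antipode,
      antipode_antipode, drinfeldDouble_tmul_one_mul_one_tmul]

end DualHopf

namespace DualHopf

open WithConv Coalgebra HopfAlgebra

variable {F H : Type*} [Field F] [Ring H] [HopfAlgebra F H] [FiniteDimensional F H]

local notation "S" => antipode F (A := H)
local notation "H⋆" => Module.Dual F H
local notation "ℌ" => HopfMaps.heisenberg (HopfMaps.of F H)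
local notation "𝔻⋆" => HopfMaps.drinfeldDoubleDual (HopfMaps.of F H)
local notation "b" => Module.Free.chooseBasis F H

/-! ### The Heisenberg double is an algebra -/

theorem heisenbergTwist_tmul (α : H⋆) {y : H} {ι : Type*} (r : Coalgebra.Repr F y ι) :
    (HopfMaps.of F H).heisenbergTwist (α ⊗ₜ y)
      = ∑ i ∈ r.index, r.left i ⊗ₜ transL α (r.right i) := by
  have h0 : (HopfMaps.of F H).heisenbergTwist (α ⊗ₜ y)
      = TensorProduct.lid F (H ⊗[F] H⋆) (TensorProduct.map (contractLeft F H)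
        (TensorProduct.comm F H⋆ H).toLinearMap (TensorProduct.tensorTensorTensorComm F H⋆ H⋆ H H
        ((HopfMaps.of F H).dual.comul α ⊗ₜ TensorProduct.comm F H H (comul y)))) := rfl
  have h1 : (HopfMaps.of F H).dual.comul α = TensorProduct.comm F H⋆ H⋆ (comul α) := by
    rw [comul_def']
    exact ((TensorProduct.comm F H⋆ H⋆).symm_apply_apply _).symm
  rw [h0, h1, ← (ℛ F α).eq, ← r.eq]
  simp only [map_sum, TensorProduct.comm_tmul, tmul_sum, sum_tmul,
    TensorProduct.tensorTensorTensorComm_tmul, TensorProduct.map_tmul, TensorProduct.lid_tmul,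
    LinearEquiv.coe_coe, contractLeft_apply]
  refine Finset.sum_congr rfl fun i _ => ?_
  rw [← sum_right_smul_left (ℛ F α), tmul_sum]
  simp only [tmul_smul]

theorem counit_opRhoR (δ : H⋆) (n : H) : counit (R := F) (opRhoR F H δ n) = δ n := by
  rw [opRhoR_apply _ (ℛ F n)]
  conv_rhs => rw [← sum_counit_smul_right (ℛ F n)]
  simp [mul_comm]

theorem sum_coord_smul (u : H) : ∑ j, ((b).coord j u) • (b) j = u := (b).sum_repr u

theorem sum_smul_coord (α : H⋆) : ∑ j, α ((b) j) • (b).coord j = α := by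
  apply LinearMap.ext
  intro x
  conv_rhs => rw [← sum_coord_smul (F := F) x]
  simp

theorem sum_coord_one_mul (w : H) : ∑ j, ((b).coord j 1) • ((b) j * w) = w := by
  have h := congrArg (· * w) (sum_coord_smul (F := F) (1 : H))
  simpa only [Finset.sum_mul, smul_mul_assoc, one_mul] using h

theorem sum_coord_one_mul' (w : H) : ∑ j, ((b).coord j 1) • (w * (b) j) = w := by
  have h := congrArg (w * ·) (sum_coord_smul (F := F) (1 : H))
  simpa only [Finset.mul_sum, mul_smul_comm, mul_one] using h

theorem dual_mul_apply_one (α β : H⋆) : (α * β) (1 : H) = α 1 * β 1 := by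
  rw [mul_apply _ _ (reprOne F H)]
  simp only [reprOne, Finset.sum_singleton]

/-- The projection `y ⊗ γ ↦ γ(1) y` of `D(H)^*` onto `H`. -/
def projFst (F H : Type*) [Field F] [Ring H] [HopfAlgebra F H] :
    H ⊗[F] Module.Dual F H →ₗ[F] H :=
  (TensorProduct.rid F H).toLinearMap ∘ₗ (Module.Dual.eval F H 1).lTensor H

/-- The projection `y ⊗ γ ↦ ε(y) γ` of `D(H)^*` onto `H^*`. -/
def projSnd (F H : Type*) [Field F] [Ring H] [HopfAlgebra F H] :
    H ⊗[F] Module.Dual F H →ₗ[F] Module.Dual F H :=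
  (TensorProduct.lid F (Module.Dual F H)).toLinearMap ∘ₗ counit.rTensor (Module.Dual F H)

theorem projFst_tmul (y : H) (γ : H⋆) : projFst F H (y ⊗ₜ γ) = γ 1 • y := by
  simp [projFst]

theorem projSnd_tmul (y : H) (γ : H⋆) : projSnd F H (y ⊗ₜ γ) = counit (R := F) y • γ := by
  simp [projSnd]

variable [InvolutiveAntipode F H]

/-- The straightening rule of the Heisenberg double is the relation of right coaction and left
multiplication on `H`. -/
theorem opRhoR_mul_opL (α : H⋆) (y : H) : opRhoR F H α * opL F H y
    = heisenbergEquiv F H ((HopfMaps.of F H).heisenbergTwist (α ⊗ₜ y)) := by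
  have h := congrArg (fun X => X (α ⊗ₜ[F] y)) (convA_mul_convB_opRhoR_opL (F := F) (H := H))
  have h1 : (convA (opRhoR F H) * convB (opL F H)) (α ⊗ₜ[F] y) = opRhoR F H α * opL F H y :=
    liftL_mul_liftR_tmul _ _ _ _
  rw [← h1]
  refine h.trans ?_
  rw [heisenbergTwist_tmul α (ℛ F y), map_sum]
  refine (conv_mul_pairConv _ _ _ (ℛ F y)).trans ?_
  refine Finset.sum_congr rfl fun i _ => ?_
  exact liftR_mul_liftL_tmul _ _ _ _

theorem heisenbergEquiv_mul (s t : H ⊗[F] H⋆) :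
    heisenbergEquiv F H ((ℌ).mul s t) = heisenbergEquiv F H s * heisenbergEquiv F H t := by
  induction s with
  | zero => simp
  | add a c ha hc => simp only [map_add, LinearMap.add_apply, ha, hc, add_mul]
  | tmul y α =>
    induction t with
    | zero => simp
    | add a c ha hc => simp only [map_add, ha, hc, mul_add]
    | tmul z β =>
      have h0 : (ℌ).mul (y ⊗ₜ α) (z ⊗ₜ β) = TensorProduct.map (LinearMap.mulLeft F y)
          (LinearMap.mulRight F β) ((HopfMaps.of F H).heisenbergTwist (α ⊗ₜ z)) := by
        have h1 : (ℌ).mul (y ⊗ₜ α) (z ⊗ₜ β) = TensorProduct.map (HopfMaps.of F H).mulT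
          (HopfMaps.of F H).dual.mulT ((TensorProduct.tensorTensorTensorAssoc F H H H⋆ H⋆).symm
            ((y ⊗ₜ ((HopfMaps.of F H).heisenbergTwist (α ⊗ₜ z))) ⊗ₜ β)) := rfl
        rw [h1]
        generalize (HopfMaps.of F H).heisenbergTwist (α ⊗ₜ z) = t
        induction t with
        | zero => simp
        | add a c ha hc => simp only [map_add, tmul_add, add_tmul, ha, hc]
        | tmul a c => rfl
      have h1 : ∀ t : H ⊗[F] H⋆, heisenbergEquiv F H (TensorProduct.map (LinearMap.mulLeft F y)
          (LinearMap.mulRight F β) t) = opL F H y * heisenbergEquiv F H t * opRhoR F H β := by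
        intro t
        induction t with
        | zero => simp
        | add a c ha hc => simp only [map_add, ha, hc, mul_add, add_mul]
        | tmul a c => simp only [TensorProduct.map_tmul, LinearMap.mulLeft_apply,
            LinearMap.mulRight_apply, heisenbergEquiv_tmul, map_mul, mul_assoc]
      rw [h0, h1, ← opRhoR_mul_opL, heisenbergEquiv_tmul, heisenbergEquiv_tmul]
      simp only [mul_assoc]

theorem heisenbergEquiv_one : heisenbergEquiv F H (ℌ).one = 1 := by
  change heisenbergEquiv F H ((1 : H) ⊗ₜ (1 : H⋆)) = 1
  rw [heisenbergEquiv_tmul, map_one, map_one, one_mul]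

/-- The Heisenberg double is an associative unital algebra, as it is isomorphic to `End H`. -/
theorem heisenberg_isAlgebra : (ℌ).IsAlgebra where
  mul_assoc x y z := (heisenbergEquiv F H).injective (by simp only [heisenbergEquiv_mul, mul_assoc])
  one_mul x := (heisenbergEquiv F H).injective (by
    rw [heisenbergEquiv_mul, heisenbergEquiv_one, one_mul])
  mul_one x := (heisenbergEquiv F H).injective (by
    rw [heisenbergEquiv_mul, heisenbergEquiv_one, mul_one])

/-! ### The dual of the Drinfeld double -/

theorem drinfeldDoubleDual_antipode_tmul (y : H) (γ : H⋆) : (𝔻⋆).antipode (y ⊗ₜ γ)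
    = ∑ i, ∑ j, ((b) i * (S y * (b) j)) ⊗ₜ[F]
      (antipode F ((b).coord j) * (antipode F γ * (b).coord i)) := by
  have h : (𝔻⋆).antipode (y ⊗ₜ γ) = ∑ i, ∑ j, ((b) i * ((HopfMaps.of F H).antipodeInv y * (b) j)) ⊗ₜ[F]
      (antipode F ((b).coord j) * (antipode F γ * (b).coord i)) := by
    simp only [HopfMaps.drinfeldDoubleDual, LinearMap.sum_apply]
    rfl
  rw [h, antipodeInv_of]

theorem sum_opL_mul_opRhoR_antipode (m : H) :
    ∑ j, opL F H ((b) j) (opRhoR F H (antipode F ((b).coord j)) m) = counit (R := F) m • (1 : H) := by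
  simp only [opRhoR_apply _ (ℛ F m), opL_apply, dual_antipode_apply, Finset.mul_sum]
  rw [Finset.sum_comm, ← sum_antipode_right_mul_left (ℛ F m)]
  refine Finset.sum_congr rfl fun k _ => ?_
  conv_rhs => rw [← sum_coord_smul (F := F) (S ((ℛ F m).right k)), Finset.sum_mul]
  simp only [mul_smul_comm, smul_mul_assoc]

/-- The antipode of `D(H)^*` replaces left by right multiplication, and the right by the left
coaction. -/
theorem heisenbergEquiv_antipode (y : H) (γ : H⋆) :
    heisenbergEquiv F H ((𝔻⋆).antipode (y ⊗ₜ γ)) = opR F H y * opRhoL F H γ := by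
  apply LinearMap.ext
  intro m
  have h1 : ∀ i, ∑ j, heisenbergEquiv F H (((b) i * (S y * (b) j)) ⊗ₜ[F]
      (antipode F ((b).coord j) * (antipode F γ * (b).coord i))) m
      = γ (S (opRhoR F H ((b).coord i) m)) • ((b) i * S y) := by
    intro i
    have h2 : ∀ j, heisenbergEquiv F H (((b) i * (S y * (b) j)) ⊗ₜ[F]
      (antipode F ((b).coord j) * (antipode F γ * (b).coord i))) m
      = (b) i * (S y * (opL F H ((b) j) (opRhoR F H (antipode F ((b).coord j))
        (opRhoR F H (antipode F γ) (opRhoR F H ((b).coord i) m))))) := by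
      intro j
      rw [heisenbergEquiv_tmul]
      simp only [map_mul, Module.End.mul_apply, opL_apply]
    simp only [h2]
    rw [← Finset.mul_sum, ← Finset.mul_sum, sum_opL_mul_opRhoR_antipode, counit_opRhoR]
    simp only [mul_smul_comm, mul_one, dual_antipode_apply]
  rw [drinfeldDoubleDual_antipode_tmul, map_sum, LinearMap.sum_apply]
  simp only [map_sum, LinearMap.sum_apply, h1]
  rw [Module.End.mul_apply, opR_apply, opRhoL_apply _ (ℛ F m), Finset.sum_mul]
  simp only [opRhoR_apply _ (ℛ F m), map_sum, map_smul, Finset.sum_smul]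
  rw [Finset.sum_comm]
  refine Finset.sum_congr rfl fun k _ => ?_
  conv_rhs => rw [← sum_coord_smul (F := F) ((ℛ F m).right k), Finset.smul_sum, Finset.sum_mul]
  refine Finset.sum_congr rfl fun i _ => ?_
  simp only [smul_mul_assoc, smul_smul, smul_eq_mul, mul_comm]

theorem projFst_antipode (t : H ⊗[F] H⋆) : projFst F H ((𝔻⋆).antipode t) = S (projFst F H t) := by
  induction t with
  | zero => simp
  | add a c ha hc => simp only [map_add, ha, hc]
  | tmul y γ =>
    rw [drinfeldDoubleDual_antipode_tmul]
    simp only [map_sum, projFst_tmul, dual_mul_apply_one, dual_antipode_apply,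
      HopfAlgebra.antipode_one]
    have h1 : ∀ i, ∑ j, ((b).coord j 1 * (γ 1 * (b).coord i 1)) • ((b) i * (S y * (b) j))
        = γ 1 • ((b).coord i 1 • ((b) i * S y)) := by
      intro i
      conv_rhs => rw [← sum_coord_one_mul' (F := F) (S y)]
      simp only [Finset.mul_sum, Finset.smul_sum, mul_smul_comm, smul_smul]
      refine Finset.sum_congr rfl fun j _ => ?_
      congr 1
      ring
    simp only [h1]
    rw [← Finset.smul_sum, sum_coord_one_mul, map_smul]

theorem projSnd_antipode (t : H ⊗[F] H⋆) :
    projSnd F H ((𝔻⋆).antipode t) = antipode F (projSnd F H t) := by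
  induction t with
  | zero => simp
  | add a c ha hc => simp only [map_add, ha, hc]
  | tmul y γ =>
    rw [drinfeldDoubleDual_antipode_tmul]
    have hε : ∑ j, counit (R := F) ((b) j) • (b).coord j = (1 : H⋆) := sum_smul_coord (1 : H⋆)
    simp only [map_sum, projSnd_tmul, Bialgebra.counit_mul, HopfAlgebra.counit_antipode]
    have h1 : ∀ i, ∑ j, (counit (R := F) ((b) i) * (counit (R := F) y * counit (R := F) ((b) j)))
        • (antipode F ((b).coord j) * (antipode F γ * (b).coord i))
        = (counit (R := F) ((b) i) * counit (R := F) y) • (antipode F γ * (b).coord i) := by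
      intro i
      conv_rhs => rw [← one_mul (antipode F γ * (b).coord i),
        ← HopfAlgebra.antipode_one (R := F) (A := H⋆), ← hε, map_sum, Finset.sum_mul, Finset.smul_sum]
      refine Finset.sum_congr rfl fun j _ => ?_
      rw [map_smul, smul_mul_assoc, smul_smul]
      congr 1
      ring
    simp only [h1]
    conv_rhs => rw [map_smul, ← mul_one (antipode F γ), ← hε, Finset.mul_sum, Finset.smul_sum]
    refine Finset.sum_congr rfl fun i _ => ?_
    rw [mul_smul_comm, smul_smul, mul_comm]

theorem drinfeldDoubleDual_comul_tmul (y : H) (γ : H⋆) : (𝔻⋆).comul (y ⊗ₜ γ)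
    = ∑ i, ∑ j, TensorProduct.map
      (TensorProduct.map LinearMap.id (LinearMap.mulLeft F ((b).coord i)
        ∘ₗ LinearMap.mulRight F ((b).coord j)))
      (TensorProduct.map (LinearMap.mulLeft F (S ((b) j)) ∘ₗ LinearMap.mulRight F ((b) i)) LinearMap.id)
      (TensorProduct.tensorTensorTensorComm F H H H⋆ H⋆
        (comul y ⊗ₜ (HopfMaps.of F H).dual.comul γ)) := by
  simp only [HopfMaps.drinfeldDoubleDual, LinearMap.sum_apply]
  rfl

theorem ext_tmul_tmul {M : Type*} [AddCommMonoid M] [Module F M]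
    {f g : (H ⊗[F] H) ⊗[F] (H⋆ ⊗[F] H⋆) →ₗ[F] M}
    (h : ∀ a a' p q, f ((a ⊗ₜ a') ⊗ₜ (p ⊗ₜ q)) = g ((a ⊗ₜ a') ⊗ₜ (p ⊗ₜ q)))
    (u : H ⊗[F] H) (w : H⋆ ⊗[F] H⋆) : f (u ⊗ₜ w) = g (u ⊗ₜ w) := by
  have : f = g := by
    apply TensorProduct.ext
    apply TensorProduct.ext'
    intro a a'
    apply TensorProduct.ext'
    exact h a a'
  rw [this]

/-- The projection onto `H` is a coalgebra homomorphism: evaluated at `1`, the dual bases in the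
coproduct of `D(H)^*` sum up to `1`. -/
theorem projFst_comul (t : H ⊗[F] H⋆) : TensorProduct.map (projFst F H) (projFst F H) ((𝔻⋆).comul t)
    = comul (projFst F H t) := by
  induction t with
  | zero => simp
  | add a c ha hc => simp only [map_add, ha, hc]
  | tmul y γ =>
    rw [drinfeldDoubleDual_comul_tmul, projFst_tmul, map_smul]
    have h1 : γ 1 = pairing F H ((HopfMaps.of F H).dual.comul γ) (1 ⊗ₜ 1) := by
      rw [pairing_dual_comul, one_mul]
    rw [h1]
    have key := ext_tmul_tmul (f := TensorProduct.map (projFst F H) (projFst F H) ∘ₗ (∑ i, ∑ j, TensorProduct.map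
        (TensorProduct.map LinearMap.id (LinearMap.mulLeft F ((b).coord i)
          ∘ₗ LinearMap.mulRight F ((b).coord j)))
        (TensorProduct.map (LinearMap.mulLeft F (S ((b) j)) ∘ₗ LinearMap.mulRight F ((b) i))
          LinearMap.id))
        ∘ₗ (TensorProduct.tensorTensorTensorComm F H H H⋆ H⋆).toLinearMap)
      (g := (TensorProduct.rid F (H ⊗[F] H)).toLinearMap
        ∘ₗ ((LinearMap.applyₗ ((1 : H) ⊗ₜ[F] (1 : H))) ∘ₗ (pairing F H).toLinearMap).lTensor _)
      (fun a a' p q => by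
        simp only [LinearMap.comp_apply, LinearMap.sum_apply, LinearEquiv.coe_coe,
          LinearMap.lTensor_tmul, TensorProduct.rid_tmul, LinearMap.applyₗ_apply_apply]
        simp only [map_sum, TensorProduct.tensorTensorTensorComm_tmul, TensorProduct.map_tmul,
          projFst_tmul, LinearMap.comp_apply, LinearMap.mulLeft_apply, LinearMap.mulRight_apply,
          LinearMap.id_apply, dual_mul_apply_one, pairing_tmul]
        have h2 : ∑ i, ∑ j, ((b).coord i 1) • ((b).coord j 1 • (S ((b) j) * (a' * (b) i))) = a' := by
          have h3 : ∀ w : H, ∑ j, (b).coord j 1 • (S ((b) j) * w) = w := by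
            intro w
            have h := congrArg (fun x => S x * w) (sum_coord_smul (F := F) (1 : H))
            simpa only [map_sum, map_smul, Finset.sum_mul, smul_mul_assoc, one_mul,
              HopfAlgebra.antipode_one] using h
          simp only [← Finset.smul_sum, h3]
          exact sum_coord_one_mul' a'
        conv_rhs => rw [← h2]
        simp only [tmul_sum, Finset.smul_sum, tmul_smul, ← smul_tmul', smul_smul]
        refine Finset.sum_congr rfl fun i _ => Finset.sum_congr rfl fun j _ => ?_
        congr 1
        ring)
      (comul y) ((HopfMaps.of F H).dual.comul γ)
    simpa only [LinearMap.comp_apply, LinearMap.sum_apply, LinearEquiv.coe_coe,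
      LinearMap.lTensor_tmul, LinearMap.rTensor_tmul, TensorProduct.rid_tmul, TensorProduct.lid_tmul,
      LinearMap.applyₗ_apply_apply] using key

/-- The projection onto `H^*` is a coalgebra homomorphism, for the comultiplication dual to the product
of `H`. -/
theorem projSnd_comul (t : H ⊗[F] H⋆) : TensorProduct.map (projSnd F H) (projSnd F H) ((𝔻⋆).comul t)
    = (HopfMaps.of F H).dual.comul (projSnd F H t) := by
  induction t with
  | zero => simp
  | add a c ha hc => simp only [map_add, ha, hc]
  | tmul y γ =>
    rw [drinfeldDoubleDual_comul_tmul, projSnd_tmul, map_smul]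
    have h1 : counit (R := F) y = TensorProduct.lid F F (TensorProduct.map counit counit (comul (R := F) y)) := by
      rw [← (ℛ F y).eq]
      simp only [map_sum, TensorProduct.map_tmul, TensorProduct.lid_tmul, smul_eq_mul]
      exact (sum_counit_mul_counit (ℛ F y)).symm
    rw [h1]
    have hε : ∑ j, counit (R := F) ((b) j) • (b).coord j = (1 : H⋆) := sum_smul_coord (1 : H⋆)
    have key := ext_tmul_tmul (f := TensorProduct.map (projSnd F H) (projSnd F H) ∘ₗ (∑ i, ∑ j, TensorProduct.map
        (TensorProduct.map LinearMap.id (LinearMap.mulLeft F ((b).coord i)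
          ∘ₗ LinearMap.mulRight F ((b).coord j)))
        (TensorProduct.map (LinearMap.mulLeft F (S ((b) j)) ∘ₗ LinearMap.mulRight F ((b) i))
          LinearMap.id))
        ∘ₗ (TensorProduct.tensorTensorTensorComm F H H H⋆ H⋆).toLinearMap)
      (g := (TensorProduct.lid F (H⋆ ⊗[F] H⋆)).toLinearMap
        ∘ₗ ((TensorProduct.lid F F).toLinearMap ∘ₗ TensorProduct.map counit counit).rTensor _)
      (fun a a' p q => by
        simp only [LinearMap.comp_apply, LinearMap.sum_apply, LinearEquiv.coe_coe,
          LinearMap.rTensor_tmul, TensorProduct.lid_tmul]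
        simp only [map_sum, TensorProduct.tensorTensorTensorComm_tmul, TensorProduct.map_tmul,
          projSnd_tmul, LinearMap.comp_apply, LinearMap.mulLeft_apply, LinearMap.mulRight_apply,
          LinearMap.id_apply, Bialgebra.counit_mul, HopfAlgebra.counit_antipode,
          TensorProduct.lid_tmul, smul_eq_mul]
        have h2 : ∑ i, ∑ j, counit (R := F) ((b) i) • counit (R := F) ((b) j) •
            ((b).coord i * (p * (b).coord j)) = p := by
          conv_rhs => rw [← one_mul p, ← mul_one p, ← hε, Finset.mul_sum, Finset.sum_mul_sum]
          refine Finset.sum_congr rfl fun i _ => Finset.sum_congr rfl fun j _ => ?_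
          rw [mul_smul_comm, smul_mul_smul_comm, smul_smul]
        conv_rhs => rw [← h2]
        simp only [sum_tmul, Finset.smul_sum, tmul_smul, ← smul_tmul', smul_smul]
        refine Finset.sum_congr rfl fun i _ => Finset.sum_congr rfl fun j _ => ?_
        congr 1
        ring)
      (comul y) ((HopfMaps.of F H).dual.comul γ)
    simpa only [LinearMap.comp_apply, LinearMap.sum_apply, LinearEquiv.coe_coe,
      LinearMap.lTensor_tmul, LinearMap.rTensor_tmul, TensorProduct.rid_tmul, TensorProduct.lid_tmul,
      LinearMap.applyₗ_apply_apply] using key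

theorem drinfeldDoubleDual_counit_eq_fst (t : H ⊗[F] H⋆) : (𝔻⋆).counit t = counit (R := F) (projFst F H t) := by
  induction t with
  | zero => simp
  | add a c ha hc => simp only [map_add, ha, hc]
  | tmul y γ =>
    rw [projFst_tmul, map_smul, smul_eq_mul, mul_comm]
    rfl

theorem drinfeldDoubleDual_counit_eq_snd (t : H ⊗[F] H⋆) : (𝔻⋆).counit t = projSnd F H t 1 := by
  induction t with
  | zero => simp
  | add a c ha hc => simp only [map_add, LinearMap.add_apply, ha, hc]
  | tmul y γ =>
    rw [projSnd_tmul]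
    rfl

end DualHopf

/-! ### Elements of a tensor power supported on a set of factors -/

section Support

variable {F A : Type*} [Field F] [AddCommMonoid A] [Module F A] {ι : Type*}

/-- The span of the pure tensors whose entries outside of `s` are `1`. -/
def AlgMaps.supported (a : AlgMaps F A) (s : Set ι) : Submodule F (⨂[F] _ : ι, A) :=
  Submodule.span F {t | ∃ x : ι → A, (∀ i ∉ s, x i = a.one) ∧ PiTensorProduct.tprod F x = t}

theorem AlgMaps.incl_mem_supported [DecidableEq ι] (a : AlgMaps F A) (i : ι) (x : A) :
    a.incl i x ∈ a.supported {i} :=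
  Submodule.subset_span ⟨_, fun j hj => by
    rw [Function.update_of_ne (by simpa using hj)], (a.incl_apply i x).symm⟩

theorem AlgMaps.one_mem_supported (a : AlgMaps F A) (s : Set ι) : (a.pi ι).one ∈ a.supported s :=
  Submodule.subset_span ⟨_, fun _ _ => rfl, rfl⟩

/-- Two multiplications with the same unit give the same products of elements with disjoint
supports. -/
theorem AlgMaps.pi_mul_eq_of_disjoint {a b : AlgMaps F A} (h : a.one = b.one)
    (ha₁ : ∀ x, a.mul a.one x = x) (ha₂ : ∀ x, a.mul x a.one = x)
    (hb₁ : ∀ x, b.mul b.one x = x) (hb₂ : ∀ x, b.mul x b.one = x) {s t : Set ι}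
    (hst : Disjoint s t) {x y : ⨂[F] _ : ι, A} (hx : x ∈ a.supported s) (hy : y ∈ a.supported t) :
    (a.pi ι).mul x y = (b.pi ι).mul x y ∧ (a.pi ι).mul x y ∈ a.supported (s ∪ t) := by
  classical
  induction hx using Submodule.span_induction with
  | zero => simp
  | add x x' _ _ h₁ h₂ =>
    simp only [map_add, LinearMap.add_apply, h₁.1, h₂.1, true_and]
    exact add_mem (h₁.1 ▸ h₁.2) (h₂.1 ▸ h₂.2)
  | smul c x _ h₁ =>
    simp only [map_smul, LinearMap.smul_apply, h₁.1, true_and]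
    exact Submodule.smul_mem _ _ (h₁.1 ▸ h₁.2)
  | mem x hx =>
    obtain ⟨f, hf, rfl⟩ := hx
    induction hy using Submodule.span_induction with
    | zero => simp
    | add x x' _ _ h₁ h₂ =>
      simp only [map_add, h₁.1, h₂.1, true_and]
      exact add_mem (h₁.1 ▸ h₁.2) (h₂.1 ▸ h₂.2)
    | smul c x _ h₁ =>
      simp only [map_smul, h₁.1, true_and]
      exact Submodule.smul_mem _ _ (h₁.1 ▸ h₁.2)
    | mem y hy =>
      obtain ⟨g, hg, rfl⟩ := hy
      rw [AlgMaps.pi_mul_tprod, AlgMaps.pi_mul_tprod]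
      refine ⟨congrArg _ (funext fun i => ?_), Submodule.subset_span ⟨_, fun i hi => ?_, rfl⟩⟩
      · by_cases hi : i ∈ s
        · rw [hg i (hst.notMem_of_mem_left hi), ha₂, h, hb₂]
        · rw [hf i hi, ha₁, h, hb₁]
      · rw [hf i (fun h' => hi (Or.inl h')), hg i (fun h' => hi (Or.inr h')), ha₁]

end Support

section HolWord

variable {F A E : Type*} [Field F] [AddCommMonoid A] [Module F A] [Module.Free F A]
  [Module.Finite F A] [DecidableEq E]

/-- The holonomy of a letter, with the antipode of `D(H)^*` for an inverse letter. -/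
def HopfMaps.holLetter (h : HopfMaps F A) (x : ThickEdge E × Bool) :
    A ⊗[F] Module.Dual F A →ₗ[F] HeisenbergPow F A E :=
  bif x.2 then h.holEdge x.1 else h.holEdge x.1 ∘ₗ h.drinfeldDoubleDual.antipode

theorem HopfMaps.hol_nil_apply (h : HopfMaps F A) (t : A ⊗[F] Module.Dual F A) :
    h.hol ([] : ThickPath E) t
      = h.drinfeldDoubleDual.counit t • (h.drinfeldDoubleDual.toAlgMaps.pi E).one := rfl

theorem HopfMaps.hol_cons_apply (h : HopfMaps F A) (x : ThickEdge E × Bool) (p : ThickPath E)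
    (t : A ⊗[F] Module.Dual F A) :
    h.hol (x :: p) t = (h.drinfeldDoubleDual.toAlgMaps.pi E).mulT
      (TensorProduct.map (h.holLetter x) (h.hol p) (h.drinfeldDoubleDual.comul t)) := rfl

end HolWord

namespace DualHopf

open WithConv Coalgebra HopfAlgebra

/-- A list of convolution factors whose values commute with `x` has a product whose values
commute with `x`. -/
theorem commute_conv_prod {F C R : Type*} [Field F] [AddCommGroup C] [Module F C] [Coalgebra F C]
    [Ring R] [Algebra F R] {x : R} {L : List (WithConv (C →ₗ[F] R))}
    (h : ∀ X ∈ L, ∀ c, Commute x (X c)) (c : C) : Commute x (L.prod c) := by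
  induction L generalizing c with
  | nil =>
    rw [List.prod_nil, LinearMap.convOne_apply]
    exact (Algebra.commutes _ _).symm
  | cons X L ih =>
    rw [List.prod_cons, (ℛ F c).convMul_apply]
    exact Commute.sum_right _ _ _ fun i _ => (h X (by simp) _).mul_right
      (ih (fun Y hY => h Y (by simp [hY])) _)

variable {F H : Type*} [Field F] [Ring H] [HopfAlgebra F H] [FiniteDimensional F H]
  {E : Type*} [DecidableEq E]

local notation "S" => antipode F (A := H)
local notation "H⋆" => Module.Dual F H
local notation "ℌ" => HopfMaps.heisenberg (HopfMaps.of F H)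
local notation "𝔻⋆" => HopfMaps.drinfeldDoubleDual (HopfMaps.of F H)

/-- The tensor power of the endomorphism algebra of `H`, isomorphic to the tensor power of the
Heisenberg double. It is a definition of its own so that its module structure is found through
the algebra structure only. -/
def EndPow (F H E : Type*) [Field F] [Ring H] [HopfAlgebra F H] : Type _ :=
  ⨂[F] _ : E, Module.End F H

instance : Ring (EndPow F H E) := inferInstanceAs (Ring (⨂[F] _ : E, Module.End F H))

instance : Algebra F (EndPow F H E) := inferInstanceAs (Algebra F (⨂[F] _ : E, Module.End F H))

/-- The pure tensors in the tensor power of the endomorphism algebra. -/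
def EndPow.tprod (x : E → Module.End F H) : EndPow F H E := PiTensorProduct.tprod F x

theorem EndPow.tprod_mul_tprod (x y : E → Module.End F H) :
    EndPow.tprod x * EndPow.tprod y = EndPow.tprod (x * y) :=
  PiTensorProduct.tprod_mul_tprod x y

/-- The inclusion of the factor of `e`. -/
def single (F H : Type*) {E : Type*} [DecidableEq E] [Field F] [Ring H] [HopfAlgebra F H] (e : E) :
    Module.End F H →ₐ[F] EndPow F H E :=
  PiTensorProduct.singleAlgHom (R := F) (A := fun _ : E => Module.End F H) e

theorem single_apply (e : E) (x : Module.End F H) :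
    single F H e x = EndPow.tprod (Pi.mulSingle (M := fun _ : E => Module.End F H) e x) := rfl

theorem single_commute {e e' : E} (h : e ≠ e') (x y : Module.End F H) :
    Commute (single F H e x) (single F H e' y) := by
  rw [commute_iff_eq]
  simp only [single_apply, EndPow.tprod_mul_tprod]
  congr 1
  exact (Pi.mulSingle_commute (f := fun _ : E => Module.End F H) h x y).eq

variable [InvolutiveAntipode F H]

/-- The isomorphism of `ℋ(H)^{⊗E}` with the tensor power of the endomorphism algebra of `H`. -/
def powEquiv (F H E : Type*) [Field F] [Ring H] [HopfAlgebra F H] [FiniteDimensional F H]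
    [InvolutiveAntipode F H] : HeisenbergPow F H E ≃ₗ[F] EndPow F H E :=
  let f : HeisenbergPow F H E ≃ₗ[F] ⨂[F] _ : E, Module.End F H :=
    PiTensorProduct.congr fun _ => heisenbergEquiv F H
  f

theorem powEquiv_tprod (x : E → H ⊗[F] H⋆) : powEquiv F H E (PiTensorProduct.tprod F x)
    = EndPow.tprod fun e => heisenbergEquiv F H (x e) :=
  PiTensorProduct.congr_tprod _ _

theorem powEquiv_mul (x y : HeisenbergPow F H E) :
    powEquiv F H E (((ℌ).pi E).mul x y) = powEquiv F H E x * powEquiv F H E y := by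
  induction x using PiTensorProduct.induction_on with
  | add x₁ x₂ h₁ h₂ => simp only [map_add, LinearMap.add_apply, h₁, h₂, add_mul]
  | smul_tprod r x =>
    induction y using PiTensorProduct.induction_on with
    | add x₁ x₂ h₁ h₂ => simp only [map_add, h₁, h₂, mul_add]
    | smul_tprod s y =>
      simp only [map_smul, LinearMap.smul_apply, AlgMaps.pi_mul_tprod, powEquiv_tprod,
        heisenbergEquiv_mul, smul_mul_assoc, mul_smul_comm, EndPow.tprod_mul_tprod]
      rfl

theorem powEquiv_one : powEquiv F H E ((ℌ).pi E).one = 1 := by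
  refine (powEquiv_tprod _).trans ?_
  simp only [heisenbergEquiv_one]
  rfl

theorem drinfeldDoubleDual_one : (𝔻⋆).one = (1 : H) ⊗ₜ[F] (1 : H⋆) := rfl

theorem heisenberg_one : (ℌ).one = (1 : H) ⊗ₜ[F] (1 : H⋆) := rfl

theorem powEquiv_incl (e : E) (t : H ⊗[F] H⋆) :
    powEquiv F H E ((𝔻⋆).incl e t) = single F H e (heisenbergEquiv F H t) := by
  rw [AlgMaps.incl_apply, powEquiv_tprod, single_apply]
  congr 1
  funext e'
  by_cases h : e' = e
  · subst h; simp
  · simp only [Function.update_of_ne h, Pi.mulSingle_eq_of_ne h]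
    rw [drinfeldDoubleDual_one, ← heisenberg_one, heisenbergEquiv_one]

theorem drinfeldDoubleDual_one_mul (t : H ⊗[F] H⋆) : (𝔻⋆).mul (𝔻⋆).one t = t := by
  induction t with
  | zero => simp
  | add a c ha hc => simp only [map_add, ha, hc]
  | tmul y γ =>
    refine (AlgMaps.twisted_comm_mul _ _ _ _ _ _).trans ?_
    exact congrArg₂ (· ⊗ₜ[F] ·) (mul_one y) (one_mul γ)

theorem drinfeldDoubleDual_mul_one (t : H ⊗[F] H⋆) : (𝔻⋆).mul t (𝔻⋆).one = t := by
  induction t with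
  | zero => simp
  | add a c ha hc => simp only [map_add, LinearMap.add_apply, ha, hc]
  | tmul y γ =>
    refine (AlgMaps.twisted_comm_mul _ _ _ _ _ _).trans ?_
    exact congrArg₂ (· ⊗ₜ[F] ·) (one_mul y) (mul_one γ)

theorem powEquiv_dual_one : powEquiv F H E ((𝔻⋆).toAlgMaps.pi E).one = 1 := by
  refine (powEquiv_tprod fun _ => (𝔻⋆).one).trans ?_
  simp only [drinfeldDoubleDual_one, ← heisenberg_one, heisenbergEquiv_one]
  rfl

/-- On elements with disjoint supports the multiplications of the tensor powers of `D(H)^*` and of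
`ℋ(H)` agree. -/
theorem powEquiv_dual_mul {s t : Set E} (hst : Disjoint s t) {x y : HeisenbergPow F H E}
    (hx : x ∈ (𝔻⋆).supported s) (hy : y ∈ (𝔻⋆).supported t) :
    powEquiv F H E (((𝔻⋆).toAlgMaps.pi E).mul x y) = powEquiv F H E x * powEquiv F H E y ∧
      ((𝔻⋆).toAlgMaps.pi E).mul x y ∈ (𝔻⋆).supported (s ∪ t) := by
  have h := AlgMaps.pi_mul_eq_of_disjoint (a := (𝔻⋆).toAlgMaps) (b := ℌ)
    (drinfeldDoubleDual_one.trans heisenberg_one.symm) drinfeldDoubleDual_one_mul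
    drinfeldDoubleDual_mul_one heisenberg_isAlgebra.one_mul heisenberg_isAlgebra.mul_one hst hx hy
  exact ⟨by rw [h.1, powEquiv_mul], h.2⟩

theorem powEquiv_mulT {s t : Set E} (hst : Disjoint s t)
    {f g : H ⊗[F] H⋆ →ₗ[F] HeisenbergPow F H E} (hf : ∀ x, f x ∈ (𝔻⋆).supported s)
    (hg : ∀ x, g x ∈ (𝔻⋆).supported t) (u : (H ⊗[F] H⋆) ⊗[F] (H ⊗[F] H⋆)) :
    powEquiv F H E (((𝔻⋆).toAlgMaps.pi E).mulT (TensorProduct.map f g u))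
      = LinearMap.mul' F (EndPow F H E) (TensorProduct.map ((powEquiv F H E).toLinearMap ∘ₗ f)
        ((powEquiv F H E).toLinearMap ∘ₗ g) u) ∧
      ((𝔻⋆).toAlgMaps.pi E).mulT (TensorProduct.map f g u) ∈ (𝔻⋆).supported (s ∪ t) := by
  induction u with
  | zero => simp
  | add a c ha hc =>
    simp only [map_add, ha.1, hc.1, true_and]
    exact add_mem ha.2 hc.2
  | tmul a c => exact powEquiv_dual_mul hst (hf a) (hg c)

/-! ### Holonomies -/

/-- The algebra homomorphism by which `H` acts at an edge end: left multiplication at the target of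
the edge, right multiplication by the antipode at its start. -/
def endB (F H : Type*) {E : Type*} [DecidableEq E] [Field F] [Ring H] [HopfAlgebra F H] (d : E × Bool) :
    H →ₐ[F] EndPow F H E :=
  (single F H d.1).comp (bif d.2 then opL F H else opR F H)

/-- The algebra homomorphism by which `H^*` acts along an oriented edge, identified with the edge end
at which it departs: through the right coaction along the edge, through the left one against it. -/
def edgeA (F H : Type*) {E : Type*} [DecidableEq E] [Field F] [Ring H] [HopfAlgebra F H]
    [FiniteDimensional F H] [InvolutiveAntipode F H] (d : E × Bool) :
    Module.Dual F H →ₐ[F] EndPow F H E :=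
  (single F H d.1).comp (bif d.2 then opRhoL F H else opRhoR F H)

theorem holRBar_eq (t : H ⊗[F] H⋆) : (HopfMaps.of F H).holRBar t = projFst F H t ⊗ₜ (1 : H⋆) := by
  induction t with
  | zero => simp
  | add a c ha hc => simp only [map_add, add_tmul, ha, hc]
  | tmul y γ =>
    rw [projFst_tmul, smul_tmul]
    rfl

theorem holR_eq (t : H ⊗[F] H⋆) : (HopfMaps.of F H).holR t = (1 : H) ⊗ₜ projSnd F H t := by
  induction t with
  | zero => simp
  | add a c ha hc => simp only [map_add, tmul_add, ha, hc]
  | tmul y γ =>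
    rw [projSnd_tmul, ← smul_tmul]
    rfl

/-- The letter of a vertex loop for an edge end. -/
abbrev vertexLetter (d : E × Bool) : ThickEdge E × Bool :=
  bif d.2 then (.rBar d.1, true) else (.lBar d.1, false)

/-- The letter of a face loop for an oriented edge. -/
abbrev faceLetter (d : E × Bool) : ThickEdge E × Bool :=
  bif d.2 then (.l d.1, false) else (.r d.1, true)

theorem holLetter_vertexLetter (d : E × Bool) (t : H ⊗[F] H⋆) :
    (HopfMaps.of F H).holLetter (vertexLetter d) t ∈ (𝔻⋆).supported {d.1} ∧
    powEquiv F H E ((HopfMaps.of F H).holLetter (vertexLetter d) t) = endB F H d (projFst F H t) := by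
  obtain ⟨e, o⟩ := d
  cases o
  · have h : (HopfMaps.of F H).holLetter (vertexLetter (e, false)) t
        = (𝔻⋆).incl e ((𝔻⋆).antipode (projFst F H t ⊗ₜ (1 : H⋆))) := by
      have h1 : (HopfMaps.of F H).holLetter (vertexLetter (e, false)) t = (𝔻⋆).incl e ((𝔻⋆).antipode
        ((HopfMaps.of F H).holRBar ((𝔻⋆).antipode ((𝔻⋆).antipode t)))) := rfl
      rw [h1, holRBar_eq, projFst_antipode, projFst_antipode, antipode_antipode]
    rw [h]
    refine ⟨AlgMaps.incl_mem_supported _ _ _, ?_⟩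
    rw [powEquiv_incl, heisenbergEquiv_antipode, map_one, mul_one]
    rfl
  · have h : (HopfMaps.of F H).holLetter (vertexLetter (e, true)) t
        = (𝔻⋆).incl e (projFst F H t ⊗ₜ (1 : H⋆)) := by
      rw [← holRBar_eq]
      rfl
    rw [h]
    refine ⟨AlgMaps.incl_mem_supported _ _ _, ?_⟩
    rw [powEquiv_incl, heisenbergEquiv_tmul, map_one, mul_one]
    rfl

theorem holLetter_faceLetter (d : E × Bool) (t : H ⊗[F] H⋆) :
    (HopfMaps.of F H).holLetter (faceLetter d) t ∈ (𝔻⋆).supported {d.1} ∧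
    powEquiv F H E ((HopfMaps.of F H).holLetter (faceLetter d) t) = edgeA F H d (projSnd F H t) := by
  obtain ⟨e, o⟩ := d
  cases o
  · have h : (HopfMaps.of F H).holLetter (faceLetter (e, false)) t
        = (𝔻⋆).incl e ((1 : H) ⊗ₜ projSnd F H t) := by
      rw [← holR_eq]
      rfl
    rw [h]
    refine ⟨AlgMaps.incl_mem_supported _ _ _, ?_⟩
    rw [powEquiv_incl, heisenbergEquiv_tmul, map_one, one_mul]
    rfl
  · have h : (HopfMaps.of F H).holLetter (faceLetter (e, true)) t
        = (𝔻⋆).incl e ((𝔻⋆).antipode ((1 : H) ⊗ₜ projSnd F H t)) := by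
      have h1 : (HopfMaps.of F H).holLetter (faceLetter (e, true)) t = (𝔻⋆).incl e ((𝔻⋆).antipode
        ((HopfMaps.of F H).holR ((𝔻⋆).antipode ((𝔻⋆).antipode t)))) := rfl
      rw [h1, holR_eq, projSnd_antipode, projSnd_antipode, antipode_antipode]
    rw [h]
    refine ⟨AlgMaps.incl_mem_supported _ _ _, ?_⟩
    rw [powEquiv_incl, heisenbergEquiv_antipode, map_one, one_mul]
    rfl

/-- The holonomy of a vertex loop is the convolution product of the actions at the edge ends. -/
theorem hol_vertexWord (L : List (E × Bool)) (hL : (L.map Prod.fst).Nodup) (t : H ⊗[F] H⋆) :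
    (HopfMaps.of F H).hol (L.map vertexLetter) t ∈ (𝔻⋆).supported {e | e ∈ L.map Prod.fst} ∧
    powEquiv F H E ((HopfMaps.of F H).hol (L.map vertexLetter) t)
      = (L.map fun d => toConv (endB F H d).toLinearMap).prod (projFst F H t) := by
  induction L generalizing t with
  | nil =>
    rw [List.map_nil (f := vertexLetter), HopfMaps.hol_nil_apply]
    refine ⟨Submodule.smul_mem _ _ (AlgMaps.one_mem_supported _ _), ?_⟩
    rw [map_smul, drinfeldDoubleDual_counit_eq_fst, powEquiv_dual_one,
      List.map_nil, List.prod_nil, LinearMap.convOne_apply, Algebra.algebraMap_eq_smul_one]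
  | cons d L ih =>
    simp only [List.map_cons, List.nodup_cons] at hL
    have ih := ih hL.2
    have h1 := powEquiv_mulT (s := {d.1}) (t := {e | e ∈ L.map Prod.fst})
      (Set.disjoint_singleton_left.mpr hL.1) (fun x => (holLetter_vertexLetter d x).1)
      (fun x => (ih x).1) ((𝔻⋆).comul t)
    rw [List.map_cons (f := vertexLetter), HopfMaps.hol_cons_apply]
    refine ⟨?_, ?_⟩
    · convert h1.2 using 2
      ext e
      simp
    · rw [h1.1]
      have h2 : (powEquiv F H E).toLinearMap ∘ₗ (HopfMaps.of F H).holLetter (vertexLetter d)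
          = (endB F H d).toLinearMap ∘ₗ projFst F H :=
        LinearMap.ext fun x => (holLetter_vertexLetter d x).2
      have h3 : (powEquiv F H E).toLinearMap ∘ₗ (HopfMaps.of F H).hol (L.map vertexLetter)
          = (L.map fun d => toConv (endB F H d).toLinearMap).prod.ofConv ∘ₗ projFst F H :=
        LinearMap.ext fun x => (ih x).2
      rw [h2, h3, TensorProduct.map_comp, LinearMap.comp_apply, projFst_comul, List.map_cons,
        List.prod_cons]
      exact (LinearMap.convMul_apply _ _ _).symm

theorem edgeA_commute {d d' : E × Bool} (h : d.1 ≠ d'.1) (α β : H⋆) :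
    Commute (edgeA F H d α) (edgeA F H d' β) := single_commute h _ _

theorem edgeA_commute_prod {d : E × Bool} {L : List (E × Bool)} (h : ∀ d' ∈ L, d.1 ≠ d'.1)
    (α β : H⋆) : Commute (edgeA F H d α)
      ((L.map fun d => toConv (edgeA F H d).toLinearMap).prod β) := by
  refine commute_conv_prod (L := L.map fun d => toConv (edgeA F H d).toLinearMap) ?_ β
  intro X hX c
  obtain ⟨d', hd', rfl⟩ := List.mem_map.mp hX
  exact edgeA_commute (h d' hd') α c

/-- The holonomy of a face loop is the convolution product of the actions along its edges, in the
order in which they are traversed, in the convolution algebra for the co-opposite of `H^*`. -/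
theorem hol_faceWord (L : List (E × Bool)) (hL : (L.map Prod.fst).Nodup) (t : H ⊗[F] H⋆) :
    (HopfMaps.of F H).hol (L.map faceLetter) t ∈ (𝔻⋆).supported {e | e ∈ L.map Prod.fst} ∧
    powEquiv F H E ((HopfMaps.of F H).hol (L.map faceLetter) t)
      = (L.reverse.map fun d => toConv (edgeA F H d).toLinearMap).prod (projSnd F H t) := by
  induction L generalizing t with
  | nil =>
    rw [List.map_nil (f := faceLetter), HopfMaps.hol_nil_apply]
    refine ⟨Submodule.smul_mem _ _ (AlgMaps.one_mem_supported _ _), ?_⟩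
    rw [map_smul, drinfeldDoubleDual_counit_eq_snd, powEquiv_dual_one,
      List.reverse_nil, List.map_nil, List.prod_nil, LinearMap.convOne_apply,
      Algebra.algebraMap_eq_smul_one]
    rfl
  | cons d L ih =>
    simp only [List.map_cons, List.nodup_cons] at hL
    have ih := ih hL.2
    have h1 := powEquiv_mulT (s := {d.1}) (t := {e | e ∈ L.map Prod.fst})
      (Set.disjoint_singleton_left.mpr hL.1) (fun x => (holLetter_faceLetter d x).1)
      (fun x => (ih x).1) ((𝔻⋆).comul t)
    rw [List.map_cons (f := faceLetter), HopfMaps.hol_cons_apply]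
    refine ⟨?_, ?_⟩
    · convert h1.2 using 2
      ext e
      simp
    · rw [h1.1]
      set W := (L.reverse.map fun d => toConv (edgeA F H d).toLinearMap).prod with hW
      have h2 : (powEquiv F H E).toLinearMap ∘ₗ (HopfMaps.of F H).holLetter (faceLetter d)
          = (edgeA F H d).toLinearMap ∘ₗ projSnd F H :=
        LinearMap.ext fun x => (holLetter_faceLetter d x).2
      have h3 : (powEquiv F H E).toLinearMap ∘ₗ (HopfMaps.of F H).hol (L.map faceLetter)
          = W.ofConv ∘ₗ projSnd F H :=
        LinearMap.ext fun x => (ih x).2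
      rw [h2, h3, TensorProduct.map_comp, LinearMap.comp_apply, projSnd_comul]
      generalize projSnd F H t = δ
      have hcomm : ∀ α β, Commute (edgeA F H d α) (W β) := fun α β =>
        edgeA_commute_prod (fun d' hd' h => hL.1 (h ▸ List.mem_map_of_mem (List.mem_reverse.mp hd')))
          α β
      have h4 : (HopfMaps.of F H).dual.comul δ = TensorProduct.comm F H⋆ H⋆ (comul δ) := by
        rw [comul_def']
        exact ((TensorProduct.comm F H⋆ H⋆).symm_apply_apply _).symm
      rw [List.reverse_cons, List.map_append, List.prod_append, ← hW, List.map_singleton,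
        List.prod_singleton, (ℛ F δ).convMul_apply, h4, ← (ℛ F δ).eq]
      simp only [map_sum, TensorProduct.comm_tmul, TensorProduct.map_tmul, LinearMap.mul'_apply]
      exact Finset.sum_congr rfl fun i _ => (hcomm ((ℛ F δ).right i) ((ℛ F δ).left i)).eq

end DualHopf

/-! ### Faces of regular ciliated ribbon graphs -/

namespace CiliatedRibbonGraph

variable {V E : Type*} (Γ : CiliatedRibbonGraph V E)

theorem mem_ends_iff {v : V} {d : E × Bool} : d ∈ Γ.ends v ↔ Γ.vert d = v := by
  obtain ⟨e, o⟩ := d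
  cases o
  · exact Γ.start_mem_ends v e
  · exact Γ.target_mem_ends v e

theorem opp_opp (d : E × Bool) : opp (opp d) = d := by
  simp [opp]

theorem eq_or_eq_opp_of_fst_eq {d d' : E × Bool} (h : d.1 = d'.1) : d = d' ∨ d = opp d' := by
  obtain ⟨e, o⟩ := d
  obtain ⟨e', o'⟩ := d'
  subst h
  cases o <;> cases o' <;> simp [opp]

/-- A corner of a face that does not contain the cilium: the oriented edge `d` arrives with an
edge end that is directly followed, in the linear order, by the edge end where `d'` departs. -/
def Corner (d d' : E × Bool) : Prop :=
  ∃ w l₁ l₂, Γ.ends w = l₁ ++ opp d :: d' :: l₂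

variable [DecidableEq E]

theorem faceNext_mem_ends (d : E × Bool) : Γ.faceNext d ∈ Γ.ends (Γ.vert (opp d)) :=
  List.formPerm_apply_mem_of_mem (Γ.mem_ends_iff.mpr rfl)

theorem vert_faceNext (d : E × Bool) : Γ.vert (Γ.faceNext d) = Γ.vert (opp d) :=
  Γ.mem_ends_iff.mp (Γ.faceNext_mem_ends d)

theorem faceNext_injective : Function.Injective Γ.faceNext := by
  intro d d' h
  have h1 : Γ.vert (opp d) = Γ.vert (opp d') := by
    rw [← vert_faceNext, ← vert_faceNext, h]
  unfold faceNext at h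
  rw [h1] at h
  have h2 := congrArg opp ((List.formPerm _).injective h)
  rwa [opp_opp, opp_opp] at h2

/-- The oriented edges of the face of the cilium at `v`, in the order in which they are
traversed. -/
def traversal (v : V) : List (E × Bool) := (Γ.ciliatedFace v).reverse

theorem traversal_of_ends_eq_nil {v : V} (h : Γ.ends v = []) : Γ.traversal v = [] := by
  simp [traversal, ciliatedFace, h]

theorem traversal_of_ends_eq_cons {v : V} {c : E × Bool} {l : List (E × Bool)}
    (h : Γ.ends v = c :: l) : Γ.traversal v
      = (List.range (Function.minimalPeriod Γ.faceNext c)).map (fun i => Γ.faceNext^[i] c) := by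
  simp [traversal, ciliatedFace, h]

theorem ciliumInFace_of_mem_traversal {v : V} {d : E × Bool} (h : d ∈ Γ.traversal v) :
    Γ.CiliumInFace v d := by
  cases hv : Γ.ends v with
  | nil => simp [Γ.traversal_of_ends_eq_nil hv] at h
  | cons c l =>
    rw [Γ.traversal_of_ends_eq_cons hv] at h
    obtain ⟨n, -, hn⟩ := List.mem_map.mp h
    exact ⟨c, by rw [hv]; rfl, n, hn⟩

/-- The oriented edge after one that arrives with the last edge end of `w` is the first one
at `w`; otherwise they form a corner without cilium. -/
theorem corner_or_of_faceNext (d : E × Bool) : Γ.Corner d (Γ.faceNext d) ∨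
    ∃ w l l', Γ.ends w = l ++ [opp d] ∧ Γ.ends w = Γ.faceNext d :: l' := by
  obtain ⟨l₁, l₂, h⟩ := List.append_of_mem (Γ.mem_ends_iff.mpr rfl : opp d ∈ Γ.ends (Γ.vert (opp d)))
  have hnd := Γ.ends_nodup (Γ.vert (opp d))
  cases l₂ with
  | nil =>
    right
    refine ⟨Γ.vert (opp d), l₁, ?_⟩
    cases l₁ with
    | nil =>
      refine ⟨[], h, ?_⟩
      rw [faceNext, h]
      simp
    | cons c l =>
      refine ⟨l ++ [opp d], h, ?_⟩
      rw [faceNext, h]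
      simp
  | cons a l₂ =>
    left
    refine ⟨Γ.vert (opp d), l₁, l₂, ?_⟩
    rw [h]
    congr 2
    rw [faceNext, h]
    rw [h] at hnd
    have h1 := List.formPerm_apply_lt_getElem _ hnd l₁.length (by simp)
    have e1 : (l₁ ++ opp d :: a :: l₂)[l₁.length]'(by simp) = opp d := by simp
    have e2 : (l₁ ++ opp d :: a :: l₂)[l₁.length + 1]'(by simp) = a := by simp
    rw [e1, e2] at h1
    rw [h1]

variable {Γ}

namespace IsRegular

theorem vert_opp_ne (hΓ : Γ.IsRegular) (d : E × Bool) : Γ.vert (opp d) ≠ Γ.vert d := by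
  obtain ⟨e, o⟩ := d
  cases o
  · exact (hΓ.no_loops e).symm
  · exact hΓ.no_loops e

theorem nodup_ends_fst (hΓ : Γ.IsRegular) (v : V) : ((Γ.ends v).map Prod.fst).Nodup := by
  refine List.Nodup.map_on ?_ (Γ.ends_nodup v)
  intro d hd d' hd' h
  rcases eq_or_eq_opp_of_fst_eq h with h | h
  · exact h
  · rw [Γ.mem_ends_iff] at hd hd'
    exact absurd (by rw [← h, hd, hd']) (hΓ.vert_opp_ne d')

theorem eq_of_ciliumInFace (hΓ : Γ.IsRegular) {v w : V} {d : E × Bool} (hv : Γ.CiliumInFace v d)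
    (hw : Γ.CiliumInFace w d) : v = w :=
  (hΓ.face_has_one_cilium d).unique hv hw

theorem traversal_disjoint (hΓ : Γ.IsRegular) {v w : V} (h : v ≠ w) {d : E × Bool} (hd : d ∈ Γ.traversal v) :
    d ∉ Γ.traversal w := fun hd' =>
  h (hΓ.eq_of_ciliumInFace (Γ.ciliumInFace_of_mem_traversal hd) (Γ.ciliumInFace_of_mem_traversal hd'))

/-- A face traverses each edge at most once. -/
theorem nodup_traversal_fst (hΓ : Γ.IsRegular) (v : V) : ((Γ.traversal v).map Prod.fst).Nodup := by
  cases hv : Γ.ends v with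
  | nil => simp [Γ.traversal_of_ends_eq_nil hv]
  | cons c l =>
    rw [Γ.traversal_of_ends_eq_cons hv, List.map_map]
    refine List.Nodup.map_on ?_ List.nodup_range
    intro i hi j hj h
    rw [List.mem_range] at hi hj
    have key : ∀ i j, (Γ.faceNext^[i] c).1 = (Γ.faceNext^[j] c).1 → i ≤ j →
        Γ.faceNext^[i] c = Γ.faceNext^[j] c := by
      intro i j h hij
      rcases eq_or_eq_opp_of_fst_eq h with h | h
      · exact h
      · obtain ⟨k, rfl⟩ := Nat.exists_eq_add_of_le hij
        have h2 := hΓ.face_traverses_edge_once (Γ.faceNext^[i] c) k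
        rw [← Function.iterate_add_apply, add_comm k i] at h2
        rw [h, opp_opp] at h2
        exact absurd rfl h2
    have h' : Γ.faceNext^[i] c = Γ.faceNext^[j] c := by
      rcases le_total i j with hij | hij
      · exact key i j h hij
      · exact (key j i h.symm hij).symm
    exact (Function.iterate_eq_iterate_iff_of_lt_minimalPeriod hi hj).mp h'

/-- All corners of the face of the cilium at `v`, apart from that of its end and start, are without
cilium. -/
theorem isChain_traversal (hΓ : Γ.IsRegular) (v : V) : (Γ.traversal v).IsChain Γ.Corner := by
  cases hv : Γ.ends v with
  | nil => simp [Γ.traversal_of_ends_eq_nil hv]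
  | cons c l =>
    rw [Γ.traversal_of_ends_eq_cons hv, List.isChain_map, List.isChain_range]
    intro i hi
    rcases Γ.corner_or_of_faceNext (Γ.faceNext^[i] c) with h | ⟨w, l₁, l₂, h₁, h₂⟩
    · rwa [← Function.iterate_succ_apply' Γ.faceNext i c] at h
    · exfalso
      rw [← Function.iterate_succ_apply' Γ.faceNext i c] at h₂
      have hw : Γ.CiliumInFace w (Γ.faceNext^[i + 1] c) := ⟨_, by rw [h₂]; rfl, 0, rfl⟩
      have hv' : Γ.CiliumInFace v (Γ.faceNext^[i + 1] c) := ⟨c, by rw [hv]; rfl, i + 1, rfl⟩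
      obtain rfl := hΓ.eq_of_ciliumInFace hv' hw
      rw [hv] at h₂
      have h3 : Γ.faceNext^[i + 1] c = Γ.faceNext^[0] c := (List.cons.inj h₂).1.symm
      have h4 := (Function.iterate_eq_iterate_iff_of_lt_minimalPeriod
        (by omega) (by omega)).mp h3
      omega

end IsRegular

/-- The face of the cilium at `v` departs with the first edge end at `v`, and arrives at `v` with the
last one. -/
theorem exists_traversal_eq [Finite E] {v : V} {c : E × Bool} {l : List (E × Bool)}
    (hv : Γ.ends v = c :: l) : ∃ t d l', Γ.traversal v = c :: t ∧ (c :: t).getLast (by simp) = d ∧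
      Γ.ends v = l' ++ [opp d] := by
  have hc : c ∈ Function.periodicPts Γ.faceNext := Γ.faceNext_injective.mem_periodicPts c
  have hpos := Function.minimalPeriod_pos_of_mem_periodicPts hc
  obtain ⟨n, hn⟩ := Nat.exists_eq_succ_of_ne_zero hpos.ne'
  have h1 := Γ.traversal_of_ends_eq_cons hv
  rw [hn] at h1
  have h2 : Γ.traversal v = c :: (List.range n).map (fun i => Γ.faceNext^[i + 1] c) := by
    rw [h1, List.range_succ_eq_map, List.map_cons, List.map_map]
    rfl
  refine ⟨(List.range n).map (fun i => Γ.faceNext^[i + 1] c), Γ.faceNext^[n] c, ?_⟩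
  have h3 : Γ.faceNext (Γ.faceNext^[n] c) = c := by
    rw [← Function.iterate_succ_apply' Γ.faceNext n c, ← hn]
    exact Function.iterate_minimalPeriod
  rcases Γ.corner_or_of_faceNext (Γ.faceNext^[n] c) with ⟨w, l₁, l₂, h⟩ | ⟨w, l₁, l₂, h₁, h₂⟩
  · exfalso
    rw [h3] at h
    have hw : c ∈ Γ.ends w := by rw [h]; simp
    have hv' : c ∈ Γ.ends v := by rw [hv]; simp
    rw [Γ.mem_ends_iff] at hw hv'
    obtain rfl : w = v := hw.symm.trans hv'
    have hnd := Γ.ends_nodup w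
    have h4 := h.symm.trans hv
    rw [h] at hnd
    cases l₁ with
    | nil =>
      have := (List.cons.inj h4).1
      simp [this] at hnd
    | cons a l₁ =>
      have := (List.cons.inj h4).1
      simp [this] at hnd
  · rw [h3] at h₂
    have hw : c ∈ Γ.ends w := by rw [h₂]; simp
    have hv' : c ∈ Γ.ends v := by rw [hv]; simp
    rw [Γ.mem_ends_iff] at hw hv'
    obtain rfl : w = v := hw.symm.trans hv'
    refine ⟨l₁, h2, ?_, h₁⟩
    have h5 : Γ.traversal w = (List.range n).map (fun i => Γ.faceNext^[i] c) ++ [Γ.faceNext^[n] c] := by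
      rw [h1, List.range_succ, List.map_append]
      rfl
    have h6 := h2.symm.trans h5
    simp only [h6, List.getLast_append_singleton]

end CiliatedRibbonGraph

/-! ### Moving a face loop across a vertex loop -/

namespace CiliatedRibbonGraph

variable {V E K : Type*} {Γ : CiliatedRibbonGraph V E} [DecidableEq E] [Ring K]

/-- Commutation relations, in a ring, between elements `a d` for the oriented edges and elements
`b d` for the edge ends: `a d` commutes with the `b d'` of the other edges, and an invertible
element `p`, or its inverse `q`, appears when it passes the edge end at which `d` arrives or departs. -/
structure EdgeRelations (a b : E × Bool → K) (p q : K) : Prop where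
  mul_inv : p * q = 1
  dep : ∀ d, a d * b d = q * (b d * a d)
  arr : ∀ d, a d * b (opp d) = b (opp d) * a d * p
  comm : ∀ d d', d.1 ≠ d'.1 → Commute (a d) (b d')

namespace EdgeRelations

variable {a b : E × Bool → K} {p q : K}

theorem commute_prod (h : EdgeRelations a b p q) {d : E × Bool} {L : List (E × Bool)}
    (hL : ∀ d' ∈ L, d.1 ≠ d'.1) : Commute (a d) (L.map b).prod := by
  refine Commute.list_prod_right _ _ fun x hx => ?_
  obtain ⟨d', hd', rfl⟩ := List.mem_map.mp hx
  exact h.comm d d' (hL d' hd')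

theorem commute_of_vert_ne (h : EdgeRelations a b p q) {d : E × Bool} {w : V} (h₁ : Γ.vert d ≠ w)
    (h₂ : Γ.vert (opp d) ≠ w) : Commute (a d) ((Γ.ends w).map b).prod := by
  refine h.commute_prod fun d' hd' he => ?_
  have hd' := Γ.mem_ends_iff.mp hd'
  rcases eq_or_eq_opp_of_fst_eq he with rfl | rfl
  · exact h₁ hd'
  · exact h₂ (by rw [opp_opp, hd'])

/-- The edges at the other ends of a vertex are different from that of `d`. -/
theorem fst_ne_of_ends_eq (hΓ : Γ.IsRegular) {w : V} {d : E × Bool} {L₁ L₂ : List (E × Bool)}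
    (h : Γ.ends w = L₁ ++ d :: L₂) : (∀ d' ∈ L₁, d.1 ≠ d'.1) ∧ ∀ d' ∈ L₂, d.1 ≠ d'.1 := by
  have hnd := hΓ.nodup_ends_fst w
  rw [h, List.map_append, List.map_cons, List.nodup_append, List.nodup_cons] at hnd
  refine ⟨fun d' hd' he => ?_, fun d' hd' he => ?_⟩
  · exact hnd.2.2 d'.1 (List.mem_map_of_mem hd') d.1 (by simp) he.symm
  · exact hnd.2.1.1 (he ▸ List.mem_map_of_mem hd')

/-- Moving an edge across the loop of the vertex at which it departs. -/
theorem mul_prod_of_dep (h : EdgeRelations a b p q) (hΓ : Γ.IsRegular) {w : V} {d : E × Bool}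
    {L₁ L₂ : List (E × Bool)} (hw : Γ.ends w = L₁ ++ d :: L₂) :
    a d * ((Γ.ends w).map b).prod = (L₁.map b).prod * q * b d * (L₂.map b).prod * a d := by
  obtain ⟨h₁, h₂⟩ := fst_ne_of_ends_eq hΓ hw
  rw [hw, List.map_append, List.prod_append, List.map_cons, List.prod_cons, ← mul_assoc,
    (h.commute_prod h₁).eq, mul_assoc, ← mul_assoc (a d), h.dep d]
  simp only [mul_assoc]
  rw [(h.commute_prod h₂).eq]

/-- The product along a path without cilia, moved across the loop of the vertex `w`. The two
statements are for a path that departs from `w` with the edge end `d` or from another vertex,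
and the factor `r` is that of its arrival. -/
theorem prod_mul_prod (h : EdgeRelations a b p q) (hΓ : Γ.IsRegular) {w : V} {r : K}
    (d : E × Bool) (t : List (E × Bool)) (ht : (d :: t).IsChain Γ.Corner)
    (hr : (∃ l, Γ.ends w = l ++ [opp ((d :: t).getLast (by simp))]) ∧ r = p ∨
      Γ.vert (opp ((d :: t).getLast (by simp))) ≠ w ∧ r = 1) :
    (∀ L₁ L₂, Γ.ends w = L₁ ++ d :: L₂ → ((d :: t).map a).prod * ((Γ.ends w).map b).prod
      = (L₁.map b).prod * q * b d * (L₂.map b).prod * ((d :: t).map a).prod * r) ∧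
    (Γ.vert d ≠ w → ((d :: t).map a).prod * ((Γ.ends w).map b).prod
      = ((Γ.ends w).map b).prod * ((d :: t).map a).prod * r) := by
  induction t generalizing d with
  | nil =>
    simp only [List.getLast_singleton] at hr
    simp only [List.map_singleton, List.prod_singleton]
    rcases hr with ⟨⟨l, hl⟩, rfl⟩ | ⟨hne, rfl⟩
    · have hw : Γ.vert (opp d) = w := by rw [← Γ.mem_ends_iff, hl]; simp
      refine ⟨fun L₁ L₂ hL => ?_, fun _ => ?_⟩
      · have hw' : Γ.vert d = w := by rw [← Γ.mem_ends_iff, hL]; simp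
        exact absurd (hw.trans hw'.symm) (hΓ.vert_opp_ne d)
      · rw [hl, List.map_append, List.prod_append, List.map_singleton, List.prod_singleton,
          ← mul_assoc, (h.commute_prod (fst_ne_of_ends_eq hΓ hl).1 : Commute (a d) _).eq,
          mul_assoc, h.arr]
        simp only [mul_assoc]
    · refine ⟨fun L₁ L₂ hL => ?_, fun hd => ?_⟩
      · rw [mul_one, h.mul_prod_of_dep hΓ hL]
      · rw [mul_one, (h.commute_of_vert_ne hd hne).eq]
  | cons d' t ih =>
    obtain ⟨hc, ht⟩ := List.isChain_cons_cons.mp ht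
    have ih := ih d' ht (by simpa only [List.getLast_cons_cons] using hr)
    rw [List.map_cons (a := d), List.prod_cons]
    set X := ((d' :: t).map a).prod
    obtain ⟨u, l₁, l₂, hu⟩ := hc
    have hu₁ : Γ.vert (opp d) = u := by rw [← Γ.mem_ends_iff, hu]; simp
    have hu₂ : Γ.vert d' = u := by rw [← Γ.mem_ends_iff, hu]; simp
    have hdu : Γ.vert d ≠ u := fun hd => hΓ.vert_opp_ne d (hu₁.trans hd.symm)
    by_cases hw : u = w
    · subst hw
      refine ⟨fun L₁ L₂ hL => ?_, fun _ => ?_⟩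
      · exact absurd (by rw [← Γ.mem_ends_iff, hL]; simp) hdu
      · have h₁ := fst_ne_of_ends_eq hΓ hu
        have c₁ : Commute (a d) (l₁.map b).prod := h.commute_prod h₁.1
        have c₂ : Commute (a d) ((d' :: l₂).map b).prod := h.commute_prod h₁.2
        have e := ih.1 (l₁ ++ [opp d]) l₂ (by simp [hu])
        rw [mul_assoc, e, hu]
        simp only [List.map_append, List.prod_append, List.map_cons, List.prod_cons, List.map_nil,
          List.prod_nil, mul_one] at c₂ ⊢
        -- the factors of `d` arriving and of `d'` departing cancel
        calc a d * ((l₁.map b).prod * b (opp d) * q * b d' * (l₂.map b).prod * X * r)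
            = (a d * (l₁.map b).prod) * b (opp d) * q * (b d' * (l₂.map b).prod) * X * r := by
              simp only [mul_assoc]
          _ = (l₁.map b).prod * (a d * b (opp d)) * q * (b d' * (l₂.map b).prod) * X * r := by
              rw [c₁.eq]; simp only [mul_assoc]
          _ = (l₁.map b).prod * b (opp d) * a d * (p * q) * (b d' * (l₂.map b).prod) * X * r := by
              rw [h.arr]; simp only [mul_assoc]
          _ = (l₁.map b).prod * b (opp d) * (a d * (b d' * (l₂.map b).prod)) * X * r := by
              rw [h.mul_inv]; simp only [mul_assoc, mul_one]
          _ = _ := by rw [c₂.eq]; simp only [mul_assoc]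
    · have e := ih.2 (by rwa [hu₂])
      refine ⟨fun L₁ L₂ hL => ?_, fun hd => ?_⟩
      · rw [mul_assoc, e, mul_assoc _ X, ← mul_assoc, h.mul_prod_of_dep hΓ hL]
        simp only [mul_assoc]
      · rw [mul_assoc, e, mul_assoc _ X, ← mul_assoc,
          (h.commute_of_vert_ne hd (by rwa [hu₁])).eq]
        simp only [mul_assoc]

variable [Finite E]

/-- A face commutes with the loops of the vertices other than that of its cilium. -/
theorem traversal_commute (h : EdgeRelations a b p q) (hΓ : Γ.IsRegular) {v w : V} (hvw : v ≠ w) :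
    Commute ((Γ.traversal v).map a).prod ((Γ.ends w).map b).prod := by
  cases hv : Γ.ends v with
  | nil =>
    rw [Γ.traversal_of_ends_eq_nil hv]
    exact Commute.one_left _
  | cons c l =>
    obtain ⟨t, d, l', ht, hd, hl'⟩ := exists_traversal_eq hv
    have hch := hΓ.isChain_traversal v
    rw [ht] at hch ⊢
    have hc : Γ.vert c = v := by rw [← Γ.mem_ends_iff, hv]; simp
    have hd' : Γ.vert (opp d) = v := by rw [← Γ.mem_ends_iff, hl']; simp
    have e := (h.prod_mul_prod hΓ (w := w) (r := 1) c t hch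
      (Or.inr ⟨by rw [hd, hd']; exact hvw, rfl⟩)).2 (by rwa [hc])
    rw [mul_one] at e
    exact e

/-- Moving a face across the loop of the vertex of its cilium conjugates by `p`. -/
theorem traversal_mul_prod (h : EdgeRelations a b p q) (hqp : q * p = 1) (hΓ : Γ.IsRegular) (v : V) :
    ((Γ.traversal v).map a).prod * ((Γ.ends v).map b).prod
      = q * (((Γ.ends v).map b).prod * ((Γ.traversal v).map a).prod) * p := by
  cases hv : Γ.ends v with
  | nil => simp [Γ.traversal_of_ends_eq_nil hv, hqp]
  | cons c l =>
    obtain ⟨t, d, l', ht, hd, hl'⟩ := exists_traversal_eq hv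
    have hch := hΓ.isChain_traversal v
    rw [ht] at hch ⊢
    have e := (h.prod_mul_prod hΓ (w := v) (r := p) c t hch
      (Or.inl ⟨⟨l', by rw [hd]; exact hl'⟩, rfl⟩)).1 [] l hv
    rw [← hv, e, hv]
    simp only [List.map_nil, List.prod_nil, one_mul, List.map_cons, List.prod_cons, mul_assoc]

end EdgeRelations

end CiliatedRibbonGraph

/-! ### The algebra homomorphisms of the vertex and face loops -/

namespace DualHopf

open WithConv Coalgebra HopfAlgebra CiliatedRibbonGraph

/-- The convolution product of algebra homomorphisms with commuting values is an algebra
homomorphism. -/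
theorem exists_algHom_prod {F C R D : Type*} [Field F] [Ring C] [Bialgebra F C] [Ring R]
    [Algebra F R] (f : D → C →ₐ[F] R) (L : List D)
    (h : L.Pairwise fun d d' => ∀ x y, Commute (f d x) (f d' y)) :
    ∃ φ : C →ₐ[F] R, toConv φ.toLinearMap = (L.map fun d => toConv (f d).toLinearMap).prod := by
  induction L with
  | nil => exact ⟨(Algebra.ofId F R).comp (Bialgebra.counitAlgHom F C), rfl⟩
  | cons d L ih =>
    obtain ⟨h₁, h₂⟩ := List.pairwise_cons.mp h
    obtain ⟨φ, hφ⟩ := ih h₂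
    have hc : ∀ x y, Commute (f d x) (φ y) := fun x y => by
      have h3 := commute_conv_prod (x := f d x) (L := L.map fun d => toConv (f d).toLinearMap)
        (fun X hX c => by
          obtain ⟨d', hd', rfl⟩ := List.mem_map.mp hX
          exact h₁ d' hd' x c) y
      rwa [← hφ] at h3
    refine ⟨(Algebra.TensorProduct.lift (f d) φ hc).comp (Bialgebra.comulAlgHom F C), ?_⟩
    rw [List.map_cons, List.prod_cons, ← hφ]
    apply WithConv.ofConv_injective
    apply LinearMap.ext
    intro c
    refine Eq.trans ?_ ((ℛ F c).convMul_apply _ _).symm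
    change Algebra.TensorProduct.lift (f d) φ hc (comul c) = _
    conv_lhs => rw [← (ℛ F c).eq]
    simp only [map_sum, Algebra.TensorProduct.lift_tmul]
    rfl

variable {F H : Type*} [Field F] [Ring H] [HopfAlgebra F H] [FiniteDimensional F H]
  {V E : Type*} [DecidableEq E] [InvolutiveAntipode F H]

local notation "S" => antipode F (A := H)
local notation "H⋆" => Module.Dual F H
local notation "𝔻" => HopfMaps.drinfeldDouble (HopfMaps.of F H)
local notation "ℌ" => HopfMaps.heisenberg (HopfMaps.of F H)

theorem liftR_list_prod {C D R : Type*} [AddCommGroup C] [Module F C] [Coalgebra F C]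
    [AddCommGroup D] [Module F D] [Coalgebra F D] [Ring R] [Algebra F R]
    (L : List (WithConv (D →ₗ[F] R))) : liftR C L.prod = (L.map (liftR C)).prod := by
  induction L with
  | nil => exact liftR_one
  | cons X L ih => rw [List.prod_cons, liftR_mul, ih, List.map_cons, List.prod_cons]

theorem liftL_list_prod {C D R : Type*} [AddCommGroup C] [Module F C] [Coalgebra F C]
    [AddCommGroup D] [Module F D] [Coalgebra F D] [Ring R] [Algebra F R]
    (L : List (WithConv (C →ₗ[F] R))) : liftL D L.prod = (L.map (liftL D)).prod := by
  induction L with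
  | nil => exact liftL_one
  | cons X L ih => rw [List.prod_cons, liftL_mul, ih, List.map_cons, List.prod_cons]

/-- The four local relations on `H` are the commutation relations of the edges and edge ends, with the
pairing as the invertible element. -/
theorem edgeRelations : EdgeRelations (fun d : E × Bool => convA (edgeA F H d))
    (fun d => convB (endB F H d)) (pair F H (EndPow F H E)) (pairInv F H (EndPow F H E)) where
  mul_inv := pair_mul_pairInv
  dep := by
    rintro ⟨e, o⟩
    cases o
    · exact comp_rel_dep convA_mul_convB_opRhoR_opR (single F H e)
    · exact comp_rel_dep convA_mul_convB_opRhoL_opL (single F H e)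
  arr := by
    rintro ⟨e, o⟩
    cases o
    · exact comp_rel_arr convA_mul_convB_opRhoR_opL (single F H e)
    · exact comp_rel_arr convA_mul_convB_opRhoL_opR (single F H e)
  comm d d' h := (liftR_liftL_comm fun _ _ => single_commute h _ _).symm

/-- Edge ends act by commuting operators. -/
theorem endB_commute {d d' : E × Bool} (h : d ≠ d') (x y : H) :
    Commute (endB F H d x) (endB F H d' y) := by
  obtain ⟨e, o⟩ := d
  obtain ⟨e', o'⟩ := d'
  by_cases he : e = e'
  · subst he
    cases o <;> cases o'
    · exact absurd rfl h
    · exact ((opL_opR_comm y x).map (single F H e)).symm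
    · exact (opL_opR_comm x y).map (single F H e)
    · exact absurd rfl h
  · exact single_commute he _ _

/-- Different oriented edges act by commuting operators. -/
theorem edgeA_commute_of_ne {d d' : E × Bool} (h : d ≠ d') (α β : H⋆) :
    Commute (edgeA F H d α) (edgeA F H d' β) := by
  obtain ⟨e, o⟩ := d
  obtain ⟨e', o'⟩ := d'
  by_cases he : e = e'
  · subst he
    cases o <;> cases o'
    · exact absurd rfl h
    · exact (opRhoR_opRhoL_comm α β).map (single F H e)
    · exact ((opRhoR_opRhoL_comm β α).map (single F H e)).symm
    · exact absurd rfl h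
  · exact single_commute he _ _

/-- Convolution products over disjoint lists commute. -/
theorem commute_of_disjoint {C R D : Type*} [Ring C] [Bialgebra F C] [Ring R]
    [Algebra F R] {f : D → C →ₐ[F] R} {L L' : List D} {φ φ' : C →ₐ[F] R}
    (hf : ∀ d d', d ≠ d' → ∀ x y, Commute (f d x) (f d' y)) (h : ∀ d ∈ L, d ∉ L')
    (hφ : toConv φ.toLinearMap = (L.map fun d => toConv (f d).toLinearMap).prod)
    (hφ' : toConv φ'.toLinearMap = (L'.map fun d => toConv (f d).toLinearMap).prod) (x y : C) :
    Commute (φ x) (φ' y) := by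
  have h1 : ∀ d ∈ L, ∀ x, Commute (f d x) (φ' y) := fun d hd x => by
    have h3 := commute_conv_prod (x := f d x) (L := L'.map fun d => toConv (f d).toLinearMap)
      (fun X hX c => by
        obtain ⟨d', hd', rfl⟩ := List.mem_map.mp hX
        exact hf d d' (fun e => h d hd (e ▸ hd')) x c) y
    rwa [← hφ'] at h3
  have h3 := commute_conv_prod (x := φ' y) (L := L.map fun d => toConv (f d).toLinearMap)
    (fun X hX c => by
      obtain ⟨d', hd', rfl⟩ := List.mem_map.mp hX
      exact (h1 d' hd' c).symm) x
  rw [← hφ] at h3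
  exact h3.symm

variable (F H)

/-- The vertex loop at `v` acts by an algebra homomorphism. -/
theorem exists_vertexHom {Γ : CiliatedRibbonGraph V E} (v : V) :
    ∃ B : H →ₐ[F] EndPow F H E,
      toConv B.toLinearMap = ((Γ.ends v).map fun d => toConv (endB F H d).toLinearMap).prod :=
  exists_algHom_prod _ _ ((Γ.ends_nodup v).imp fun h => endB_commute h)

/-- The face loop at `v` acts by an algebra homomorphism. -/
theorem exists_faceHom {Γ : CiliatedRibbonGraph V E} (hΓ : Γ.IsRegular) (v : V) :
    ∃ A : H⋆ →ₐ[F] EndPow F H E,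
      toConv A.toLinearMap = ((Γ.traversal v).map fun d => toConv (edgeA F H d).toLinearMap).prod :=
  exists_algHom_prod _ _ (((hΓ.nodup_traversal_fst v).of_map _).imp fun h => edgeA_commute_of_ne h)

/-- The algebra homomorphisms of the vertex loops and the face loops give commuting
representations of the double, one for each vertex. -/
theorem exists_loopHoms [Finite E] {Γ : CiliatedRibbonGraph V E} (hΓ : Γ.IsRegular) :
    ∃ (A : V → H⋆ →ₐ[F] EndPow F H E) (B : V → H →ₐ[F] EndPow F H E),
      (∀ v δ, powEquiv F H E ((HopfMaps.of F H).faceHol Γ v δ) = A v δ) ∧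
      (∀ v z, powEquiv F H E ((HopfMaps.of F H).vertexHol Γ v z) = B v z) ∧
      (∀ v, DoubleRel (A v) (B v)) ∧
      (∀ v w, v ≠ w → ∀ x y, Commute (A v x) (A w y)) ∧
      (∀ v w, v ≠ w → ∀ x y, Commute (A v x) (B w y)) ∧
      ∀ v w, v ≠ w → ∀ x y, Commute (B v x) (B w y) := by
  choose B hB using exists_vertexHom F H (Γ := Γ)
  choose A hA using exists_faceHom F H hΓ
  have hA' : ∀ v, convA (A v) = ((Γ.traversal v).map fun d => convA (edgeA F H d)).prod := fun v => by
    rw [convA, hA, liftL_list_prod, List.map_map]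
    rfl
  have hB' : ∀ v, convB (B v) = ((Γ.ends v).map fun d => convB (endB F H d)).prod := fun v => by
    rw [convB, hB, liftR_list_prod, List.map_map]
    rfl
  refine ⟨A, B, fun v δ => ?_, fun v z => ?_, fun v => ?_, fun v w hvw => ?_,
    fun v w hvw x y => ?_, fun v w hvw => ?_⟩
  · have hnd : ((Γ.ciliatedFace v).map Prod.fst).Nodup := by
      have := hΓ.nodup_traversal_fst v
      rwa [traversal, List.map_reverse, List.nodup_reverse] at this
    refine (hol_faceWord (Γ.ciliatedFace v) hnd ((1 : H) ⊗ₜ δ)).2.trans ?_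
    rw [projSnd_tmul, Bialgebra.counit_one, one_smul]
    exact (congrArg (fun X => X δ) (hA v)).symm
  · refine (hol_vertexWord (Γ.ends v) (hΓ.nodup_ends_fst v) (z ⊗ₜ (1 : H⋆))).2.trans ?_
    rw [projFst_tmul, one_apply, Bialgebra.counit_one, one_smul]
    exact (congrArg (fun X => X z) (hB v)).symm
  · rw [doubleRel_iff, hA', hB']
    exact edgeRelations.traversal_mul_prod pairInv_mul_pair hΓ v
  · exact commute_of_disjoint (fun d d' h => edgeA_commute_of_ne h)
      (fun d hd => hΓ.traversal_disjoint hvw hd) (hA v) (hA w)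
  · have h := edgeRelations (F := F) (H := H).traversal_commute hΓ hvw
    rw [← hA', ← hB', commute_iff_eq] at h
    have h1 := congrArg (fun X => X (x ⊗ₜ[F] y)) h
    simp only [liftL_mul_liftR_tmul, liftR_mul_liftL_tmul] at h1
    exact h1
  · refine commute_of_disjoint (fun d d' h => endB_commute h) (fun d hd hd' => hvw ?_) (hB v) (hB w)
    rw [Γ.mem_ends_iff] at hd hd'
    exact hd.symm.trans hd'

end DualHopf

/-! ### Algebra homomorphisms on tensor powers -/

section PiHom

variable {F A ι : Type*} [Field F] [AddCommMonoid A] [Module F A] [Fintype ι] [DecidableEq ι]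

theorem AlgMaps.incl_mul {a : AlgMaps F A} (ha : a.IsAlgebra) (i : ι) (x y : A) :
    a.incl i (a.mul x y) = (a.pi ι).mul (a.incl i x) (a.incl i y) := by
  simp only [AlgMaps.incl_apply, AlgMaps.pi_mul_tprod]
  congr 1
  funext j
  by_cases hj : j = i
  · subst hj; simp
  · simp [Function.update_of_ne hj, ha.mul_one]

theorem List.prod_map_mul_of_commute {M : Type*} [Monoid M] {f g : ι → M} (L : List ι)
    (hL : L.Nodup) (h : ∀ i j, i ≠ j → Commute (f i) (g j)) :
    (L.map fun i => f i * g i).prod = (L.map f).prod * (L.map g).prod := by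
  induction L with
  | nil => simp
  | cons i L ih =>
    obtain ⟨hi, hL⟩ := List.nodup_cons.mp hL
    have hc : Commute (g i) (L.map f).prod := by
      refine Commute.list_prod_right _ _ fun x hx => ?_
      obtain ⟨j, hj, rfl⟩ := List.mem_map.mp hx
      exact (h j i (fun e => hi (e ▸ hj))).symm
    simp only [List.map_cons, List.prod_cons, ih hL, mul_assoc]
    rw [← mul_assoc (g i), hc.eq, mul_assoc]

/-- Algebra homomorphisms with commuting values induce one on the tensor power. -/
theorem AlgMaps.exists_piHom {R : Type*} [Ring R] [Algebra F R] {a : AlgMaps F A}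
    (f : ι → A →ₗ[F] R) (hmul : ∀ i x y, f i (a.mul x y) = f i x * f i y)
    (hone : ∀ i, f i a.one = 1) (hcomm : ∀ i j, i ≠ j → ∀ x y, Commute (f i x) (f j y)) :
    ∃ T : (⨂[F] _ : ι, A) →ₗ[F] R, (∀ x y, T ((a.pi ι).mul x y) = T x * T y) ∧
      T (a.pi ι).one = 1 ∧ ∀ i x, T (a.incl i x) = f i x := by
  let e := Fintype.equivFin ι
  let L : List ι := List.ofFn e.symm
  have hnd : L.Nodup := List.nodup_ofFn.mpr e.symm.injective
  have hmem : ∀ i, i ∈ L := fun i => List.mem_ofFn.mpr ⟨e i, e.symm_apply_apply i⟩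
  let T : (⨂[F] _ : ι, A) →ₗ[F] R := PiTensorProduct.lift
    (((MultilinearMap.mkPiAlgebraFin F (Fintype.card ι) R).domDomCongr e.symm).compLinearMap f)
  have hT : ∀ x : ι → A, T (PiTensorProduct.tprod F x) = (L.map fun i => f i (x i)).prod := by
    intro x
    simp only [T, PiTensorProduct.lift.tprod, MultilinearMap.compLinearMap_apply,
      MultilinearMap.domDomCongr_apply, MultilinearMap.mkPiAlgebraFin_apply, L, List.map_ofFn]
    rfl
  refine ⟨T, fun x y => ?_, ?_, fun i x => ?_⟩
  · induction x using PiTensorProduct.induction_on with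
    | add x₁ x₂ h₁ h₂ => simp only [map_add, LinearMap.add_apply, h₁, h₂, add_mul]
    | smul_tprod r x =>
      induction y using PiTensorProduct.induction_on with
      | add x₁ x₂ h₁ h₂ => simp only [map_add, h₁, h₂, mul_add]
      | smul_tprod s y =>
        simp only [map_smul, LinearMap.smul_apply, AlgMaps.pi_mul_tprod, hT, hmul,
          smul_mul_assoc, mul_smul_comm]
        rw [List.prod_map_mul_of_commute L hnd fun i j hij => hcomm i j hij _ _]
  · refine (hT _).trans (List.prod_eq_one fun x hx => ?_)
    obtain ⟨i, -, rfl⟩ := List.mem_map.mp hx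
    exact hone i
  · rw [AlgMaps.incl_apply, hT, List.prod_map_eq_pow_single i _ fun j hj _ => by
      rw [Function.update_of_ne hj, hone], List.count_eq_one_of_mem hnd (hmem i), pow_one,
      Function.update_self]

/-- An algebra homomorphism on a tensor power is determined by its values on the factors. -/
theorem AlgMaps.IsAlgHom.ext_incl {B : Type*} [AddCommMonoid B] [Module F B] {a : AlgMaps F A}
    (ha : a.IsAlgebra) {b : AlgMaps F B} {f g : (⨂[F] _ : ι, A) →ₗ[F] B}
    (hf : (a.pi ι).IsAlgHom b f) (hg : (a.pi ι).IsAlgHom b g)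
    (h : ∀ i x, f (a.incl i x) = g (a.incl i x)) : f = g := by
  refine LinearMap.ext fun t => PiTensorProduct.induction_linear (fun x => ?_) t
  have key : ∀ s : Finset ι, f (PiTensorProduct.tprod F fun i => if i ∈ s then x i else a.one)
      = g (PiTensorProduct.tprod F fun i => if i ∈ s then x i else a.one) := by
    intro s
    induction s using Finset.induction_on with
    | empty =>
      simp only [Finset.notMem_empty, if_false]
      exact hf.map_one.trans hg.map_one.symm
    | insert i s hi ih =>
      have h1 : (PiTensorProduct.tprod F fun j => if j ∈ insert i s then x j else a.one)
          = (a.pi ι).mul (a.incl i (x i))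
            (PiTensorProduct.tprod F fun j => if j ∈ s then x j else a.one) := by
        rw [AlgMaps.incl_apply, AlgMaps.pi_mul_tprod]
        congr 1
        funext j
        by_cases hj : j = i
        · subst hj; simp [hi, ha.mul_one]
        · simp [hj, ha.one_mul]
      rw [h1, hf.map_mul, hg.map_mul, h, ih]
  simpa using key Finset.univ

end PiHom

section Sandwich

variable {F B D C K : Type*} [Field F] [AddCommMonoid B] [Module F B] [AddCommMonoid D]
  [Module F D] [AddCommMonoid C] [Module F C] [AddCommMonoid K] [Module F K]

/-- Conjugation with products is iterated conjugation. -/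
theorem AlgMaps.sandwich_map {b : AlgMaps F B} (hb : b.IsAlgebra) {p q : D →ₗ[F] B}
    {i : C ⊗[F] K →ₗ[F] D} {f f' : C →ₗ[F] B} {g g' : K →ₗ[F] B}
    (hp : ∀ α z, p (i (α ⊗ₜ z)) = b.mul (g' z) (f' α))
    (hq : ∀ α z, q (i (α ⊗ₜ z)) = b.mul (f α) (g z)) (X : B) (u : C ⊗[F] C) (w : K ⊗[F] K) :
    b.sandwich p q X (TensorProduct.comm F D D (TensorProduct.map i i
      (TensorProduct.tensorTensorTensorComm F C C K K (TensorProduct.comm F C C u ⊗ₜ w))))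
      = b.sandwich g' g (b.sandwich f' f X u) (TensorProduct.comm F K K w) := by
  induction w with
  | zero => simp
  | add w₁ w₂ h₁ h₂ => simp only [map_add, tmul_add, h₁, h₂]
  | tmul y z =>
    induction u with
    | zero => simp [AlgMaps.sandwich]
    | add u₁ u₂ h₁ h₂ =>
      simp only [map_add, add_tmul, h₁, h₂]
      simp [AlgMaps.sandwich]
    | tmul α β =>
      simp only [TensorProduct.comm_tmul, TensorProduct.tensorTensorTensorComm_tmul,
        TensorProduct.map_tmul, AlgMaps.sandwich, TensorProduct.lift.tmul,
        LinearMap.compl₁₂_apply, LinearMap.comp_apply, LinearMap.flip_apply, hp, hq,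
        hb.mul_assoc]

end Sandwich

/-! ### The gauge action on the triangle operators -/

namespace DualHopf

open WithConv Coalgebra HopfAlgebra

variable {F H : Type*} [Field F] [Ring H] [HopfAlgebra F H] [FiniteDimensional F H]
  [InvolutiveAntipode F H] {V E : Type*} [Fintype V] [DecidableEq V] [DecidableEq E]

local notation "S" => antipode F (A := H)
local notation "H⋆" => Module.Dual F H
local notation "𝔻" => HopfMaps.drinfeldDouble (HopfMaps.of F H)
local notation "ℌ" => HopfMaps.heisenberg (HopfMaps.of F H)

/-- Commuting representations of the double in the tensor power of the Heisenberg double combine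
to a homomorphism on the tensor power of the double. -/
theorem exists_doublePowHom {f : V → H⋆ →ₗ[F] HeisenbergPow F H E} {g : V → H →ₗ[F] HeisenbergPow F H E}
    (A : V → H⋆ →ₐ[F] EndPow F H E) (B : V → H →ₐ[F] EndPow F H E)
    (hf : ∀ v δ, powEquiv F H E (f v δ) = A v δ) (hg : ∀ v z, powEquiv F H E (g v z) = B v z)
    (hAB : ∀ v, DoubleRel (A v) (B v))
    (hAA : ∀ v w, v ≠ w → ∀ x y, Commute (A v x) (A w y))
    (hA_B : ∀ v w, v ≠ w → ∀ x y, Commute (A v x) (B w y))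
    (hBB : ∀ v w, v ≠ w → ∀ x y, Commute (B v x) (B w y)) :
    ∃ τ : DoublePow F H V →ₗ[F] HeisenbergPow F H E,
      ((𝔻).pi V).IsAlgHom ((ℌ).pi E) τ ∧
      ∀ v δ z, τ ((𝔻).incl v (δ ⊗ₜ[F] z)) = ((ℌ).pi E).mul (f v δ) (g v z) := by
  obtain ⟨T, hT₁, hT₂, hT₃⟩ := AlgMaps.exists_piHom (a := (𝔻).toAlgMaps)
    (fun v => doubleMap (A v) (B v)) (fun v => doubleMap_mul (hAB v))
    (fun v => doubleMap_one (A v) (B v)) (fun v w hvw x y => by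
      induction x with
      | zero => simp
      | add a b ha hb => rw [map_add]; exact ha.add_left hb
      | tmul α h =>
        induction y with
        | zero => simp
        | add a b ha hb => rw [map_add]; exact ha.add_right hb
        | tmul β k =>
          simp only [doubleMap_tmul]
          exact ((hAA v w hvw α β).mul_right (hA_B v w hvw α k)).mul_left
            ((hA_B w v hvw.symm β h).symm.mul_right (hBB v w hvw h k)))
  refine ⟨(powEquiv F H E).symm.toLinearMap ∘ₗ T, ⟨fun x y => ?_, ?_⟩, fun v δ z => ?_⟩
  · apply (powEquiv F H E).injective
    rw [powEquiv_mul]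
    simp only [LinearMap.comp_apply, LinearEquiv.coe_coe, LinearEquiv.apply_symm_apply]
    exact hT₁ x y
  · apply (powEquiv F H E).injective
    rw [powEquiv_one]
    simp only [LinearMap.comp_apply, LinearEquiv.coe_coe, LinearEquiv.apply_symm_apply]
    exact hT₂
  · apply (powEquiv F H E).injective
    rw [powEquiv_mul, hf, hg]
    simp only [LinearMap.comp_apply, LinearEquiv.coe_coe, LinearEquiv.apply_symm_apply]
    exact (hT₃ v _).trans (doubleMap_tmul _ _ _ _)

/-- The adjoint action of the factor at `v` is conjugation with its images of `H⋆` and `H`. -/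
theorem sandwich_incl {b : AlgMaps F (HeisenbergPow F H E)} (hb : b.IsAlgebra)
    {τ : DoublePow F H V →ₗ[F] HeisenbergPow F H E} (hτ : ((𝔻).pi V).IsAlgHom b τ)
    {f : H⋆ →ₗ[F] HeisenbergPow F H E} {g : H →ₗ[F] HeisenbergPow F H E} (v : V)
    (h : ∀ δ z, τ ((𝔻).incl v (δ ⊗ₜ[F] z)) = b.mul (f δ) (g z)) (hf : f 1 = b.one) (hg : g 1 = b.one)
    (X : HeisenbergPow F H E) (δ : H⋆) (z : H) :
    b.sandwich (τ ∘ₗ ((𝔻).pi V).antipode) τ X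
        (TensorProduct.comm F _ _ (((𝔻).pi V).comul ((𝔻).incl v (δ ⊗ₜ[F] z))))
      = b.sandwich (g ∘ₗ S) g (b.sandwich (f ∘ₗ (HopfMaps.of F H).dual.antipode) f X
          ((HopfMaps.of F H).dual.comul δ))
        (TensorProduct.comm F _ _ (comul (R := F) z)) := by
  rw [HopfMaps.pi_comul_incl drinfeldDouble_isHopfAlgebra]
  change b.sandwich (τ ∘ₗ ((𝔻).pi V).antipode) τ X (TensorProduct.comm F _ _ (TensorProduct.map _ _
    (TensorProduct.tensorTensorTensorComm F H⋆ H⋆ H H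
      (TensorProduct.comm F _ _ ((HopfMaps.of F H).dual.comul δ) ⊗ₜ comul (R := F) z)))) = _
  refine AlgMaps.sandwich_map hb (fun α z => ?_) (h · ·) X _ _
  rw [LinearMap.comp_apply, HopfMaps.pi_antipode_incl drinfeldDouble_isHopfAlgebra,
    drinfeldDouble_antipode_tmul, AlgMaps.incl_mul drinfeldDouble_isHopfAlgebra.toIsAlgebra]
  refine (hτ.map_mul _ _).trans ?_
  rw [h, h, hf, hg, hb.one_mul, hb.mul_one]
  rfl

theorem eq_one_of_powEquiv {C : Type*} [Ring C] [Algebra F C] (φ : C →ₐ[F] EndPow F H E)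
    {f : C → HeisenbergPow F H E} (h : ∀ c, powEquiv F H E (f c) = φ c) : f 1 = ((ℌ).pi E).one := by
  apply (powEquiv F H E).injective
  rw [h, map_one, powEquiv_one]

end DualHopf

end

theorem theorem6p1 {F : Type*} [Field F] [CharZero F]
    {H : Type*} [Ring H] [HopfAlgebra F H] [FiniteDimensional F H] [IsSemisimpleRing H]
    {V E : Type*} [Fintype V] [Fintype E] [DecidableEq V] [DecidableEq E]
    (Γ : CiliatedRibbonGraph V E) (hΓ : Γ.IsRegular) :
    -- the Hopf algebra of gauge transformations, and the algebra of triangle operators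
    ((HopfMaps.of F H).drinfeldDouble.pi V).IsHopfAlgebra ∧
    ((HopfMaps.of F H).heisenberg.pi E).IsAlgebra ∧
    -- the algebra map `τ`
    ∃ τ : DoublePow F H V →ₗ[F] HeisenbergPow F H E,
      (((HopfMaps.of F H).drinfeldDouble.pi V).IsAlgHom ((HopfMaps.of F H).heisenberg.pi E) τ ∧
        ∀ v δ z, τ ((HopfMaps.of F H).drinfeldDouble.incl v (δ ⊗ₜ[F] z))
          = ((HopfMaps.of F H).heisenberg.pi E).mul
              ((HopfMaps.of F H).faceHol Γ v δ) ((HopfMaps.of F H).vertexHol Γ v z)) ∧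
      (∀ τ' : DoublePow F H V →ₗ[F] HeisenbergPow F H E,
        ((HopfMaps.of F H).drinfeldDouble.pi V).IsAlgHom
            ((HopfMaps.of F H).heisenberg.pi E) τ' →
        (∀ v δ z, τ' ((HopfMaps.of F H).drinfeldDouble.incl v (δ ⊗ₜ[F] z))
          = ((HopfMaps.of F H).heisenberg.pi E).mul
              ((HopfMaps.of F H).faceHol Γ v δ) ((HopfMaps.of F H).vertexHol Γ v z)) →
        τ' = τ) ∧
      -- the right module algebra structure `X ◁ k` on `ℋ(H)^{op ⊗ E}`
      ∃ act : HeisenbergPow F H E →ₗ[F]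
          DoublePow F H V →ₗ[F] HeisenbergPow F H E,
        IsRightModuleAlgebra ((HopfMaps.of F H).drinfeldDouble.pi V)
          ((HopfMaps.of F H).heisenberg.op.pi E) act ∧
        -- `X ◁ k = τ(S(k₂)) · X · τ(k₁)`
        (∀ X k, act X k
          = ((HopfMaps.of F H).heisenberg.pi E).sandwich
              (τ ∘ₗ ((HopfMaps.of F H).drinfeldDouble.pi V).antipode) τ X
              (TensorProduct.comm F _ _ (((HopfMaps.of F H).drinfeldDouble.pi V).comul k))) ∧
        -- `X ◁ (δ ⊗ z)_v = Hol_{p_v}(S z₂ ⊗ 1) · Hol_{p_f(v)}(1 ⊗ S δ₁) · X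
        --    · Hol_{p_f(v)}(1 ⊗ δ₂) · Hol_{p_v}(z₁ ⊗ 1)`
        (∀ X v δ z, act X ((HopfMaps.of F H).drinfeldDouble.incl v (δ ⊗ₜ[F] z))
          = ((HopfMaps.of F H).heisenberg.pi E).sandwich
              ((HopfMaps.of F H).vertexHol Γ v ∘ₗ (HopfMaps.of F H).antipode)
              ((HopfMaps.of F H).vertexHol Γ v)
              (((HopfMaps.of F H).heisenberg.pi E).sandwich
                ((HopfMaps.of F H).faceHol Γ v ∘ₗ (HopfMaps.of F H).dual.antipode)
                ((HopfMaps.of F H).faceHol Γ v) X ((HopfMaps.of F H).dual.comul δ))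
              (TensorProduct.comm F _ _ ((HopfMaps.of F H).comul z))) := by
  obtain ⟨A, B, hf, hg, hAB, hAA, hA_B, hBB⟩ := DualHopf.exists_loopHoms F H hΓ
  have hD := DualHopf.drinfeldDouble_isHopfAlgebra (F := F) (H := H)
  have hE := (DualHopf.heisenberg_isAlgebra (F := F) (H := H)).pi (ι := E)
  obtain ⟨τ, hτ, hτv⟩ := DualHopf.exists_doublePowHom A B hf hg hAB hAA hA_B hBB
  obtain ⟨act, hact, hact'⟩ := exists_isRightModuleAlgebra (hD.pi (ι := V))
    (HopfMaps.pi_antipode_antipode DualHopf.drinfeldDouble_antipode_antipode) hE hτ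
  refine ⟨hD.pi, hE, τ, ⟨hτ, hτv⟩, fun τ' hτ' hτv' => ?_, act, ?_, hact', fun X v δ z => ?_⟩
  · refine hτ'.ext_incl hD.toIsAlgebra hτ fun v x => ?_
    induction x with
    | zero => simp
    | add a b ha hb => simp only [map_add, ha, hb]
    | tmul δ z => rw [hτv, hτv']
  · rw [AlgMaps.op_pi]
    exact hact
  · rw [hact']
    refine DualHopf.sandwich_incl hE hτ v (hτv v) ?_ ?_ X δ z
    · open DualHopf in exact eq_one_of_powEquiv (A v) (hf v)
    · exact DualHopf.eq_one_of_powEquiv (B v) (hg v)
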